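/- **Theorem (local uniqueness of classical solutions).** *Setting.* Fix $P>0$. Let $\mathrm X$ be the family of infinite (double-point-free) arcs $\Gamma\subset\mathbb R^2$, $P$-periodic in $x$ and directed from $x=-\infty$ to $x=\infty$, having winding number $\pm\frac12$ about every point off $\Gamma$; let $D_1(\Gamma)$ and $D_2(\Gamma)$ be the lower and upper complements of $\Gamma$ (winding number $-\frac12$, resp. $+\frac12$), and write $\Gamma<\Gamma'$ if $\mathrm{Cl}(D_1(\Gamma))\subset D_1(\Gamma')$ or $\mathrm{Cl}(D_2(\Gamma'))\subset D_2(\Gamma)$. For a pair $\mathbf\Gamma=(\Gamma_1,\Gamma_2)$ in $\mathrm X$ with $\Gamma_1<\Gamma_2$, its stream-bed is $\Omega(\mathbf\Gamma)=D_1(\Gamma_2)\cap D_2(\Gamma_1)$, and its stream function $U$ is the continuous $P$-periodic function on $\mathrm{Cl}(\Omega(\mathbf\Gamma))$ that is harmonic in $\Omega(\mathbf\Gamma)$, equal to $0$ on $\Gamma_1$ and to $1$ on $\Gamma_2$. Let $\partial^-G<\partial^+G$ be two arcs in $\mathrm X$ and let $G$ be the strip-like domain between them. Let $a:\mathbb R^2\to(0,\infty)$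 be a $P$-periodic (in $x$) $C^2$-function such that $\ln a$ is (weakly) subharmonic in $G$. A classical solution in $G$ is a pair $\mathbf\Gamma=(\Gamma_1,\Gamma_2)$ of $C^1$-arcs in $\mathrm X$ with $\partial^-G<\Gamma_1<\Gamma_2<\partial^+G$ such that $\nabla U$ extends continuously to $\mathrm{Cl}(\Omega(\mathbf\Gamma))$ and $|\nabla U|=a$ on $\Gamma_1\cup\Gamma_2$. *Claim.* Let $\mathbf\Gamma_1,\mathbf\Gamma_2$ be two classical solutions in $G$, with stream-beds $\Omega_1,\Omega_2$ and stream functions $U_1,U_2$, and suppose that some arc $\gamma\in\mathrm X$ is contained in both $\Omega_1$ and $\Omega_2$. (a) If $\mathbf\Gamma_1\ne\mathbf\Gamma_2$, then $|\nabla U_i|=a$ throughout $\Omega_i$ for $i=1,2$; the set $\Omega_1\cup\Omega_2$ is connected and $\ln a$ is harmonic in it; and there is a single harmonic function $U:\Omega_1\cup\Omega_2\to\mathbb R$ with $|\nabla U|=a$ throughout $\Omega_1\cup\Omega_2$. (b) If $\ln a$ is strictly subharmonic in $G$ (its value at the centre of any closed disc in $G$ is strictly less than its mean over the boundary circle; for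 instance $\Delta\ln a>0$ in $G$), then $\mathbf\Gamma_1=\mathbf\Gamma_2$; in particular $\Omega_1=\Omega_2$, and $U_1=U_2$ on $\mathrm{Cl}(\Omega_1)$. -/

import Mathlib

open Complex Set Filter Topology

/-- The plane is `ℂ`, with `p = x + i y`. The path `γ : ℝ → ℂ` has (total) winding number `w` about
`p` if a continuous argument of `γ t - p` increases by `2 π w` as `t` runs from `-∞` to `∞`. -/
def HasWindingNumber (γ : ℝ → ℂ) (p : ℂ) (w : ℝ) : Prop :=
  ∃ θ : ℝ → ℝ, Continuous θ ∧
    (∀ t, γ t - p = (‖γ t - p‖ : ℂ) * Complex.exp ((θ t : ℂ) * Complex.I)) ∧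
    ∃ θ₀ θ₁ : ℝ, Tendsto θ atBot (𝓝 θ₀) ∧ Tendsto θ atTop (𝓝 θ₁) ∧ θ₁ - θ₀ = 2 * Real.pi * w

/-- The class `X`: infinite arcs, `P`-periodic in `x`, directed from `x = -∞` to `x = ∞`, with
winding number `± 1/2` about every point off the arc. (One period of the parameter is normalized
to `1`; this is no restriction, and arcs are compared below through their traces.) -/
structure PeriodicArc (P : ℝ) where
  /-- the parametrization -/
  param : ℝ → ℂ
  continuous_param : Continuous param
  injective_param : Function.Injective param
  param_add_one : ∀ t, param (t + 1) = param t + (P : ℂ)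
  winding : ∀ p, p ∉ range param →
    HasWindingNumber param p (-1 / 2) ∨ HasWindingNumber param p (1 / 2)

namespace PeriodicArc

variable {P : ℝ}

/-- The arc as a set of points. -/
def trace (Γ : PeriodicArc P) : Set ℂ := range Γ.param

/-- The lower complement `D₁(Γ)`. -/
def lower (Γ : PeriodicArc P) : Set ℂ :=
  {p | p ∉ Γ.trace ∧ HasWindingNumber Γ.param p (-1 / 2)}

/-- The upper complement `D₂(Γ)`. -/
def upper (Γ : PeriodicArc P) : Set ℂ :=
  {p | p ∉ Γ.trace ∧ HasWindingNumber Γ.param p (1 / 2)}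

/-- `Γ < Γ'` : the arc `Γ` lies strictly below the arc `Γ'`. -/
def Below (Γ Γ' : PeriodicArc P) : Prop :=
  closure Γ.lower ⊆ Γ'.lower ∨ closure Γ'.upper ⊆ Γ.upper

/-- The arc is of class `C¹`: it has a regular `C¹` parametrization. -/
def IsC1 (Γ : PeriodicArc P) : Prop :=
  ∃ Γ' : PeriodicArc P, Γ'.trace = Γ.trace ∧ ContDiff ℝ 1 Γ'.param ∧ ∀ t, deriv Γ'.param t ≠ 0

end PeriodicArc

/-- The class of ordered pairs `(Γ₁, Γ₂)` of periodic arcs with `Γ₁ < Γ₂`. -/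
structure ArcPair (P : ℝ) where
  /-- the lower arc -/
  bot : PeriodicArc P
  /-- the upper arc -/
  top : PeriodicArc P
  bot_below_top : bot.Below top

namespace ArcPair

variable {P : ℝ}

/-- The strip-like region `D₁(Γ₂) ∩ D₂(Γ₁)` between the two arcs (for a solution: the
stream-bed). -/
def region (Γ : ArcPair P) : Set ℂ := Γ.top.lower ∩ Γ.bot.upper

/-- The two pairs consist of the same arcs. -/
def Same (Γ Γ' : ArcPair P) : Prop :=
  Γ.bot.trace = Γ'.bot.trace ∧ Γ.top.trace = Γ'.top.trace

/-- `Γ ∈ X(G)`, where `G` is the strip-like region between the two arcs of the pair `B`: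
`∂⁻G < Γ₁ < Γ₂ < ∂⁺G`. -/
def Inside (Γ B : ArcPair P) : Prop :=
  B.bot.Below Γ.bot ∧ Γ.top.Below B.top

end ArcPair

/-- `U` is the capacitary potential (stream function) of the pair `Γ`: continuous and `P`-periodic
on the closure of the region, harmonic in it, `0` on the lower arc and `1` on the upper arc. -/
structure IsCapacitaryPotential {P : ℝ} (Γ : ArcPair P) (U : ℂ → ℝ) : Prop where
  continuousOn : ContinuousOn U (closure Γ.region)
  periodic : ∀ p ∈ closure Γ.region, U (p + (P : ℂ)) = U p
  harmonic : InnerProductSpace.HarmonicOnNhd U Γ.region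
  eq_zero : ∀ p ∈ Γ.bot.trace, U p = 0
  eq_one : ∀ p ∈ Γ.top.trace, U p = 1

/-- `Γ`, with stream function `U`, is a classical solution of the double-free-boundary problem with
the single flow-speed `a`: both arcs are `C¹`, and `∇U` extends continuously to the closure of the
stream-bed, with `|∇U| = a` on both arcs. -/
structure IsClassicalSolution {P : ℝ} (a : ℂ → ℝ) (Γ : ArcPair P) (U : ℂ → ℝ) : Prop where
  bot_c1 : Γ.bot.IsC1
  top_c1 : Γ.top.IsC1
  potential : IsCapacitaryPotential Γ U
  bernoulli : ∃ V : ℂ → ℂ, ContinuousOn V (closure Γ.region) ∧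
    (∀ p ∈ Γ.region, V p = gradient U p) ∧
    ∀ p ∈ Γ.bot.trace ∪ Γ.top.trace, ‖V p‖ = a p

/-- (Weak) subharmonicity: upper semicontinuity and the sub-mean-value inequality on every closed
disc in `G`. -/
def SubharmonicOn (u : ℂ → ℝ) (G : Set ℂ) : Prop :=
  UpperSemicontinuousOn u G ∧
    ∀ (p : ℂ) (r : ℝ), 0 < r → Metric.closedBall p r ⊆ G → u p ≤ Real.circleAverage u p r

/-- Strict subharmonicity: the sub-mean-value inequality is strict on every closed disc in `G`.
(For a `C²` function, `Δu > 0` in `G` is sufficient.) -/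
def StrictSubharmonicOn (u : ℂ → ℝ) (G : Set ℂ) : Prop :=
  UpperSemicontinuousOn u G ∧
    ∀ (p : ℂ) (r : ℝ), 0 < r → Metric.closedBall p r ⊆ G → u p < Real.circleAverage u p r

/-!
The proof compares the two stream functions `U₁`, `U₂` on the common stream `Ω₁ ∩ Ω₂`.

*One solution.* The stream function has no critical points: its superlevel and sublevel sets are
connected, by the maximum principle (`IsFlow.isPreconnected_superlevel`), whereas near a critical
point at least four sectors would belong to them alternately, which the topology of the plane
forbids (`false_of_alternating_segments`, `IsFlow.gradient_ne_zero`). Hence `log ‖∇U‖` is harmonic,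
and `log ‖∇U‖ - log a` is superharmonic with boundary values `0`; so `‖∇U‖ ≥ a` in the stream, with
equality everywhere as soon as there is equality at one interior point (`IsFlow.le_norm_gradient`,
`IsFlow.norm_gradient_eq_of_eq`).

*Two solutions.* Suppose that the minimum `m` of `U₁ - U₂` over the closure of the common stream is
negative. It is attained at a boundary point `p` which, up to exchanging the solutions and turning
the plane upside down, lies on the lower arc of the first solution and inside the second stream.
The set `U₂ > U₂(p)` is connected, does not meet that arc and reaches the top, so it lies above the
arc, and a small disc in it that touches its boundary at `p` lies in the common stream. The normal
derivative of `U₁` at `p` is at most `a p`, and that of `U₂` is `‖∇U₂(p)‖ ≥ a p`, so Hopf's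
boundary point lemma (`hopf_boundary_point`) leaves only the possibility that `U₁ - U₂ = m` on the
disc. Then `‖∇U₂(p)‖ = a p`, and both speeds equal `a` throughout
(`IsFlowPair.eventually_eq_and_norm_eq_of_mem_bot`). The coincidence `U₁ - U₂ = m` propagates from
the disc to the whole common stream: a union of components of the common stream on which it holds
contains the dividing arc, and then fills the common stream along the upper arc of the second
solution and the lower arc of the first one, which leaves no boundary for the remaining components
(`IsFlowPair.inter_subset`). So `U₁` and `U₂` are, up to a constant, restrictions of one harmonic
function. If neither `U₁ - U₂` nor `U₂ - U₁` takes a negative value, then `U₁ = U₂` on the common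
stream, and the solutions coincide. This is the dichotomy `IsFlowPair.eq_or_norm_eq`; in its second
case `log a = log ‖∇U₁‖` is harmonic, which strict subharmonicity excludes.

The arcs bounding `G` are only continuous. That `log a` has a nonnegative Laplacian in the streams
nevertheless needs no Jordan curve theorem, as these arcs have empty interior
(`ArcPair.Inside.region_subset_closure`) and `a` is of class `C²`.
-/

/-! ### The Laplacian: maximum principle and boundary point lemma -/

/-- Second derivative of `v` at `z` along the direction `e`. -/
noncomputable def secondDeriv (v : ℂ → ℝ) (z e : ℂ) : ℝ := fderiv ℝ (fderiv ℝ v) z e e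

open InnerProductSpace in
lemma laplacian_eq_secondDeriv (v : ℂ → ℝ) (z : ℂ) :
    Laplacian.laplacian v z = secondDeriv v z 1 + secondDeriv v z I := by
  rw [laplacian_eq_iteratedFDeriv_complexPlane]
  simp [iteratedFDeriv_two_apply, secondDeriv]

lemma secondDeriv_add_secondDeriv_I_mul (v : ℂ → ℝ) (z e : ℂ) :
    secondDeriv v z e + secondDeriv v z (I * e) = ‖e‖ ^ 2 * Laplacian.laplacian v z := by
  rw [laplacian_eq_secondDeriv]
  have h1 : e = e.re • (1 : ℂ) + e.im • I := by
    apply Complex.ext <;> simp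
  have h2 : I * e = e.re • I + (-e.im) • (1 : ℂ) := by
    apply Complex.ext <;> simp
  have h3 : ‖e‖ ^ 2 = e.re ^ 2 + e.im ^ 2 := by
    rw [← Complex.normSq_eq_norm_sq, Complex.normSq_apply]; ring
  rw [h3]
  unfold secondDeriv
  rw [h2]
  generalize fderiv ℝ (fderiv ℝ v) z = B
  have h4 : B e e = B (e.re • (1 : ℂ) + e.im • I) (e.re • (1 : ℂ) + e.im • I) := by rw [← h1]
  rw [h4, map_add, map_add, map_add, map_add, map_smul, map_smul, map_smul]
  simp only [add_apply, smul_apply, map_smul, smul_eq_mul]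
  ring

lemma hasDerivAt_along_line {v : ℂ → ℝ} {p e : ℂ} {t : ℝ}
    (h : DifferentiableAt ℝ v (p + t • e)) :
    HasDerivAt (fun s : ℝ => v (p + s • e)) (fderiv ℝ v (p + t • e) e) t := by
  have h1 : HasDerivAt (fun s : ℝ => p + s • e) e t := by
    simpa using ((hasDerivAt_id t).smul_const e).const_add p
  exact h.hasFDerivAt.comp_hasDerivAt t h1

lemma hasDerivAt_fderiv_along_line {v : ℂ → ℝ} {p e : ℂ} {t : ℝ}
    (h : ContDiffAt ℝ 2 v (p + t • e)) :
    HasDerivAt (fun s : ℝ => fderiv ℝ v (p + s • e) e) (secondDeriv v (p + t • e) e) t := by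
  have h1 : HasDerivAt (fun s : ℝ => p + s • e) e t := by
    simpa using ((hasDerivAt_id t).smul_const e).const_add p
  have h2 : DifferentiableAt ℝ (fderiv ℝ v) (p + t • e) :=
    (h.fderiv_right (m := 1) (by norm_num)).differentiableAt (by norm_num)
  have h3 : HasDerivAt (fun s : ℝ => fderiv ℝ v (p + s • e))
      (fderiv ℝ (fderiv ℝ v) (p + t • e) e) t := h2.hasFDerivAt.comp_hasDerivAt t h1
  exact (ContinuousLinearMap.apply ℝ ℝ e).hasFDerivAt.comp_hasDerivAt t h3

lemma secondDeriv_nonpos_of_isLocalMax {v : ℂ → ℝ} {p : ℂ} (h : ContDiffAt ℝ 2 v p)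
    (hm : IsLocalMax v p) (e : ℂ) : secondDeriv v p e ≤ 0 := by
  by_contra! hpos
  set g : ℝ → ℝ := fun s => v (p + s • e) with hg
  have hc : ContinuousAt (fun s : ℝ => p + s • e) 0 := by fun_prop
  have hp0 : p + (0 : ℝ) • e = p := by simp
  have ht : Tendsto (fun s : ℝ => p + s • e) (𝓝 0) (𝓝 p) := by
    simpa [ContinuousAt] using hc
  have hev : ∀ᶠ s : ℝ in 𝓝 0, deriv g s = fderiv ℝ v (p + s • e) e := by
    filter_upwards [ht.eventually (h.eventually (by simp))] with s hs
    exact (hasDerivAt_along_line (hs.differentiableAt (by norm_num))).deriv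
  have h2 : deriv (deriv g) 0 = secondDeriv v p e := by
    rw [(show deriv g =ᶠ[𝓝 0] _ from hev).deriv_eq]
    have := (hasDerivAt_fderiv_along_line (v := v) (p := p) (e := e) (t := 0)
      (by simpa using h)).deriv
    rw [this, hp0]
  have hgm : IsLocalMax g 0 := by
    have := ht.eventually hm
    filter_upwards [this] with s hs
    simpa [hg] using hs
  have h1 : deriv g 0 = 0 := hgm.deriv_eq_zero
  have hgc : ContinuousAt g 0 := by
    have : ContinuousAt v (p + (0 : ℝ) • e) := by rw [hp0]; exact h.continuousAt
    exact ContinuousAt.comp (f := fun s : ℝ => p + s • e) this hc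
  have hmin : IsLocalMin g 0 := isLocalMin_of_deriv_deriv_pos (by rw [h2]; exact hpos) h1 hgc
  have hconst : g =ᶠ[𝓝 0] fun _ => g 0 := by
    filter_upwards [hmin, hgm] with s h1 h2 using le_antisymm h2 h1
  have : deriv (deriv g) 0 = 0 := by
    rw [hconst.deriv.deriv_eq]; simp
  rw [h2] at this
  exact hpos.ne' this

lemma laplacian_nonpos_of_isLocalMax {v : ℂ → ℝ} {p : ℂ} (h : ContDiffAt ℝ 2 v p)
    (hm : IsLocalMax v p) : Laplacian.laplacian v p ≤ 0 := by
  rw [laplacian_eq_secondDeriv]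
  exact add_nonpos (secondDeriv_nonpos_of_isLocalMax h hm 1)
    (secondDeriv_nonpos_of_isLocalMax h hm I)

lemma laplacian_sq_re (c z : ℂ) :
    Laplacian.laplacian (fun w : ℂ => ((w - c).re) ^ 2) z = 2 := by
  have h1 : fderiv ℝ (fun w : ℂ => ((w - c).re) ^ 2) =
      fun w => (2 * (w - c).re) • reCLM := by
    ext1 w
    have h : HasFDerivAt (fun w : ℂ => (w - c).re) reCLM w :=
      reCLM.hasFDerivAt.comp w ((hasFDerivAt_id w).sub_const c)
    have := (h.pow 2).fderiv
    simpa using this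
  have h2 : fderiv ℝ (fun w : ℂ => (2 * (w - c).re) • reCLM) z =
      ((2 : ℝ) • reCLM).smulRight reCLM := by
    have h : HasFDerivAt (fun w : ℂ => (w - c).re) reCLM z :=
      reCLM.hasFDerivAt.comp z ((hasFDerivAt_id z).sub_const c)
    exact ((h.const_mul 2).smul_const reCLM).fderiv
  rw [laplacian_eq_secondDeriv, secondDeriv, secondDeriv, h1, h2]
  simp

open InnerProductSpace in
/-- Hopf's boundary point lemma in quantitative form: a `C²` function with nonnegative Laplacian on
a disc that stays below `M` inside drops at least linearly from `M` as one moves inwards. The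
barrier is the logarithm of the distance to the centre. -/
lemma hopf_boundary_point {v : ℂ → ℝ} {c : ℂ} {R M : ℝ} (hR : 0 < R)
    (hc : ContinuousOn v (Metric.closedBall c R))
    (hd : ∀ z ∈ Metric.ball c R, ContDiffAt ℝ 2 v z)
    (hΔ : ∀ z ∈ Metric.ball c R, 0 ≤ Laplacian.laplacian v z)
    (hle : ∀ z ∈ Metric.closedBall c R, v z ≤ M) (hlt : ∀ z ∈ Metric.ball c R, v z < M) :
    ∃ κ > 0, ∀ z ∈ Metric.closedBall c R, R / 2 ≤ dist z c → v z ≤ M - κ * (R - dist z c) := by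
  obtain ⟨δ, hδ, hδle⟩ : ∃ δ > 0, ∀ z ∈ Metric.closedBall c (R / 2), v z ≤ M - δ := by
    have hsub : Metric.closedBall c (R / 2) ⊆ Metric.ball c R :=
      Metric.closedBall_subset_ball (by linarith)
    obtain ⟨z0, hz0, hmax⟩ := (isCompact_closedBall c (R / 2)).exists_isMaxOn
      ⟨c, Metric.mem_closedBall_self (by linarith)⟩
      (hc.mono (hsub.trans Metric.ball_subset_closedBall))
    refine ⟨M - v z0, by linarith [hlt z0 (hsub hz0)], fun z hz => ?_⟩
    have := hmax hz
    simp only [mem_ofPred_eq] at this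
    linarith
  have hlog2 : 0 < Real.log 2 := Real.log_pos (by norm_num)
  set k := δ / Real.log 2 with hk
  have hkpos : 0 < k := by positivity
  -- comparison with the barrier on the annulus `R / 2 ≤ dist z c ≤ R`
  have key : ∀ z ∈ Metric.closedBall c R, R / 2 ≤ dist z c →
      v z + k * (Real.log R - Real.log (dist z c)) ≤ M := by
    intro z0 hz0 hz0'
    by_contra! hcon
    set d := v z0 + k * (Real.log R - Real.log (dist z0 c)) - M with hd'
    have hdpos : 0 < d := by linarith
    set ε := d / (2 * R ^ 2) with hε
    have hεpos : 0 < ε := by positivity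
    -- the quadratic perturbation makes the Laplacian strictly positive at an interior maximum
    set ψ : ℂ → ℝ := fun z => v z + (k * Real.log R - k * Real.log ‖z - c‖) +
      ε * ((z - c).re ^ 2 - R ^ 2) with hψ
    set K := Metric.closedBall c R \ Metric.ball c (R / 2) with hK
    have hKc : IsCompact K := (isCompact_closedBall c R).diff Metric.isOpen_ball
    have hne : ∀ z ∈ K, z - c ≠ 0 := by
      intro z hz h0
      apply hz.2
      rw [sub_eq_zero] at h0
      rw [h0]; exact Metric.mem_ball_self (by linarith)
    have hψc : ContinuousOn ψ K := by
      refine ContinuousOn.add (ContinuousOn.add (hc.mono sdiff_subset) ?_) (by fun_prop)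
      refine continuousOn_const.sub (continuousOn_const.mul ?_)
      exact ContinuousOn.log (by fun_prop) (fun z hz => norm_ne_zero_iff.2 (hne z hz))
    have hz0K : z0 ∈ K := ⟨hz0, by simpa [Metric.mem_ball] using hz0'⟩
    obtain ⟨z1, hz1, hmax⟩ := hKc.exists_isMaxOn ⟨z0, hz0K⟩ hψc
    have hre : ∀ z ∈ Metric.closedBall c R, (z - c).re ^ 2 ≤ R ^ 2 := by
      intro z hz
      have h1 : |(z - c).re| ≤ R := (abs_re_le_norm _).trans (by simpa [dist_eq_norm] using hz)
      exact sq_le_sq' (by linarith [neg_abs_le (z - c).re]) ((le_abs_self _).trans h1)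
    have hψ0 : M < ψ z0 := by
      have : ε * R ^ 2 = d / 2 := by rw [hε]; field_simp
      have h2 : 0 ≤ ε * (z0 - c).re ^ 2 := by positivity
      simp only [hψ, ← dist_eq_norm]
      nlinarith
    have hψ1 : M < ψ z1 := lt_of_lt_of_le hψ0 (hmax hz0K)
    have hneg : ε * ((z1 - c).re ^ 2 - R ^ 2) ≤ 0 :=
      mul_nonpos_of_nonneg_of_nonpos hεpos.le (by linarith [hre z1 hz1.1])
    have hz1R : dist z1 c ≤ R := hz1.1
    have hz1R' : R / 2 ≤ dist z1 c := by simpa [Metric.mem_ball] using hz1.2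
    rcases hz1R.lt_or_eq with hlt1 | heq
    · rcases hz1R'.lt_or_eq with hlt2 | heq
      · have hz1b : z1 ∈ Metric.ball c R := hlt1
        have hnhds : K ∈ 𝓝 z1 := by
          have : {z : ℂ | R / 2 < dist z c ∧ dist z c < R} ∈ 𝓝 z1 :=
            IsOpen.mem_nhds
              ((isOpen_lt continuous_const (continuous_id.dist continuous_const)).inter
              (isOpen_lt (continuous_id.dist continuous_const) continuous_const)) ⟨hlt2, hlt1⟩
          filter_upwards [this] with z hz
          exact ⟨hz.2.le, by simpa [Metric.mem_ball] using hz.1.le⟩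
        have hlm : IsLocalMax ψ z1 := hmax.isLocalMax hnhds
        have hharm : HarmonicAt (fun z : ℂ => Real.log ‖z - c‖) z1 :=
          AnalyticAt.harmonicAt_log_norm (f := fun z => z - c) (by fun_prop) (hne z1 hz1)
        have hA : ContDiffAt ℝ 2 (fun z : ℂ => k * Real.log R - k * Real.log ‖z - c‖) z1 :=
          contDiffAt_const.sub (contDiffAt_const.mul hharm.1)
        have hB : ContDiffAt ℝ 2 (fun z : ℂ => ε * ((z - c).re ^ 2 - R ^ 2)) z1 := by
          have : ContDiff ℝ 2 (fun z : ℂ => (z - c).re) :=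
            reCLM.contDiff.comp (contDiff_id.sub contDiff_const)
          exact (contDiff_const.mul ((this.pow 2).sub contDiff_const)).contDiffAt
        have hlapA : Laplacian.laplacian
            (fun z : ℂ => k * Real.log R - k * Real.log ‖z - c‖) z1 = 0 := by
          have h1 : HarmonicAt (fun z : ℂ => k * Real.log R - k * Real.log ‖z - c‖) z1 :=
            (harmonicAt_const (k * Real.log R)).sub (hharm.const_smul (c := k))
          exact h1.2.eq_of_nhds
        have hlapB : Laplacian.laplacian (fun z : ℂ => ε * ((z - c).re ^ 2 - R ^ 2)) z1
            = ε * 2 := by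
          have hS : ContDiffAt ℝ 2 (fun z : ℂ => (z - c).re ^ 2) z1 := by
            have : ContDiff ℝ 2 (fun z : ℂ => (z - c).re) :=
              reCLM.contDiff.comp (contDiff_id.sub contDiff_const)
            exact (this.pow 2).contDiffAt
          have h1 : (fun z : ℂ => ε * ((z - c).re ^ 2 - R ^ 2)) =
              ε • ((fun z : ℂ => (z - c).re ^ 2) - fun _ => R ^ 2) := by
            ext z; simp
          have hC : ContDiffAt ℝ 2 (fun _ : ℂ => R ^ 2) z1 := contDiffAt_const
          have h2 : ContDiffAt ℝ 2 ((fun z : ℂ => (z - c).re ^ 2) - fun _ => R ^ 2) z1 := hS.sub hC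
          rw [h1, laplacian_smul ε h2, hS.laplacian_sub hC, laplacian_sq_re]
          simp
        have hv := hd z1 hz1b
        have h1 := laplacian_nonpos_of_isLocalMax ((hv.add hA).add hB) hlm
        have h2 : Laplacian.laplacian ψ z1 = Laplacian.laplacian v z1 + 0 + ε * 2 := by
          have hvA : ContDiffAt ℝ 2
              (v + fun z : ℂ => k * Real.log R - k * Real.log ‖z - c‖) z1 := hv.add hA
          rw [← hlapA, ← hlapB, ← hv.laplacian_add hA, ← hvA.laplacian_add hB]
          rfl
        have h3 := hΔ z1 hz1b
        have h4 : Laplacian.laplacian ψ z1 ≤ 0 := h1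
        linarith
      · have h1 := hδle z1 heq.symm.le
        have h2 : k * Real.log R - k * Real.log ‖z1 - c‖ = δ := by
          rw [← dist_eq_norm, ← heq, Real.log_div hR.ne' (by norm_num), hk]
          field_simp; ring
        simp only [hψ, h2] at hψ1
        linarith
    · have h1 := hle z1 hz1.1
      simp only [hψ, ← dist_eq_norm, heq, sub_self, add_zero] at hψ1
      linarith
  refine ⟨k / R, by positivity, fun z hz hz' => ?_⟩
  have h1 := key z hz hz'
  have hpos : 0 < dist z c := by linarith
  have h2 : (R - dist z c) / R ≤ Real.log R - Real.log (dist z c) := by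
    have := Real.log_le_sub_one_of_pos (show 0 < dist z c / R by positivity)
    rw [Real.log_div hpos.ne' hR.ne'] at this
    have h3 : (R - dist z c) / R = 1 - dist z c / R := by field_simp
    linarith
  have h3 : k / R * (R - dist z c) = k * ((R - dist z c) / R) := by ring
  rw [h3]
  nlinarith [mul_le_mul_of_nonneg_left h2 hkpos.le]

lemma le_neg_of_le_linear_of_hasDerivWithinAt {g : ℝ → ℝ} {κ r d : ℝ} (hr : 0 < r)
    (h : ∀ t ∈ Ioo 0 r, g t ≤ g 0 - κ * t) (hd : HasDerivWithinAt g d (Ioi 0) 0) : d ≤ -κ := by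
  have h1 := (hasDerivWithinAt_iff_tendsto_slope' (by simp)).1 hd
  refine le_of_tendsto h1 ?_
  filter_upwards [Ioo_mem_nhdsGT hr] with t ht
  rw [slope_def_field, sub_zero, div_le_iff₀ ht.1]
  linarith [h t ht]

/-- Strong maximum principle for `C²` functions with nonnegative Laplacian, local form. -/
lemma eventually_eq_of_isLocalMax {v : ℂ → ℝ} {p : ℂ}
    (hd : ∀ᶠ z in 𝓝 p, ContDiffAt ℝ 2 v z)
    (hΔ : ∀ᶠ z in 𝓝 p, 0 ≤ Laplacian.laplacian v z) (hm : IsLocalMax v p) :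
    ∀ᶠ z in 𝓝 p, v z = v p := by
  obtain ⟨ρ, hρ, hball⟩ := Metric.eventually_nhds_iff_ball.1 (hd.and (hΔ.and hm))
  rw [Metric.eventually_nhds_iff_ball]
  refine ⟨ρ / 3, by linarith, fun q hq => ?_⟩
  by_contra hne
  have hmem : ∀ z, dist z p < ρ → z ∈ Metric.ball p ρ := fun z hz => hz
  -- the largest disc about `q` on which `v < v p` touches the contact set at a point `p'`; there
  -- the gradient vanishes, contrary to the boundary point lemma
  set F := Metric.closedBall p (2 * ρ / 3) ∩ {z | v z = v p} with hF
  have hcont : ContinuousOn v (Metric.ball p ρ) := fun z hz =>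
    (hball z hz).1.continuousAt.continuousWithinAt
  have hFc : IsCompact F := by
    refine (isCompact_closedBall p (2 * ρ / 3)).of_isClosed_subset ?_ inter_subset_left
    have := (hcont.mono (Metric.closedBall_subset_ball (by linarith :
      2 * ρ / 3 < ρ))).preimage_isClosed_of_isClosed Metric.isClosed_closedBall
      (isClosed_singleton (x := v p))
    exact this
  have hpF : p ∈ F := ⟨Metric.mem_closedBall_self (by positivity), rfl⟩
  obtain ⟨p', hp', hinf⟩ := hFc.exists_infDist_eq_dist ⟨p, hpF⟩ q
  set R := dist q p' with hRdef
  have hRle : R ≤ dist q p := by rw [← hinf]; exact Metric.infDist_le_dist_of_mem hpF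
  have hqp : dist q p < ρ / 3 := hq
  have hqF : v q ≠ v p := hne
  have hR : 0 < R := by
    refine dist_pos.2 fun h => hqF ?_
    rw [h]; exact hp'.2
  have hsub : Metric.closedBall q R ⊆ Metric.ball p ρ := by
    intro z hz
    have h1 : dist z q ≤ R := hz
    have := dist_triangle z q p
    rw [Metric.mem_ball]; linarith
  have hlt : ∀ z ∈ Metric.ball q R, v z < v p := by
    intro z hz
    have h1 : dist z q < R := hz
    refine lt_of_le_of_ne (hball z (hsub (Metric.ball_subset_closedBall hz))).2.2 fun h => ?_
    have h2 : z ∈ F := by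
      refine ⟨?_, h⟩
      have := dist_triangle z q p
      rw [Metric.mem_closedBall]; linarith
    have h3 := Metric.infDist_le_dist_of_mem (x := q) h2
    rw [hinf, dist_comm q z] at h3
    linarith
  obtain ⟨κ, hκ, hκle⟩ := hopf_boundary_point (M := v p) hR (hcont.mono hsub)
    (fun z hz => (hball z (hsub (Metric.ball_subset_closedBall hz))).1)
    (fun z hz => (hball z (hsub (Metric.ball_subset_closedBall hz))).2.1)
    (fun z hz => (hball z (hsub hz)).2.2) hlt
  have hp'b : p' ∈ Metric.ball p ρ := hsub (by rw [Metric.mem_closedBall, dist_comm])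
  have hp'max : IsLocalMax v p' := by
    filter_upwards [Metric.isOpen_ball.mem_nhds hp'b] with z hz
    rw [hp'.2]; exact (hball z hz).2.2
  have hder := hasDerivAt_along_line (v := v) (p := p') (e := q - p') (t := 0)
    (by simpa using (hball p' hp'b).1.differentiableAt (by norm_num))
  rw [show p' + (0 : ℝ) • (q - p') = p' by simp, hp'max.fderiv_eq_zero] at hder
  have := le_neg_of_le_linear_of_hasDerivWithinAt (κ := κ * R) (r := 1 / 2) (by norm_num)
    (fun t ht => ?_) (hder.hasDerivWithinAt (s := Ioi 0))
  · simp only [zero_apply] at this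
    nlinarith
  · have hdist : dist (p' + t • (q - p')) q = (1 - t) * R := by
      rw [dist_eq_norm, show p' + t • (q - p') - q = (1 - t) • (p' - q) by
        simp only [real_smul]; push_cast; ring, norm_smul, Real.norm_of_nonneg (by linarith [ht.2]),
        ← dist_eq_norm, dist_comm]
    have h1 := hκle (p' + t • (q - p')) (by
      rw [Metric.mem_closedBall, hdist]; nlinarith [ht.1]) (by rw [hdist]; nlinarith [ht.2])
    rw [hdist] at h1
    simp only [zero_smul, add_zero]
    rw [hp'.2]
    linarith

/-- Converse of the mean value inequality, at a point: for a `C²` function, the sub-mean-value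
inequality on small circles forces a nonnegative Laplacian. Averaging over the four rotations by
right angles cancels the first-order terms, so that otherwise the restriction to each ray would be
strictly concave with vanishing slope at the centre. -/
lemma laplacian_nonneg_of_le_circleAverage {u : ℂ → ℝ} {q : ℂ} {r₀ : ℝ} (hr₀ : 0 < r₀)
    (hu : ContDiffAt ℝ 2 u q)
    (hsub : ∀ r, 0 < r → r < r₀ → u q ≤ Real.circleAverage u q r) :
    0 ≤ Laplacian.laplacian u q := by
  by_contra! hneg
  set Λ := Laplacian.laplacian u q with hΛ
  have hcont : ContinuousAt (fderiv ℝ (fderiv ℝ u)) q :=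
    ((hu.fderiv_right (m := 1) (by norm_num)).fderiv_right (m := 0) (by norm_num)).continuousAt
  have hclose : ∀ᶠ z in 𝓝 q, ‖fderiv ℝ (fderiv ℝ u) z - fderiv ℝ (fderiv ℝ u) q‖ < -Λ / 4 := by
    have h1 := ContinuousAt.norm (E := ℂ →L[ℝ] ℂ →L[ℝ] ℝ)
      (hcont.sub (continuousAt_const (y := fderiv ℝ (fderiv ℝ u) q)))
    refine h1.eventually_lt continuousAt_const ?_
    rw [Pi.sub_apply, sub_self]
    exact (norm_zero (E := ℂ →L[ℝ] ℂ →L[ℝ] ℝ)).trans_lt (by linarith)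
  obtain ⟨δ, hδ, hball⟩ := Metric.eventually_nhds_iff_ball.1
    ((hu.eventually (by simp)).and hclose)
  set r := min δ r₀ / 2 with hr
  have hmin : 0 < min δ r₀ := lt_min hδ hr₀
  have hrpos : 0 < r := by positivity
  have hrδ : r < δ := by have := min_le_left δ r₀; linarith
  have hrr₀ : r < r₀ := by have := min_le_right δ r₀; linarith
  have hnear : ∀ z e : ℂ, z ∈ Metric.ball q δ → ‖e‖ = 1 →
      secondDeriv u z e < secondDeriv u q e + -Λ / 4 := by
    intro z e hz he
    have h1 := (hball z hz).2
    have h2 : |secondDeriv u z e - secondDeriv u q e| ≤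
        ‖fderiv ℝ (fderiv ℝ u) z - fderiv ℝ (fderiv ℝ u) q‖ := by
      have := (fderiv ℝ (fderiv ℝ u) z - fderiv ℝ (fderiv ℝ u) q).le_opNorm₂ e e
      simpa [he, secondDeriv] using this
    linarith [le_abs_self (secondDeriv u z e - secondDeriv u q e)]
  -- the mean over four points of a circle at right angles is less than the value at the centre
  have hray : ∀ e : ℂ, ‖e‖ = 1 →
      u (q + r • e) + u (q + r • (I * e)) + u (q + r • (I * (I * e)))
        + u (q + r • (I * (I * (I * e)))) < 4 * u q := by
    intro e he
    have he1 : ‖I * e‖ = 1 := by simp [he]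
    have he2 : ‖I * (I * e)‖ = 1 := by simp [he]
    have he3 : ‖I * (I * (I * e))‖ = 1 := by simp [he]
    have hmem : ∀ t ∈ Icc 0 r, ∀ e' : ℂ, ‖e'‖ = 1 → q + t • e' ∈ Metric.ball q δ := by
      intro t ht e' he'
      rw [Metric.mem_ball, dist_eq_norm, add_sub_cancel_left, norm_smul, he', mul_one,
        Real.norm_of_nonneg ht.1]
      linarith [ht.2]
    set g : ℝ → ℝ := fun t => u (q + t • e) + u (q + t • (I * e)) + u (q + t • (I * (I * e)))
        + u (q + t • (I * (I * (I * e)))) with hg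
    set g' : ℝ → ℝ := fun t => fderiv ℝ u (q + t • e) e + fderiv ℝ u (q + t • (I * e)) (I * e)
        + fderiv ℝ u (q + t • (I * (I * e))) (I * (I * e))
        + fderiv ℝ u (q + t • (I * (I * (I * e)))) (I * (I * (I * e))) with hg'
    have hd1 : ∀ t ∈ Icc 0 r, HasDerivAt g (g' t) t := by
      intro t ht
      have := fun e' he' => hasDerivAt_along_line (v := u) (p := q) (e := e') (t := t)
        ((hball _ (hmem t ht e' he')).1.differentiableAt (by norm_num))
      exact (((this _ he).add (this _ he1)).add (this _ he2)).add (this _ he3)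
    have hd2 : ∀ t ∈ Icc 0 r, HasDerivAt g' (secondDeriv u (q + t • e) e
        + secondDeriv u (q + t • (I * e)) (I * e)
        + secondDeriv u (q + t • (I * (I * e))) (I * (I * e))
        + secondDeriv u (q + t • (I * (I * (I * e)))) (I * (I * (I * e)))) t := by
      intro t ht
      have := fun e' he' => hasDerivAt_fderiv_along_line (v := u) (p := q) (e := e') (t := t)
        ((hball _ (hmem t ht e' he')).1)
      exact (((this _ he).add (this _ he1)).add (this _ he2)).add (this _ he3)
    have hg'0 : g' 0 = 0 := by
      have : e + I * e + I * (I * e) + I * (I * (I * e)) = 0 := by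
        linear_combination (e + I * e) * I_mul_I
      simp only [hg', zero_smul, add_zero, ← map_add, this, map_zero]
    have hanti' : StrictAntiOn g' (Icc 0 r) := by
      refine strictAntiOn_of_deriv_neg (convex_Icc 0 r)
        (fun t ht => (hd2 t ht).continuousAt.continuousWithinAt) fun t ht => ?_
      have ht' := interior_subset ht
      rw [(hd2 t ht').deriv]
      have a0 := hnear _ _ (hmem t ht' _ he) he
      have a1 := hnear _ _ (hmem t ht' _ he1) he1
      have a2 := hnear _ _ (hmem t ht' _ he2) he2
      have a3 := hnear _ _ (hmem t ht' _ he3) he3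
      have b0 := secondDeriv_add_secondDeriv_I_mul u q e
      have b1 := secondDeriv_add_secondDeriv_I_mul u q (I * (I * e))
      rw [he, ← hΛ] at b0
      rw [he2, ← hΛ] at b1
      linarith
    have hanti : StrictAntiOn g (Icc 0 r) := by
      refine strictAntiOn_of_deriv_neg (convex_Icc 0 r)
        (fun t ht => (hd1 t ht).continuousAt.continuousWithinAt) fun t ht => ?_
      have ht' := interior_subset ht
      rw [interior_Icc] at ht
      rw [(hd1 t ht').deriv, ← hg'0]
      exact hanti' (left_mem_Icc.2 hrpos.le) ht' ht.1
    have := hanti (left_mem_Icc.2 hrpos.le) (right_mem_Icc.2 hrpos.le) hrpos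
    simp only [hg, zero_smul, add_zero] at this
    linarith
  have hcm : ∀ (θ : ℝ) , circleMap q r θ = q + r • exp (θ * I) := by
    intro θ; simp [circleMap]
  have hrot : ∀ θ : ℝ, exp ((θ + Real.pi / 2 : ℝ) * I) = I * exp (θ * I) := by
    intro θ
    push_cast
    rw [add_mul, Complex.exp_add, exp_pi_div_two_mul_I, mul_comm]
  have hccirc : ∀ η : ℝ, Continuous fun θ : ℝ => u (circleMap q r (θ + η)) := by
    intro η
    rw [continuous_iff_continuousAt]
    intro θ
    have hmem : circleMap q r (θ + η) ∈ Metric.ball q δ := by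
      rw [Metric.mem_ball, dist_eq_norm]; simp [abs_of_pos hrpos, hrδ]
    have h1 : ContinuousAt u (circleMap q r (θ + η)) := (hball _ hmem).1.continuousAt
    have h2 : ContinuousAt (fun θ : ℝ => circleMap q r (θ + η)) θ :=
      ((continuous_circleMap q r).comp (continuous_add_const η)).continuousAt
    exact ContinuousAt.comp (f := fun θ : ℝ => circleMap q r (θ + η)) h1 h2
  have havg : ∀ η : ℝ, ∫ θ in (0 : ℝ)..2 * Real.pi, u (circleMap q r (θ + η)) =
      2 * Real.pi * Real.circleAverage u q r := by
    intro η
    rw [Real.circleAverage_eq_integral_add η, smul_eq_mul]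
    field_simp
  have hint : ∀ η : ℝ, IntervalIntegrable (fun θ : ℝ => u (circleMap q r (θ + η)))
      MeasureTheory.volume 0 (2 * Real.pi) := fun η => (hccirc η).intervalIntegrable _ _
  have hpos : 0 < ∫ θ in (0 : ℝ)..2 * Real.pi, (4 * u q - (u (circleMap q r (θ + 0))
      + u (circleMap q r (θ + Real.pi / 2)) + u (circleMap q r (θ + (Real.pi / 2 + Real.pi / 2)))
      + u (circleMap q r (θ + (Real.pi / 2 + Real.pi / 2 + Real.pi / 2))))) := by
    refine intervalIntegral.intervalIntegral_pos_of_pos_on ?_ (fun θ _ => ?_) Real.two_pi_pos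
    · exact intervalIntegrable_const.sub ((((hint _).add (hint _)).add (hint _)).add (hint _))
    · have := hray (exp (θ * I)) (norm_exp_ofReal_mul_I θ)
      simp only [← hrot, ← hcm] at this
      simp only [add_zero, ← add_assoc]
      linarith
  rw [intervalIntegral.integral_sub intervalIntegrable_const
      ((((hint _).add (hint _)).add (hint _)).add (hint _)),
    intervalIntegral.integral_add (((hint _).add (hint _)).add (hint _)) (hint _),
    intervalIntegral.integral_add ((hint _).add (hint _)) (hint _),
    intervalIntegral.integral_add (hint _) (hint _), havg, havg, havg, havg,
    intervalIntegral.integral_const, smul_eq_mul] at hpos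
  have := hsub r hrpos hrr₀
  nlinarith [Real.pi_pos]

/-! ### Crossing arcs in the plane -/

/-- A nonvanishing continuous function on a convex set has a continuous logarithm. -/
lemma exists_continuousOn_log_of_convex {E : Type*} [NormedAddCommGroup E] [NormedSpace ℝ E]
    {Q : Set E} (hQ : Convex ℝ Q) (hne : Q.Nonempty) {F : E → ℂ} (hF : ContinuousOn F Q)
    (h0 : ∀ q ∈ Q, F q ≠ 0) :
    ∃ l : E → ℂ, ContinuousOn l Q ∧ ∀ q ∈ Q, exp (l q) = F q := by
  classical
  have : ContractibleSpace Q := hQ.contractibleSpace hne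
  have : LocallyPathConnectedSpace Q := hQ.locallyPathConnectedSpace
  obtain ⟨a, ha⟩ := hne
  obtain ⟨L, ⟨-, hL⟩, -⟩ := Complex.isCoveringMapOn_exp.existsUnique_continuousMap_lifts
    (A := Q) ⟨Q.domRestrict F, hF.domRestrict⟩ (a₀ := ⟨a, ha⟩) (e₀ := Complex.log (F a))
    (Complex.exp_log (h0 a ha)) (fun q => h0 q q.2)
  refine ⟨fun q => if h : q ∈ Q then L ⟨q, h⟩ else 0, ?_, fun q hq => ?_⟩
  · rw [continuousOn_iff_continuous_domRestrict]
    convert L.continuous using 1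
    ext q
    simp
  · have := congrFun hL ⟨q, hq⟩
    simp only [hq, dif_pos]
    exact this

/-- Two continuous logarithms of the same function on a connected set have the same increments. -/
lemma sub_eq_sub_of_exp_eq {f g : ℝ → ℂ} {S : Set ℝ} (hS : IsPreconnected S)
    (hf : ContinuousOn f S) (hg : ContinuousOn g S) (h : ∀ t ∈ S, exp (f t) = exp (g t))
    {a b : ℝ} (ha : a ∈ S) (hb : b ∈ S) : f a - f b = g a - g b := by
  have hint : ∀ t ∈ S, ∃ n : ℤ, f t = g t + n * (2 * Real.pi * I) := fun t ht =>
    Complex.exp_eq_exp_iff_exists_int.1 (h t ht)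
  set k : ℝ → ℝ := fun t => (f t - g t).im / (2 * Real.pi) with hk
  have hkc : ContinuousOn k S := (Complex.continuous_im.comp_continuousOn (hf.sub hg)).div_const _
  have hkn : ∀ t ∈ S, ∃ n : ℤ, k t = n ∧ f t = g t + n * (2 * Real.pi * I) := by
    intro t ht
    obtain ⟨n, hn⟩ := hint t ht
    refine ⟨n, ?_, hn⟩
    simp only [hk, hn]
    have := Real.pi_ne_zero
    simp
  have hkab : k a = k b := by
    by_contra hne
    wlog hlt : k a < k b generalizing a b
    · exact this hb ha (Ne.symm hne) (lt_of_le_of_ne (not_lt.1 hlt) (Ne.symm hne))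
    obtain ⟨n, hn, -⟩ := hkn a ha
    obtain ⟨m, hm, -⟩ := hkn b hb
    have hnm : n + 1 ≤ m := by
      rw [hn, hm] at hlt
      exact_mod_cast hlt
    have hmem : k a + 1 / 2 ∈ Icc (k a) (k b) := by
      have : (n : ℝ) + 1 ≤ m := by exact_mod_cast hnm
      constructor <;> linarith
    obtain ⟨t, ht, hkt⟩ := hS.intermediate_value ha hb hkc hmem
    obtain ⟨j, hj, -⟩ := hkn t ht
    rw [hj, hn] at hkt
    have : (2 * j : ℝ) = 2 * n + 1 := by linarith
    have : 2 * j = 2 * n + 1 := by exact_mod_cast this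
    omega
  obtain ⟨n, hn, hn'⟩ := hkn a ha
  obtain ⟨m, hm, hm'⟩ := hkn b hb
  have : (n : ℝ) = m := by rw [← hn, ← hm, hkab]
  have : n = m := by exact_mod_cast this
  rw [hn', hm', this]; ring

/-- The increment of a logarithm along a segment that avoids a half-line. -/
lemma sub_eq_log_div_of_exp_eq_segment {f : ℝ → ℂ} {a b : ℂ} (ha : a ≠ 0)
    (hf : ContinuousOn f (Icc 0 1)) (h : ∀ t ∈ Icc (0 : ℝ) 1, exp (f t) = (1 - t) * a + t * b)
    (hab : b / a ∈ slitPlane) : f 1 - f 0 = Complex.log (b / a) := by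
  have hslit : ∀ t ∈ Icc (0 : ℝ) 1, (1 - t : ℂ) + t * (b / a) ∈ slitPlane := by
    intro t ht
    have := starConvex_one_slitPlane hab (sub_nonneg.2 ht.2) ht.1 (by ring)
    simpa using this
  have hg : ContinuousOn (fun t : ℝ => f 0 + Complex.log ((1 - t : ℂ) + t * (b / a)))
      (Icc 0 1) := by
    refine continuousOn_const.add (ContinuousOn.clog ?_ hslit)
    fun_prop
  have := sub_eq_sub_of_exp_eq isPreconnected_Icc hf hg (fun t ht => ?_)
    (right_mem_Icc.2 zero_le_one) (left_mem_Icc.2 zero_le_one)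
  · rw [this]; simp
  · have h0 := h 0 (left_mem_Icc.2 zero_le_one)
    rw [h t ht, Complex.exp_add, Complex.exp_log (slitPlane_ne_zero (hslit t ht)), h0]
    simp
    field_simp

/-- The square `[-1, 2]²` with its four corners cut off. -/
def cutSquare : Set (ℝ × ℝ) :=
  {q | -1 ≤ q.1 ∧ q.1 ≤ 2 ∧ -1 ≤ q.2 ∧ q.2 ≤ 2 ∧ -1 ≤ q.1 + q.2 ∧ q.1 + q.2 ≤ 3 ∧
    q.1 - q.2 ≤ 2 ∧ q.2 - q.1 ≤ 2}

lemma convex_cutSquare : Convex ℝ cutSquare := by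
  rintro ⟨a, b⟩ ⟨h1, h2, h3, h4, h5, h6, h7, h8⟩ ⟨c, d⟩ ⟨k1, k2, k3, k4, k5, k6, k7, k8⟩
    s t hs ht hst
  obtain rfl : t = 1 - s := by linarith
  simp only at h1 h2 h3 h4 h5 h6 h7 h8 k1 k2 k3 k4 k5 k6 k7 k8
  simp only [cutSquare, Prod.smul_mk, Prod.mk_add_mk, smul_eq_mul, mem_ofPred_eq]
  refine ⟨?_, ?_, ?_, ?_, ?_, ?_, ?_, ?_⟩
  · linarith [mul_le_mul_of_nonneg_left h1 hs, mul_le_mul_of_nonneg_left k1 ht]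
  · linarith [mul_le_mul_of_nonneg_left h2 hs, mul_le_mul_of_nonneg_left k2 ht]
  · linarith [mul_le_mul_of_nonneg_left h3 hs, mul_le_mul_of_nonneg_left k3 ht]
  · linarith [mul_le_mul_of_nonneg_left h4 hs, mul_le_mul_of_nonneg_left k4 ht]
  · linarith [mul_le_mul_of_nonneg_left h5 hs, mul_le_mul_of_nonneg_left k5 ht]
  · linarith [mul_le_mul_of_nonneg_left h6 hs, mul_le_mul_of_nonneg_left k6 ht]
  · linarith [mul_le_mul_of_nonneg_left h7 hs, mul_le_mul_of_nonneg_left k7 ht]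
  · linarith [mul_le_mul_of_nonneg_left h8 hs, mul_le_mul_of_nonneg_left k8 ht]

/-- A path from `p + u` to `p + v` in `X`, prolonged at both ends by segments to `p`. -/
lemma exists_loop_through {X : Set ℂ} (hX : IsPathConnected X) {p u v : ℂ}
    (hu : ∀ t ∈ Ioc (0 : ℝ) 1, p + t * u ∈ X) (hv : ∀ t ∈ Ioc (0 : ℝ) 1, p + t * v ∈ X) :
    ∃ x : ℝ → ℂ, Continuous x ∧ (∀ t ∈ Icc (-1 : ℝ) 0, x t = p + (1 + t) * u) ∧
      (∀ t ∈ Icc (1 : ℝ) 2, x t = p + (2 - t) * v) ∧ ∀ t ∈ Ioo (-1 : ℝ) 2, x t ∈ X := by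
  have hu1 := hu 1 ⟨one_pos, le_rfl⟩
  have hv1 := hv 1 ⟨one_pos, le_rfl⟩
  obtain ⟨c, hc⟩ := hX.joinedIn _ hu1 _ hv1
  have hc0 : ∀ t ≤ (0 : ℝ), c.extend t = p + u := fun t ht => by
    rw [c.extend_of_le_zero ht]; simp
  have hc1 : ∀ t, (1 : ℝ) ≤ t → c.extend t = p + v := fun t ht => by
    rw [c.extend_of_one_le ht]; simp
  have hl : ∀ t ∈ Icc (-1 : ℝ) 0,
      c.extend t + (min t 0 : ℝ) * u - (max (t - 1) 0 : ℝ) * v = p + (1 + t) * u := by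
    intro t ht
    rw [hc0 t ht.2, min_eq_left ht.2, max_eq_right (by linarith [ht.2])]
    push_cast; ring
  have hr : ∀ t ∈ Icc (1 : ℝ) 2,
      c.extend t + (min t 0 : ℝ) * u - (max (t - 1) 0 : ℝ) * v = p + (2 - t) * v := by
    intro t ht
    rw [hc1 t ht.1, min_eq_right (by linarith [ht.1]), max_eq_left (by linarith [ht.1])]
    push_cast; ring
  refine ⟨fun t => c.extend t + (min t 0 : ℝ) * u - (max (t - 1) 0 : ℝ) * v, ?_, hl, hr, ?_⟩
  · have := c.continuous_extend
    fun_prop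
  · intro t ht
    rcases le_total t 0 with h0 | h0
    · have := hu (1 + t) ⟨by linarith [ht.1], by linarith⟩
      simp only [hl t ⟨ht.1.le, h0⟩]
      simpa using this
    rcases le_total t 1 with h1 | h1
    · simp only [min_eq_right h0, max_eq_right (sub_nonpos.2 h1)]
      simp only [ofReal_zero, zero_mul, add_zero, sub_zero]
      rw [c.extend_apply ⟨h0, h1⟩]
      exact hc _
    · have := hv (2 - t) ⟨by linarith [ht.2], by linarith⟩
      simp only [hr t ⟨h1, ht.2.le⟩]
      simpa using this

/-- Two disjoint path-connected sets cannot alternate around a point: if four segments issue from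
`p`, at equal angles `α ≤ π / 2`, then `X` cannot contain the first and third and `Y` the second and
fourth. Otherwise, join the segments within `X` and `Y` to loops `x` and `y` based at `p`; on a
square with cut corners `x t - y s` has a continuous logarithm, whose increments along opposite
sides cancel, while the four cut corners contribute `2 π i` in total. -/
theorem false_of_alternating_segments {X Y : Set ℂ} (hX : IsPathConnected X)
    (hY : IsPathConnected Y) (hXY : Disjoint X Y) {p u : ℂ} (hpX : p ∉ X) (hpY : p ∉ Y)
    (hu : u ≠ 0) {α : ℝ} (hα0 : 0 < α) (hα : α ≤ Real.pi / 2)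
    (h0 : ∀ t ∈ Ioc (0 : ℝ) 1, p + t * u ∈ X)
    (h1 : ∀ t ∈ Ioc (0 : ℝ) 1, p + t * (u * exp (α * I)) ∈ Y)
    (h2 : ∀ t ∈ Ioc (0 : ℝ) 1, p + t * (u * exp (α * I) ^ 2) ∈ X)
    (h3 : ∀ t ∈ Ioc (0 : ℝ) 1, p + t * (u * exp (α * I) ^ 3) ∈ Y) : False := by
  have hπ := Real.pi_pos
  set ω := exp (α * I) with hω
  have hω0 : ω ≠ 0 := Complex.exp_ne_zero _
  obtain ⟨x, hxc, hxl, hxr, hxX⟩ := exists_loop_through hX h0 h2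
  obtain ⟨y, hyc, hyl, hyr, hyY⟩ := exists_loop_through hY h1 h3
  have hxm : x (-1) = p := by rw [hxl _ ⟨le_rfl, by norm_num⟩]; simp
  have hx2 : x 2 = p := by rw [hxr _ ⟨by norm_num, le_rfl⟩]; simp
  have hym : y (-1) = p := by rw [hyl _ ⟨le_rfl, by norm_num⟩]; simp
  have hy2 : y 2 = p := by rw [hyr _ ⟨by norm_num, le_rfl⟩]; simp
  obtain ⟨l, hlc, hl⟩ := exists_continuousOn_log_of_convex convex_cutSquare
    ⟨((0 : ℝ), (0 : ℝ)), by norm_num [cutSquare]⟩ (F := fun q => x q.1 - y q.2)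
    (by fun_prop) (by
      rintro ⟨t, s⟩ ⟨q1, q2, q3, q4, q5, q6, q7, q8⟩ h
      simp only at q1 q2 q3 q4 q5 q6 q7 q8 h
      rw [sub_eq_zero] at h
      rcases q1.eq_or_lt with rfl | q1'
      · rw [hxm] at h
        exact hpY (h ▸ hyY s ⟨by linarith, by linarith⟩)
      rcases q2.eq_or_lt with rfl | q2'
      · rw [hx2] at h
        exact hpY (h ▸ hyY s ⟨by linarith, by linarith⟩)
      have hxt := hxX t ⟨q1', q2'⟩
      rcases q3.eq_or_lt with rfl | q3'
      · rw [hym] at h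
        exact hpX (h ▸ hxt)
      rcases q4.eq_or_lt with rfl | q4'
      · rw [hy2] at h
        exact hpX (h ▸ hxt)
      exact hXY.le_bot ⟨hxt, h ▸ hyY s ⟨q3', q4'⟩⟩)
  -- the increments along the two horizontal, and the two vertical, sides agree
  have hH : l (1, -1) - l (0, -1) = l (1, 2) - l (0, 2) := by
    refine sub_eq_sub_of_exp_eq (f := fun t => l (t, -1)) (g := fun t => l (t, 2))
      (S := Icc 0 1) isPreconnected_Icc (hlc.comp (by fun_prop) fun t ht => ?_)
      (hlc.comp (by fun_prop) fun t ht => ?_) (fun t ht => ?_) (by simp) (by simp)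
    · obtain ⟨a, b⟩ := ht
      simp only [cutSquare, mem_ofPred_eq]
      refine ⟨?_, ?_, ?_, ?_, ?_, ?_, ?_, ?_⟩ <;> linarith
    · obtain ⟨a, b⟩ := ht
      simp only [cutSquare, mem_ofPred_eq]
      refine ⟨?_, ?_, ?_, ?_, ?_, ?_, ?_, ?_⟩ <;> linarith
    · obtain ⟨a, b⟩ := ht
      rw [hl, hl]
      · simp [hym, hy2]
      · simp only [cutSquare, mem_ofPred_eq]
        refine ⟨?_, ?_, ?_, ?_, ?_, ?_, ?_, ?_⟩ <;> linarith
      · simp only [cutSquare, mem_ofPred_eq]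
        refine ⟨?_, ?_, ?_, ?_, ?_, ?_, ?_, ?_⟩ <;> linarith
  have hV : l (-1, 1) - l (-1, 0) = l (2, 1) - l (2, 0) := by
    refine sub_eq_sub_of_exp_eq (f := fun t => l (-1, t)) (g := fun t => l (2, t))
      (S := Icc 0 1) isPreconnected_Icc (hlc.comp (by fun_prop) fun t ht => ?_)
      (hlc.comp (by fun_prop) fun t ht => ?_) (fun t ht => ?_) (by simp) (by simp)
    · obtain ⟨a, b⟩ := ht
      simp only [cutSquare, mem_ofPred_eq]
      refine ⟨?_, ?_, ?_, ?_, ?_, ?_, ?_, ?_⟩ <;> linarith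
    · obtain ⟨a, b⟩ := ht
      simp only [cutSquare, mem_ofPred_eq]
      refine ⟨?_, ?_, ?_, ?_, ?_, ?_, ?_, ?_⟩ <;> linarith
    · obtain ⟨a, b⟩ := ht
      rw [hl, hl]
      · simp [hxm, hx2]
      · simp only [cutSquare, mem_ofPred_eq]
        refine ⟨?_, ?_, ?_, ?_, ?_, ?_, ?_, ?_⟩ <;> linarith
      · simp only [cutSquare, mem_ofPred_eq]
        refine ⟨?_, ?_, ?_, ?_, ?_, ?_, ?_, ?_⟩ <;> linarith
  have hexp1 : ∀ {θ : ℝ}, -Real.pi < θ → θ < Real.pi →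
      exp (θ * I) ∈ slitPlane ∧ Complex.log (exp (θ * I)) = θ * I := by
    intro θ h1 h2
    refine ⟨?_, Complex.log_exp (by simpa using h1) (by simpa using h2.le)⟩
    rw [Complex.mem_slitPlane_iff_arg, Complex.arg_exp_mul_I,
      (toIocMod_eq_self _).2 ⟨h1, by linarith⟩]
    exact ⟨h2.ne, Complex.exp_ne_zero _⟩
  obtain ⟨hs1, hlog1⟩ := hexp1 (θ := Real.pi - α) (by linarith) (by linarith)
  obtain ⟨hs3, hlog3⟩ := hexp1 (θ := 3 * α - Real.pi) (by linarith) (by linarith)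
  have he1 : exp ((Real.pi - α : ℝ) * I) = -ω⁻¹ := by
    rw [hω, ← Complex.exp_neg]
    push_cast
    rw [sub_mul, Complex.exp_sub, Complex.exp_pi_mul_I, Complex.exp_neg]
    field_simp
  have he3 : exp ((3 * α - Real.pi : ℝ) * I) = -ω ^ 3 := by
    rw [hω, ← Complex.exp_nat_mul]
    push_cast
    rw [sub_mul, Complex.exp_sub, Complex.exp_pi_mul_I, mul_assoc]
    field_simp
  rw [he1] at hs1 hlog1
  rw [he3] at hs3 hlog3
  -- the four cut corners
  have hA : l (2, 0) - l (1, -1) = Complex.log (-ω⁻¹) := by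
    have hr : -(u * ω) / (u * ω ^ 2) = -ω⁻¹ := by field_simp
    have := sub_eq_log_div_of_exp_eq_segment (f := fun t => l (1 + t, -1 + t))
      (a := u * ω ^ 2) (b := -(u * ω)) (by simp [hu, hω0])
      (hlc.comp (by fun_prop) fun t ht => ?_) (fun t ht => ?_) (hr ▸ hs1)
    · rw [hr] at this
      rw [← this]; norm_num
    · obtain ⟨a, b⟩ := ht
      simp only [cutSquare, mem_ofPred_eq]
      refine ⟨?_, ?_, ?_, ?_, ?_, ?_, ?_, ?_⟩ <;> linarith
    · obtain ⟨a, b⟩ := ht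
      rw [hl]
      · simp only
        rw [hxr _ ⟨by linarith, by linarith⟩, hyl _ ⟨by linarith, by linarith⟩]
        push_cast; ring
      · simp only [cutSquare, mem_ofPred_eq]
        refine ⟨?_, ?_, ?_, ?_, ?_, ?_, ?_, ?_⟩ <;> linarith
  have hB : l (1, 2) - l (2, 1) = Complex.log (-ω⁻¹) := by
    have hr : (u * ω ^ 2) / (-(u * ω ^ 3)) = -ω⁻¹ := by field_simp
    have := sub_eq_log_div_of_exp_eq_segment (f := fun t => l (2 - t, 1 + t))
      (a := -(u * ω ^ 3)) (b := u * ω ^ 2) (by simp [hu, hω0])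
      (hlc.comp (by fun_prop) fun t ht => ?_) (fun t ht => ?_) (hr ▸ hs1)
    · rw [hr] at this
      rw [← this]; norm_num
    · obtain ⟨a, b⟩ := ht
      simp only [cutSquare, mem_ofPred_eq]
      refine ⟨?_, ?_, ?_, ?_, ?_, ?_, ?_, ?_⟩ <;> linarith
    · obtain ⟨a, b⟩ := ht
      rw [hl]
      · simp only
        rw [hxr _ ⟨by linarith, by linarith⟩, hyr _ ⟨by linarith, by linarith⟩]
        push_cast; ring
      · simp only [cutSquare, mem_ofPred_eq]
        refine ⟨?_, ?_, ?_, ?_, ?_, ?_, ?_, ?_⟩ <;> linarith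
  have hC : l (-1, 1) - l (0, 2) = Complex.log (-ω ^ 3) := by
    have hr : -(u * ω ^ 3) / u = -ω ^ 3 := by field_simp
    have := sub_eq_log_div_of_exp_eq_segment (f := fun t => l (-t, 2 - t))
      (a := u) (b := -(u * ω ^ 3)) hu
      (hlc.comp (by fun_prop) fun t ht => ?_) (fun t ht => ?_) (hr ▸ hs3)
    · rw [hr] at this
      rw [← this]; norm_num
    · obtain ⟨a, b⟩ := ht
      simp only [cutSquare, mem_ofPred_eq]
      refine ⟨?_, ?_, ?_, ?_, ?_, ?_, ?_, ?_⟩ <;> linarith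
    · obtain ⟨a, b⟩ := ht
      rw [hl]
      · simp only
        rw [hxl _ ⟨by linarith, by linarith⟩, hyr _ ⟨by linarith, by linarith⟩]
        push_cast; ring
      · simp only [cutSquare, mem_ofPred_eq]
        refine ⟨?_, ?_, ?_, ?_, ?_, ?_, ?_, ?_⟩ <;> linarith
  have hD : l (0, -1) - l (-1, 0) = Complex.log (-ω⁻¹) := by
    have hr : u / (-(u * ω)) = -ω⁻¹ := by field_simp
    have := sub_eq_log_div_of_exp_eq_segment (f := fun t => l (-1 + t, -t))
      (a := -(u * ω)) (b := u) (by simp [hu, hω0])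
      (hlc.comp (by fun_prop) fun t ht => ?_) (fun t ht => ?_) (hr ▸ hs1)
    · rw [hr] at this
      rw [← this]; norm_num
    · obtain ⟨a, b⟩ := ht
      simp only [cutSquare, mem_ofPred_eq]
      refine ⟨?_, ?_, ?_, ?_, ?_, ?_, ?_, ?_⟩ <;> linarith
    · obtain ⟨a, b⟩ := ht
      rw [hl]
      · simp only
        rw [hxl _ ⟨by linarith, by linarith⟩, hyl _ ⟨by linarith, by linarith⟩]
        push_cast; ring
      · simp only [cutSquare, mem_ofPred_eq]
        refine ⟨?_, ?_, ?_, ?_, ?_, ?_, ?_, ?_⟩ <;> linarith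
  have hsum : 3 * Complex.log (-ω⁻¹) + Complex.log (-ω ^ 3) = 0 := by
    linear_combination hV - hH - hA - hB - hC - hD
  rw [hlog1, hlog3] at hsum
  have him := congrArg Complex.im hsum
  simp at him
  linarith

/-! ### Sets attached to a connected boundary piece along one side -/

/-- `S` reaches every point of `b` from one side only: the points of `b` have arbitrarily small open
neighbourhoods whose intersection with `S` is connected. -/
def HasCollar (S b : Set ℂ) : Prop :=
  ∀ p ∈ b, ∀ W ∈ 𝓝 p, ∃ N, IsOpen N ∧ p ∈ N ∧ N ⊆ W ∧ IsPreconnected (N ∩ S)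

/-- If `A` fills `S` near each point of the connected boundary piece `b` at which it accumulates,
and it accumulates at one point of `b`, then it accumulates at all of them. -/
lemma subset_closure_of_local {S b A : Set ℂ} (hb : IsPreconnected b) (hbS : b ⊆ closure S)
    (key : ∀ p ∈ b, p ∈ closure A → ∃ N, IsOpen N ∧ p ∈ N ∧ N ∩ S ⊆ A)
    (hne : (closure A ∩ b).Nonempty) : b ⊆ closure A := by
  -- the points with such a neighbourhood form an open set, whose trace on `b` is closed in `b`
  set V : Set ℂ := ⋃₀ {N | IsOpen N ∧ N ∩ S ⊆ A} with hV
  have hVo : IsOpen V := isOpen_sUnion fun N hN => hN.1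
  have hVA : ∀ p ∈ b, p ∈ V → p ∈ closure A := by
    rintro p hp ⟨N, ⟨hN, hNA⟩, hpN⟩
    rw [mem_closure_iff]
    intro O hO hpO
    obtain ⟨z, ⟨hz1, hz2⟩, hzS⟩ := mem_closure_iff.1 (hbS hp) (O ∩ N) (hO.inter hN) ⟨hpO, hpN⟩
    exact ⟨z, hz1, hNA ⟨hz2, hzS⟩⟩
  have hAV : ∀ p ∈ b, p ∈ closure A → p ∈ V := fun p hp hpA => by
    obtain ⟨N, hN, hpN, hNA⟩ := key p hp hpA
    exact ⟨N, ⟨hN, hNA⟩, hpN⟩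
  intro p hp
  by_contra hpA
  obtain ⟨q, hqA, hqb⟩ := hne
  obtain ⟨z, hz, hz1, hz2⟩ := hb V (closure A)ᶜ hVo isClosed_closure.isOpen_compl
    (fun x hx => by
      by_cases hxA : x ∈ closure A
      · exact Or.inl (hAV x hx hxA)
      · exact Or.inr hxA) ⟨q, hqb, hAV q hqb hqA⟩ ⟨p, hp, hpA⟩
  exact hz2 (hVA z hz hz1)

/-- Let `A` be a union of components of `S`. If `A` accumulates at one point of a connected
one-sided boundary piece `b` of `S`, then it accumulates at all of them. -/
lemma HasCollar.subset_closure {S b A : Set ℂ} (h : HasCollar S b) (hb : IsPreconnected b)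
    (hbS : b ⊆ closure S) (hA : ∀ C ⊆ S, IsPreconnected C → (C ∩ A).Nonempty → C ⊆ A)
    (hAS : A ⊆ S) (hne : (closure A ∩ b).Nonempty) : b ⊆ closure A := by
  refine subset_closure_of_local hb hbS (fun p hp hpA => ?_) hne
  obtain ⟨N, hN, hpN, -, hc⟩ := h p hp univ univ_mem
  refine ⟨N, hN, hpN, hA _ inter_subset_right hc ?_⟩
  obtain ⟨z, hz, hzA⟩ := mem_closure_iff.1 hpA N hN hpN
  exact ⟨z, ⟨hz, hAS hzA⟩, hzA⟩

lemma connectedComponentIn_saturated {S C : Set ℂ} {x : ℂ} (hCS : C ⊆ S) (hC : IsPreconnected C)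
    (hne : (C ∩ connectedComponentIn S x).Nonempty) : C ⊆ connectedComponentIn S x := by
  obtain ⟨z, hzC, hz⟩ := hne
  rw [connectedComponentIn_eq hz]
  exact hC.subset_connectedComponentIn hzC hCS

lemma closure_connectedComponentIn_inter {S : Set ℂ} {x : ℂ} :
    closure (connectedComponentIn S x) ∩ S ⊆ connectedComponentIn S x := by
  rintro y ⟨hy, hyS⟩
  by_cases hx : x ∈ S
  · have h1 : IsPreconnected (insert y (connectedComponentIn S x)) :=
      isPreconnected_connectedComponentIn.subset_closure (subset_insert _ _)
        (insert_subset hy subset_closure)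
    exact h1.subset_connectedComponentIn (mem_insert_of_mem _ (mem_connectedComponentIn hx))
      (insert_subset hyS (connectedComponentIn_subset _ _)) (mem_insert _ _)
  · rw [connectedComponentIn_eq_empty hx] at hy
    simp at hy

/-- If every component of `S` accumulates at the connected one-sided boundary piece `b`, then `S`
is connected. -/
lemma HasCollar.isPreconnected {S b : Set ℂ} (h : HasCollar S b) (hb : IsPreconnected b)
    (hbS : b ⊆ closure S)
    (hcomp : ∀ x ∈ S, (closure (connectedComponentIn S x) ∩ b).Nonempty) : IsPreconnected S := by
  rcases S.eq_empty_or_nonempty with rfl | ⟨x0, hx0⟩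
  · exact isPreconnected_empty
  obtain ⟨p, -, hp⟩ := hcomp x0 hx0
  obtain ⟨N, hN, hpN, -, hNc⟩ := h p hp univ univ_mem
  obtain ⟨z, hzN, hzS⟩ := mem_closure_iff.1 (hbS hp) N hN hpN
  refine isPreconnected_of_forall z fun y hy => ⟨connectedComponentIn S y,
    connectedComponentIn_subset _ _, ?_, mem_connectedComponentIn hy,
    isPreconnected_connectedComponentIn⟩
  have h1 := h.subset_closure hb hbS (A := connectedComponentIn S y)
    (fun C h1 h2 h3 => connectedComponentIn_saturated h1 h2 h3)
    (connectedComponentIn_subset _ _) (hcomp y hy) hp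
  obtain ⟨w, hwN, hw⟩ := mem_closure_iff.1 h1 N hN hpN
  exact connectedComponentIn_saturated inter_subset_right hNc
    ⟨w, ⟨hwN, connectedComponentIn_subset _ _ hw⟩, hw⟩ ⟨hzN, hzS⟩

lemma eq_univ_of_closure_subset {A : Set ℂ} (ho : IsOpen A) (hne : A.Nonempty)
    (hc : closure A ⊆ A) : A = univ := by
  have : IsClopen A := ⟨closure_eq_iff_isClosed.1 (hc.antisymm subset_closure), ho⟩
  exact (isClopen_iff.1 this).resolve_left hne.ne_empty

/-- `T` is locally two-sided: the points of `T` have arbitrarily small open neighbourhoods in which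
the complement of `T` is the union of two connected sets, each accumulating at all of `T`. -/
def IsTwoSided (T : Set ℂ) : Prop :=
  ∀ p ∈ T, ∀ W ∈ 𝓝 p, ∃ N A B, IsOpen N ∧ p ∈ N ∧ N ⊆ W ∧ IsPreconnected A ∧ IsPreconnected B ∧
    N \ T = A ∪ B ∧ N ∩ T ⊆ closure A ∧ N ∩ T ⊆ closure B

lemma IsTwoSided.subset_closure {T S S' : Set ℂ} (h : IsTwoSided T) (hT : IsPreconnected T)
    (hS : IsOpen S) (hS' : IsOpen S') (hd : Disjoint S S') (hu : S ∪ S' = Tᶜ)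
    (hne : S.Nonempty) (hne' : S'.Nonempty) : T ⊆ closure S := by
  have hSS' : ∀ z ∈ closure S, z ∉ S' := by
    intro z hz hzS'
    obtain ⟨w, hw, hwS⟩ := mem_closure_iff.1 hz S' hS' hzS'
    exact hd.le_bot ⟨hwS, hw⟩
  have hTS : ∀ z, z ∉ T → z ∈ S ∨ z ∈ S' := fun z hz => by
    have : z ∈ S ∪ S' := hu ▸ hz
    exact this
  obtain ⟨q, hqT, hqS⟩ : ∃ q ∈ T, q ∈ closure S := by
    by_contra! hcon
    have h1 : S = univ := eq_univ_of_closure_subset hS hne fun z hz =>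
      (hTS z fun hzT => hcon z hzT hz).resolve_right (hSS' z hz)
    obtain ⟨w, hw⟩ := hne'
    exact hd.le_bot ⟨h1 ▸ mem_univ w, hw⟩
  set V : Set ℂ := ⋃₀ {N | IsOpen N ∧ N ∩ T ⊆ closure S} with hV
  have hVo : IsOpen V := isOpen_sUnion fun N hN => hN.1
  have hAV : ∀ p ∈ T, p ∈ closure S → p ∈ V := fun p hp hpS => by
    obtain ⟨N, A, B, hN, hpN, -, hA, hB, hNT, hNA, hNB⟩ := h p hp univ univ_mem
    refine ⟨N, ⟨hN, ?_⟩, hpN⟩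
    obtain ⟨z, hzN, hzS⟩ := mem_closure_iff.1 hpS N hN hpN
    have hzT : z ∉ T := fun hzT => (hu ▸ (Or.inl hzS : z ∈ S ∪ S') : z ∈ Tᶜ) hzT
    have hsub : ∀ C ⊆ N \ T, C ⊆ S ∪ S' := fun C hC w hw => by rw [hu]; exact (hC hw).2
    have hz : z ∈ A ∪ B := hNT ▸ ⟨hzN, hzT⟩
    rcases hz with hz | hz
    · exact hNA.trans (closure_mono (hA.subset_left_of_subset_union hS hS' hd
        (hsub A (hNT ▸ subset_union_left)) ⟨z, hz, hzS⟩))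
    · exact hNB.trans (closure_mono (hB.subset_left_of_subset_union hS hS' hd
        (hsub B (hNT ▸ subset_union_right)) ⟨z, hz, hzS⟩))
  intro p hp
  by_contra hpA
  obtain ⟨z, hz, ⟨N, ⟨-, hN⟩, hzN⟩, hz2⟩ := hT V (closure S)ᶜ hVo isClosed_closure.isOpen_compl
    (fun x hx => by
      by_cases hxA : x ∈ closure S
      · exact Or.inl (hAV x hx hxA)
      · exact Or.inr hxA) ⟨q, hqT, hAV q hqT hqS⟩ ⟨p, hp, hpA⟩
  exact hz2 (hN ⟨hzN, hz⟩)

lemma IsTwoSided.hasCollar {T S S' : Set ℂ} (h : IsTwoSided T) (hT : IsPreconnected T)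
    (hS : IsOpen S) (hS' : IsOpen S') (hd : Disjoint S S') (hu : S ∪ S' = Tᶜ)
    (hne : S.Nonempty) (hne' : S'.Nonempty) : HasCollar S T := by
  intro p hp W hW
  obtain ⟨N, A, B, hN, hpN, hNW, hA, hB, hNT, hNA, hNB⟩ := h p hp W hW
  refine ⟨N, hN, hpN, hNW, ?_⟩
  obtain ⟨z, hzN, hzS⟩ := mem_closure_iff.1
    (h.subset_closure hT hS hS' hd hu hne hne' hp) N hN hpN
  obtain ⟨w, hwN, hwS⟩ := mem_closure_iff.1
    (h.subset_closure hT hS' hS hd.symm (by rw [union_comm, hu]) hne' hne hp) N hN hpN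
  have hST : ∀ z, z ∈ S ∪ S' → z ∉ T := fun z hz => by rw [hu] at hz; exact hz
  have hsub : ∀ C ⊆ N \ T, C ⊆ S ∪ S' := fun C hC w hw => by rw [hu]; exact (hC hw).2
  have hAsub := hsub A (hNT ▸ subset_union_left)
  have hBsub := hsub B (hNT ▸ subset_union_right)
  have hNAB : N ∩ S ⊆ A ∪ B := fun y hy => hNT ▸ ⟨hy.1, hST y (Or.inl hy.2)⟩
  have hAN : A ⊆ N := fun y hy => (hNT ▸ (Or.inl hy : y ∈ A ∪ B) : y ∈ N \ T).1
  have hBN : B ⊆ N := fun y hy => (hNT ▸ (Or.inr hy : y ∈ A ∪ B) : y ∈ N \ T).1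
  have key : ∀ C D : Set ℂ, IsPreconnected C → IsPreconnected D → C ⊆ S ∪ S' → D ⊆ S ∪ S' →
      C ⊆ N → N ∩ S ⊆ C ∪ D → z ∈ C → w ∈ C ∪ D → IsPreconnected (N ∩ S) := by
    intro C D hC hD hCs hDs hCN hcov hz hw
    have hCS : C ⊆ S := hC.subset_left_of_subset_union hS hS' hd hCs ⟨z, hz, hzS⟩
    have hwD : w ∈ D := hw.resolve_left fun hwC => hd.le_bot ⟨hCS hwC, hwS⟩
    have hDS : D ⊆ S' := hD.subset_left_of_subset_union hS' hS hd.symm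
      (by rwa [union_comm]) ⟨w, hwD, hwS⟩
    have : N ∩ S = C := by
      refine Subset.antisymm (fun y hy => ?_) fun y hy => ⟨hCN hy, hCS hy⟩
      exact (hcov hy).resolve_right fun hyD => hd.le_bot ⟨hy.2, hDS hyD⟩
    rw [this]; exact hC
  have hw : w ∈ A ∪ B := hNT ▸ ⟨hwN, hST w (Or.inr hwS)⟩
  rcases hNAB ⟨hzN, hzS⟩ with hz | hz
  · exact key A B hA hB hAsub hBsub hAN hNAB hz hw
  · exact key B A hB hA hBsub hAsub hBN (by rwa [union_comm]) hz (by rwa [union_comm])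

/-- The easy half of the Jordan curve theorem: the complement of a connected, locally two-sided set
has at most two components. -/
lemma IsTwoSided.isPreconnected {T S S' : Set ℂ} (h : IsTwoSided T) (hT : IsPreconnected T)
    (hS : IsOpen S) (hS' : IsOpen S') (hd : Disjoint S S') (hu : S ∪ S' = Tᶜ)
    (hne : S.Nonempty) (hne' : S'.Nonempty) : IsPreconnected S := by
  refine (h.hasCollar hT hS hS' hd hu hne hne').isPreconnected hT
    (h.subset_closure hT hS hS' hd hu hne hne') fun x hx => ?_
  by_contra hcon
  have h1 : connectedComponentIn S x = univ := by
    refine eq_univ_of_closure_subset hS.connectedComponentIn ⟨x, mem_connectedComponentIn hx⟩ ?_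
    intro y hy
    refine closure_connectedComponentIn_inter ⟨hy, ?_⟩
    have hyT : y ∈ S ∪ S' := by rw [hu]; exact fun hyT => hcon ⟨y, hy, hyT⟩
    refine hyT.resolve_right fun hyS' => ?_
    obtain ⟨w, hw, hwS⟩ := mem_closure_iff.1 hy S' hS' hyS'
    exact hd.le_bot ⟨connectedComponentIn_subset _ _ hwS, hw⟩
  obtain ⟨w, hw⟩ := hne'
  exact hd.le_bot ⟨connectedComponentIn_subset S x (h1 ▸ mem_univ w), hw⟩

/-- A properly embedded regular `C¹` arc is locally two-sided: by the inverse function theorem,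
`w ↦ g (re w) + im w • (i g'(t₀))` straightens it near `g t₀`. -/
lemma isTwoSided_range {g : ℝ → ℂ} (hg : IsClosedEmbedding g) (hg1 : ContDiff ℝ 1 g)
    (hg' : ∀ t, deriv g t ≠ 0) : IsTwoSided (range g) := by
  rintro _ ⟨t₀, rfl⟩ W hW
  set e := deriv g t₀ with he
  set Φ : ℂ → ℂ := fun w => g w.re + w.im • (I * e) with hΦ
  have hΦ1 : ContDiff ℝ 1 Φ :=
    (hg1.comp reCLM.contDiff).add (imCLM.contDiff.smul contDiff_const)
  set L : ℂ ≃L[ℝ] ℂ := ContinuousLinearEquiv.smulLeft (Units.mk0 e (hg' t₀)) with hL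
  have hΦ' : HasFDerivAt Φ (L : ℂ →L[ℝ] ℂ) (t₀ : ℂ) := by
    have hd : HasDerivAt g e (t₀ : ℂ).re :=
      (hg1.differentiable (by norm_num) t₀).hasDerivAt
    have h1 : HasFDerivAt (fun w : ℂ => g w.re) _ (t₀ : ℂ) :=
      hd.hasFDerivAt.comp (t₀ : ℂ) reCLM.hasFDerivAt
    have h2 : HasFDerivAt (fun w : ℂ => w.im • (I * e)) (imCLM.smulRight (I * e)) (t₀ : ℂ) :=
      (imCLM.hasFDerivAt (x := (t₀ : ℂ))).smul_const (I * e)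
    refine (h1.add h2).congr_fderiv ?_
    ext1 w
    simp only [hL, add_apply, ContinuousLinearMap.comp_apply, reCLM_apply,
      ContinuousLinearMap.smulRight_apply, imCLM_apply, real_smul,
      ContinuousLinearMap.toSpanSingleton_apply]
    change (w.re : ℂ) * e + (w.im : ℂ) * (I * e) = e * w
    conv_rhs => rw [← re_add_im w]
    ring
  set h := hΦ1.contDiffAt.toOpenPartialHomeomorph Φ hΦ' (by norm_num) with hh
  have hcoe : (h : ℂ → ℂ) = Φ := rfl
  have hsrc : (t₀ : ℂ) ∈ h.source :=
    hΦ1.contDiffAt.mem_toOpenPartialHomeomorph_source hΦ' (by norm_num)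
  have hΦt : ∀ t : ℝ, Φ t = g t := fun t => by simp [hΦ]
  set box : ℝ → Set ℂ := fun δ => {w | |w.re - t₀| < δ ∧ |w.im| < δ} with hbox
  have hre : Continuous fun w : ℂ => |w.re - t₀| := by fun_prop
  have him : Continuous fun w : ℂ => |w.im| := by fun_prop
  have hboxo : ∀ δ, IsOpen (box δ) := fun δ =>
    (isOpen_lt hre continuous_const).inter (isOpen_lt him continuous_const)
  have hboxc : ∀ δ, Convex ℝ (box δ) := by
    intro δ w hw z hz s t hs ht hst
    obtain rfl : t = 1 - s := by linarith
    obtain ⟨hw1, hw2⟩ := hw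
    obtain ⟨hz1, hz2⟩ := hz
    rw [abs_lt] at hw1 hw2 hz1 hz2
    have hc : ∀ a b : ℝ, a < δ → b < δ → s * a + (1 - s) * b < δ := by
      intro a b ha hb
      rcases hs.eq_or_lt with rfl | hs
      · linarith
      · nlinarith
    refine ⟨abs_lt.2 ⟨?_, ?_⟩, abs_lt.2 ⟨?_, ?_⟩⟩
    · have := hc (t₀ - w.re) (t₀ - z.re) (by linarith) (by linarith)
      simp; linarith
    · have := hc (w.re - t₀) (z.re - t₀) (by linarith) (by linarith)
      simp; linarith
    · have := hc (-w.im) (-z.im) (by linarith) (by linarith)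
      simp; linarith
    · have := hc w.im z.im (by linarith) (by linarith)
      simp; linarith
  have hboxsub : ∀ V ∈ 𝓝 (t₀ : ℂ), ∃ δ > 0, box δ ⊆ V := by
    intro V hV
    obtain ⟨ε, hε, hball⟩ := Metric.mem_nhds_iff.1 hV
    refine ⟨ε / 2, by positivity, fun w hw => hball ?_⟩
    rw [Metric.mem_ball, dist_eq_norm]
    calc ‖w - t₀‖ ≤ |(w - t₀).re| + |(w - t₀).im| := norm_le_abs_re_add_abs_im _
      _ < ε / 2 + ε / 2 := add_lt_add (by simpa using hw.1) (by simpa using hw.2)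
      _ = ε := by ring
  obtain ⟨δ₀, hδ₀, hδ₀sub⟩ := hboxsub h.source (h.open_source.mem_nhds hsrc)
  -- the remaining part of the arc does not come back near `g t₀`
  have hfar : IsClosed (g '' {t | δ₀ ≤ |t - t₀|}) :=
    hg.isClosedMap _ (isClosed_le continuous_const (by fun_prop))
  have hfar' : g t₀ ∉ g '' {t | δ₀ ≤ |t - t₀|} := by
    rintro ⟨t, ht, htt⟩
    obtain rfl := hg.injective htt
    simp only [mem_ofPred_eq, sub_self, abs_zero] at ht
    linarith
  have hpre : Φ ⁻¹' (W ∩ (g '' {t | δ₀ ≤ |t - t₀|})ᶜ) ∈ 𝓝 (t₀ : ℂ) := by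
    refine hΦ1.continuous.continuousAt.preimage_mem_nhds ?_
    rw [hΦt]
    exact inter_mem hW (hfar.isOpen_compl.mem_nhds hfar')
  obtain ⟨δ₁, hδ₁, hδ₁sub⟩ := hboxsub _ hpre
  set δ := min δ₀ δ₁ with hδ
  have hδpos : 0 < δ := lt_min hδ₀ hδ₁
  have hδs : box δ ⊆ h.source := fun w hw => hδ₀sub
    ⟨hw.1.trans_le (min_le_left _ _), hw.2.trans_le (min_le_left _ _)⟩
  have hδp : ∀ w ∈ box δ, Φ w ∈ W ∧ Φ w ∉ g '' {t | δ₀ ≤ |t - t₀|} := fun w hw =>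
    hδ₁sub ⟨hw.1.trans_le (min_le_right _ _), hw.2.trans_le (min_le_right _ _)⟩
  have hiff : ∀ w ∈ box δ, Φ w ∈ range g ↔ w.im = 0 := by
    intro w hw
    constructor
    · rintro ⟨t, ht⟩
      have h1 : |t - t₀| < δ₀ := by
        by_contra! hcon
        exact (hδp w hw).2 ⟨t, hcon, ht⟩
      have h2 : (t : ℂ) ∈ h.source := hδ₀sub ⟨by simpa using h1, by simpa using hδ₀⟩
      have h3 : w = t := h.injOn (hδs hw) h2 (by rw [hcoe, hΦt, ht])
      rw [h3]; simp
    · intro h0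
      exact ⟨w.re, by simp [hΦ, h0]⟩
  refine ⟨Φ '' box δ, Φ '' (box δ ∩ {w | 0 < w.im}), Φ '' (box δ ∩ {w | w.im < 0}),
    h.isOpen_image_of_subset_source (hboxo δ) hδs,
    ⟨t₀, ⟨by simpa using hδpos, by simpa using hδpos⟩, hΦt t₀⟩, ?_, ?_, ?_, ?_, ?_, ?_⟩
  · rintro _ ⟨w, hw, rfl⟩
    exact (hδp w hw).1
  · exact ((hboxc δ).inter (convex_halfSpace_im_gt 0)).isPreconnected.image _
      hΦ1.continuous.continuousOn
  · exact ((hboxc δ).inter (convex_halfSpace_im_lt 0)).isPreconnected.image _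
      hΦ1.continuous.continuousOn
  · ext z
    constructor
    · rintro ⟨⟨w, hw, rfl⟩, hz⟩
      rw [hiff w hw] at hz
      rcases lt_or_gt_of_ne hz with h1 | h1
      · exact Or.inr ⟨w, ⟨hw, h1⟩, rfl⟩
      · exact Or.inl ⟨w, ⟨hw, h1⟩, rfl⟩
    · rintro (⟨w, ⟨hw, h1⟩, rfl⟩ | ⟨w, ⟨hw, h1⟩, rfl⟩)
      · exact ⟨⟨w, hw, rfl⟩, fun hr => (ne_of_gt h1) ((hiff w hw).1 hr)⟩
      · exact ⟨⟨w, hw, rfl⟩, fun hr => (ne_of_lt h1) ((hiff w hw).1 hr)⟩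
  · rintro _ ⟨⟨w, hw, rfl⟩, hr⟩
    rw [hiff w hw] at hr
    have hlim : Tendsto (fun s : ℝ => Φ (w + s * I)) (𝓝[>] 0) (𝓝 (Φ w)) := by
      have : Continuous fun s : ℝ => Φ (w + s * I) := hΦ1.continuous.comp (by fun_prop)
      simpa using (this.tendsto 0).mono_left nhdsWithin_le_nhds
    refine mem_closure_of_tendsto hlim ?_
    filter_upwards [Ioo_mem_nhdsGT hδpos] with s hs
    refine ⟨_, ⟨⟨by simpa using hw.1, ?_⟩, ?_⟩, rfl⟩
    · simp [hr, abs_of_pos hs.1, hs.2]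
    · simp [hr, hs.1]
  · rintro _ ⟨⟨w, hw, rfl⟩, hr⟩
    rw [hiff w hw] at hr
    have hlim : Tendsto (fun s : ℝ => Φ (w - s * I)) (𝓝[>] 0) (𝓝 (Φ w)) := by
      have : Continuous fun s : ℝ => Φ (w - s * I) := hΦ1.continuous.comp (by fun_prop)
      simpa using (this.tendsto 0).mono_left nhdsWithin_le_nhds
    refine mem_closure_of_tendsto hlim ?_
    filter_upwards [Ioo_mem_nhdsGT hδpos] with s hs
    refine ⟨_, ⟨⟨by simpa using hw.1, ?_⟩, ?_⟩, rfl⟩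
    · simp [hr, abs_of_pos hs.1, hs.2]
    · simp [hr, hs.1]

/-! ### Periodic arcs and their two complements -/

/-- The winding number about a point off the path is unique. -/
lemma HasWindingNumber.unique {γ : ℝ → ℂ} {p : ℂ} {w w' : ℝ} (hp : p ∉ range γ)
    (h : HasWindingNumber γ p w) (h' : HasWindingNumber γ p w') : w = w' := by
  obtain ⟨θ, hθc, hθ, a, b, ha, hb, hab⟩ := h
  obtain ⟨φ, hφc, hφ, c, d, hc, hd, hcd⟩ := h'
  have hexp : ∀ t, exp ((θ t : ℂ) * I) = exp ((φ t : ℂ) * I) := by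
    intro t
    have h0 : (‖γ t - p‖ : ℂ) ≠ 0 := by
      rw [ofReal_ne_zero, norm_ne_zero_iff, sub_ne_zero]
      exact fun h => hp ⟨t, h⟩
    exact mul_left_cancel₀ h0 ((hθ t).symm.trans (hφ t))
  have hinc : ∀ t, θ t - θ (-t) = φ t - φ (-t) := by
    intro t
    have := sub_eq_sub_of_exp_eq (f := fun t => (θ t : ℂ) * I) (g := fun t => (φ t : ℂ) * I)
      isPreconnected_univ (by fun_prop) (by fun_prop) (fun t _ => hexp t)
      (mem_univ t) (mem_univ (-t))
    have := congrArg Complex.im this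
    simpa using this
  have h1 : Tendsto (fun t => θ t - θ (-t)) atTop (𝓝 (b - a)) :=
    hb.sub (ha.comp tendsto_neg_atTop_atBot)
  have h2 : Tendsto (fun t => φ t - φ (-t)) atTop (𝓝 (d - c)) :=
    hd.sub (hc.comp tendsto_neg_atTop_atBot)
  have h3 : b - a = d - c := tendsto_nhds_unique h1 (by simpa only [hinc] using h2)
  have h4 : 2 * Real.pi * w = 2 * Real.pi * w' := by rw [← hab, ← hcd, h3]
  exact mul_left_cancel₀ (by positivity) h4

namespace PeriodicArc

variable {P : ℝ} (Γ : PeriodicArc P)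

lemma exists_norm_param_sub_le : ∃ C, 0 < C ∧ ∀ t, ‖Γ.param t - t * P‖ ≤ C := by
  have hper : Function.Periodic (fun t : ℝ => Γ.param t - t * P) 1 := by
    intro t
    simp only [Γ.param_add_one]
    push_cast; ring
  have hc : Continuous (fun t : ℝ => Γ.param t - t * P) := by
    have := Γ.continuous_param
    fun_prop
  obtain ⟨C, hC⟩ := (hper.isBounded_of_continuous one_ne_zero hc).exists_norm_le
  refine ⟨max C 1, by positivity, fun t => (hC _ ⟨t, rfl⟩).trans (le_max_left _ _)⟩

lemma abs_im_param_le {C : ℝ} (hC : ∀ t, ‖Γ.param t - t * P‖ ≤ C) (t : ℝ) :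
    |(Γ.param t).im| ≤ C := by
  have := (abs_im_le_norm _).trans (hC t)
  simpa using this

lemma isClosedEmbedding_param (hP : 0 < P) : IsClosedEmbedding Γ.param := by
  refine .of_continuous_injective_isClosedMap Γ.continuous_param Γ.injective_param ?_
  refine (isProperMap_iff_tendsto_cocompact.2 ⟨Γ.continuous_param, ?_⟩).isClosedMap
  obtain ⟨C, hC0, hC⟩ := Γ.exists_norm_param_sub_le
  rw [← Metric.cobounded_eq_cocompact (α := ℂ), ← comap_norm_atTop, tendsto_comap_iff]
  have h1 : Tendsto (fun t : ℝ => |t| * P - C) (cocompact ℝ) atTop := by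
    refine tendsto_atTop_add_const_right _ _ (Tendsto.atTop_mul_const hP ?_)
    exact tendsto_norm_cocompact_atTop (E := ℝ)
  refine tendsto_atTop_mono (fun t => ?_) h1
  have h2 : ‖(t * P : ℂ)‖ = |t| * P := by
    rw [norm_mul, norm_real, norm_real, Real.norm_eq_abs, Real.norm_of_nonneg hP.le]
  have h3 := norm_sub_norm_le (t * P : ℂ) (Γ.param t)
  have h4 := hC t
  rw [norm_sub_rev] at h4
  simp only [Function.comp_apply]
  linarith

lemma isClosed_trace (hP : 0 < P) : IsClosed Γ.trace :=
  (Γ.isClosedEmbedding_param hP).isClosed_range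

lemma isPreconnected_trace : IsPreconnected Γ.trace := isPreconnected_range Γ.continuous_param

lemma trace_nonempty : Γ.trace.Nonempty := range_nonempty _

lemma add_mem_trace {p : ℂ} : p + (P : ℂ) ∈ Γ.trace ↔ p ∈ Γ.trace := by
  constructor
  · rintro ⟨t, ht⟩
    refine ⟨t - 1, ?_⟩
    have := Γ.param_add_one (t - 1)
    rw [sub_add_cancel, ht] at this
    exact (add_right_cancel this).symm
  · rintro ⟨t, rfl⟩
    exact ⟨t + 1, Γ.param_add_one t⟩

lemma disjoint_lower_upper : Disjoint Γ.lower Γ.upper := by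
  rw [Set.disjoint_left]
  rintro p ⟨hp, h1⟩ ⟨-, h2⟩
  have := h1.unique hp h2
  norm_num at this

lemma lower_union_upper : Γ.lower ∪ Γ.upper = Γ.traceᶜ := by
  ext p
  constructor
  · rintro (h | h) <;> exact h.1
  · intro hp
    exact (Γ.winding p hp).imp (fun h => ⟨hp, h⟩) fun h => ⟨hp, h⟩

lemma tendsto_div_atTop (p : ℂ) :
    Tendsto (fun t : ℝ => (Γ.param t - p) / t) atTop (𝓝 P) := by
  obtain ⟨C, hC0, hC⟩ := Γ.exists_norm_param_sub_le
  rw [tendsto_iff_norm_sub_tendsto_zero]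
  have h1 : Tendsto (fun t : ℝ => (C + ‖p‖) / t) atTop (𝓝 0) :=
    tendsto_const_nhds.div_atTop tendsto_id
  refine squeeze_zero' (Eventually.of_forall fun _ => norm_nonneg _) ?_ h1
  filter_upwards [eventually_gt_atTop 0] with t ht
  have ht' : (t : ℂ) ≠ 0 := by exact_mod_cast ht.ne'
  have h2 : (Γ.param t - p) / t - P = (Γ.param t - t * P - p) / t := by
    field_simp; ring
  rw [h2, norm_div, norm_real, Real.norm_of_nonneg ht.le]
  gcongr
  exact (norm_sub_le _ _).trans (by gcongr; exact hC t)

lemma tendsto_div_atBot (p : ℂ) :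
    Tendsto (fun t : ℝ => (Γ.param t - p) / t) atBot (𝓝 P) := by
  obtain ⟨C, hC0, hC⟩ := Γ.exists_norm_param_sub_le
  rw [tendsto_iff_norm_sub_tendsto_zero]
  have h1 : Tendsto (fun t : ℝ => (C + ‖p‖) / (-t)) atBot (𝓝 0) :=
    tendsto_const_nhds.div_atTop tendsto_neg_atBot_atTop
  refine squeeze_zero' (Eventually.of_forall fun _ => norm_nonneg _) ?_ h1
  filter_upwards [eventually_lt_atBot 0] with t ht
  have ht' : (t : ℂ) ≠ 0 := by exact_mod_cast ht.ne
  have h2 : (Γ.param t - p) / t - P = (Γ.param t - t * P - p) / t := by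
    field_simp; ring
  have ht2 : 0 < -t := by linarith
  rw [h2, norm_div, norm_real, Real.norm_of_nonpos ht.le]
  gcongr
  exact (norm_sub_le _ _).trans (by gcongr; exact hC t)

/-- The winding number about points below (`σ = 1`) or above (`σ = -1`) the whole arc. -/
lemma hasWindingNumber_of_im (hP : 0 < P) {p : ℂ} {σ : ℝ} (hσ : σ = 1 ∨ σ = -1)
    (h : ∀ t, 0 < σ * (Γ.param t - p).im) : HasWindingNumber Γ.param p (-σ / 2) := by
  set c : ℂ := -σ * I with hc
  have hσ2 : (σ : ℂ) * σ = 1 := by rcases hσ with rfl | rfl <;> simp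
  have hre : ∀ z : ℂ, (c * z).re = σ * z.im := fun z => by simp [hc]
  have hslit : ∀ t, c * (Γ.param t - p) ∈ slitPlane := fun t =>
    Or.inl (by rw [hre]; exact h t)
  have hnorm : ∀ z : ℂ, ‖c * z‖ = ‖z‖ := fun z => by
    rcases hσ with rfl | rfl <;> simp [hc]
  have hexp : exp ((σ * Real.pi / 2 : ℝ) * I) = σ * I := by
    rcases hσ with rfl | rfl
    · push_cast
      rw [one_mul, exp_pi_div_two_mul_I]; simp
    · push_cast
      rw [show (-1 * Real.pi / 2 * I : ℂ) = -(Real.pi / 2 * I) by ring, Complex.exp_neg,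
        exp_pi_div_two_mul_I]
      simp
  have hargp : arg (c * P) = -(σ * Real.pi / 2) := by
    rcases hσ with rfl | rfl
    · rw [show c * P = P * (-I) by rw [hc]; push_cast; ring, arg_real_mul _ hP, arg_neg_I]
      ring
    · rw [show c * P = P * I by rw [hc]; push_cast; ring, arg_real_mul _ hP, arg_I]
      ring
  have hargm : arg (c * (-P)) = σ * Real.pi / 2 := by
    rcases hσ with rfl | rfl
    · rw [show c * (-P) = P * I by rw [hc]; push_cast; ring, arg_real_mul _ hP, arg_I]
      ring
    · rw [show c * (-P) = P * (-I) by rw [hc]; push_cast; ring, arg_real_mul _ hP, arg_neg_I]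
      ring
  have hPs : c * P ∈ slitPlane := by
    refine Or.inr ?_
    rcases hσ with rfl | rfl <;> simp [hc, hP.ne']
  have hPs' : c * (-P) ∈ slitPlane := by
    refine Or.inr ?_
    rcases hσ with rfl | rfl <;> simp [hc, hP.ne']
  refine ⟨fun t => σ * Real.pi / 2 + arg (c * (Γ.param t - p)), ?_, ?_, σ * Real.pi, 0, ?_, ?_, ?_⟩
  · refine continuous_const.add (continuous_iff_continuousAt.2 fun t => ?_)
    exact (continuousAt_arg (hslit t)).comp
      (f := fun t => c * (Γ.param t - p)) (by have := Γ.continuous_param; fun_prop)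
  · intro t
    have h1 := norm_mul_exp_arg_mul_I (c * (Γ.param t - p))
    rw [hnorm] at h1
    rw [ofReal_add, add_mul, Complex.exp_add, hexp, mul_left_comm, h1, hc]
    linear_combination -(Γ.param t - p) * hσ2 + (σ : ℂ) * σ * (Γ.param t - p) * I_mul_I
  · have h1 : Tendsto (fun t : ℝ => arg (c * -((Γ.param t - p) / t))) atBot
        (𝓝 (σ * Real.pi / 2)) := by
      rw [← hargm]
      exact (continuousAt_arg hPs').tendsto.comp ((Γ.tendsto_div_atBot p).neg.const_mul c)
    have h2 : Tendsto (fun t : ℝ => σ * Real.pi / 2 + arg (c * -((Γ.param t - p) / t))) atBot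
        (𝓝 (σ * Real.pi)) := by
      have := h1.const_add (σ * Real.pi / 2)
      rwa [add_halves] at this
    refine h2.congr' ?_
    filter_upwards [eventually_lt_atBot 0] with t ht
    have ht' : (t : ℂ) ≠ 0 := by exact_mod_cast ht.ne
    have h3 : c * (Γ.param t - p) = (-t : ℝ) * (c * -((Γ.param t - p) / t)) := by
      push_cast; field_simp
    rw [h3, arg_real_mul _ (by linarith)]
  · have h1 : Tendsto (fun t : ℝ => arg (c * ((Γ.param t - p) / t))) atTop
        (𝓝 (-(σ * Real.pi / 2))) := by
      rw [← hargp]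
      exact (continuousAt_arg hPs).tendsto.comp ((Γ.tendsto_div_atTop p).const_mul c)
    have h2 : Tendsto (fun t : ℝ => σ * Real.pi / 2 + arg (c * ((Γ.param t - p) / t))) atTop
        (𝓝 0) := by
      have := h1.const_add (σ * Real.pi / 2)
      rwa [add_neg_cancel] at this
    refine h2.congr' ?_
    filter_upwards [eventually_gt_atTop 0] with t ht
    have ht' : (t : ℂ) ≠ 0 := by exact_mod_cast ht.ne'
    have h3 : c * (Γ.param t - p) = (t : ℝ) * (c * ((Γ.param t - p) / t)) := by
      field_simp
    rw [h3, arg_real_mul _ ht]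
  · ring

lemma mem_lower_of_im_lt (hP : 0 < P) {C : ℝ} (hC : ∀ t, ‖Γ.param t - t * P‖ ≤ C) {p : ℂ}
    (hp : p.im < -C) : p ∈ Γ.lower := by
  have him : ∀ t, 0 < 1 * (Γ.param t - p).im := fun t => by
    have := neg_le_of_abs_le (Γ.abs_im_param_le hC t)
    rw [one_mul, sub_im]; linarith
  refine ⟨?_, by simpa using Γ.hasWindingNumber_of_im hP (Or.inl rfl) him⟩
  rintro ⟨t, rfl⟩
  simpa using him t

lemma mem_upper_of_lt_im (hP : 0 < P) {C : ℝ} (hC : ∀ t, ‖Γ.param t - t * P‖ ≤ C) {p : ℂ}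
    (hp : C < p.im) : p ∈ Γ.upper := by
  have him : ∀ t, 0 < (-1) * (Γ.param t - p).im := fun t => by
    have := le_of_abs_le (Γ.abs_im_param_le hC t)
    rw [sub_im]; linarith
  refine ⟨?_, by simpa using Γ.hasWindingNumber_of_im hP (Or.inr rfl) him⟩
  rintro ⟨t, rfl⟩
  simpa using him t

lemma exists_im_bound (hP : 0 < P) : ∃ C : ℝ, (∀ p : ℂ, p.im < -C → p ∈ Γ.lower) ∧
    ∀ p : ℂ, C < p.im → p ∈ Γ.upper := by
  obtain ⟨C, -, hC⟩ := Γ.exists_norm_param_sub_le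
  exact ⟨C, fun p => Γ.mem_lower_of_im_lt hP hC, fun p => Γ.mem_upper_of_lt_im hP hC⟩

lemma lower_nonempty (hP : 0 < P) : Γ.lower.Nonempty := by
  obtain ⟨C, hC, -⟩ := Γ.exists_im_bound hP
  exact ⟨⟨0, -C - 1⟩, hC _ (by simp)⟩

lemma upper_nonempty (hP : 0 < P) : Γ.upper.Nonempty := by
  obtain ⟨C, -, hC⟩ := Γ.exists_im_bound hP
  exact ⟨⟨0, C + 1⟩, hC _ (by simp)⟩

/-- The winding number is locally constant off the arc: a small shift of the base point changes
the argument by a small amount which vanishes at both ends. -/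
lemma isOpen_setOf_hasWindingNumber (hP : 0 < P) (w : ℝ) :
    IsOpen {p | p ∉ Γ.trace ∧ HasWindingNumber Γ.param p w} := by
  rw [Metric.isOpen_iff]
  rintro p ⟨hp, θ, hθc, hθ, a, b, ha, hb, hab⟩
  obtain ⟨d, hd, hball⟩ := Metric.isOpen_iff.1 (Γ.isClosed_trace hP).isOpen_compl p hp
  refine ⟨d, hd, fun q hq => ⟨hball hq, ?_⟩⟩
  have hne : ∀ t, Γ.param t - p ≠ 0 := fun t => by
    rw [sub_ne_zero]; exact fun h => hp ⟨t, h⟩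
  have hdist : ∀ t, d ≤ ‖Γ.param t - p‖ := fun t => by
    by_contra! hcon
    exact hball (show Γ.param t ∈ Metric.ball p d by rwa [Metric.mem_ball, dist_eq_norm]) ⟨t, rfl⟩
  set ρ : ℝ → ℂ := fun t => (Γ.param t - q) / (Γ.param t - p) with hρ
  have hρ1 : ∀ t, ρ t = 1 - (q - p) / (Γ.param t - p) := fun t => by
    have := hne t
    simp only [hρ]; field_simp; ring
  have hρs : ∀ t, ρ t ∈ slitPlane := by
    intro t
    refine Or.inl ?_
    have h1 : ‖(q - p) / (Γ.param t - p)‖ < 1 := by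
      rw [norm_div, div_lt_one (norm_pos_iff.2 (hne t))]
      exact lt_of_lt_of_le (by rwa [← dist_eq_norm]) (hdist t)
    have h2 := (re_le_norm ((q - p) / (Γ.param t - p)))
    rw [hρ1, sub_re, one_re]
    linarith
  have hρc : Continuous ρ := by
    have := Γ.continuous_param
    exact (this.sub continuous_const).div (this.sub continuous_const) hne
  have hlim : ∀ l : Filter ℝ, Tendsto (fun t : ℝ => (Γ.param t - p) / t) l (𝓝 P) →
      Tendsto (fun t : ℝ => (t : ℂ)⁻¹) l (𝓝 0) → (∀ᶠ t : ℝ in l, t ≠ 0) →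
      Tendsto (fun t => arg (ρ t)) l (𝓝 0) := by
    intro l h1 h2 h3
    have h4 : Tendsto ρ l (𝓝 1) := by
      have h5 : Tendsto (fun t : ℝ => 1 - (q - p) * ((t : ℂ)⁻¹ / ((Γ.param t - p) / t))) l
          (𝓝 (1 - (q - p) * (0 / P))) :=
        ((h2.div h1 (by exact_mod_cast hP.ne')).const_mul (q - p)).const_sub 1
      simp only [zero_div, mul_zero, sub_zero] at h5
      refine h5.congr' ?_
      filter_upwards [h3] with t ht
      have ht' : (t : ℂ) ≠ 0 := by exact_mod_cast ht
      have := hne t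
      rw [hρ1]; field_simp
    have h6 := (continuousAt_arg one_mem_slitPlane).tendsto.comp h4
    rwa [arg_one] at h6
  refine ⟨fun t => θ t + arg (ρ t), ?_, ?_, a, b, ?_, ?_, hab⟩
  · exact hθc.add (continuous_iff_continuousAt.2 fun t =>
      (continuousAt_arg (hρs t)).comp hρc.continuousAt)
  · intro t
    have h1 : Γ.param t - q = (Γ.param t - p) * ρ t := by
      have := hne t
      simp only [hρ]; field_simp
    have h2 := norm_mul_exp_arg_mul_I (ρ t)
    have h3 := hθ t
    rw [h1, norm_mul, ofReal_add, add_mul, Complex.exp_add, ofReal_mul]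
    calc (Γ.param t - p) * ρ t = (‖Γ.param t - p‖ * exp (θ t * I)) * (‖ρ t‖ * exp (arg (ρ t) * I))
        := by rw [h2, ← h3]
      _ = _ := by ring
  · have := ha.add (hlim atBot (Γ.tendsto_div_atBot p) ?_ (eventually_ne_atBot 0))
    · rwa [add_zero] at this
    · have h1 : Tendsto (fun t : ℝ => ((t⁻¹ : ℝ) : ℂ)) atBot (𝓝 ((0 : ℝ) : ℂ)) :=
        (continuous_ofReal.tendsto 0).comp tendsto_inv_atBot_zero
      simpa using h1
  · have := hb.add (hlim atTop (Γ.tendsto_div_atTop p) ?_ (eventually_ne_atTop 0))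
    · rwa [add_zero] at this
    · have h1 : Tendsto (fun t : ℝ => ((t⁻¹ : ℝ) : ℂ)) atTop (𝓝 ((0 : ℝ) : ℂ)) :=
        (continuous_ofReal.tendsto 0).comp tendsto_inv_atTop_zero
      simpa using h1

lemma isOpen_lower (hP : 0 < P) : IsOpen Γ.lower := Γ.isOpen_setOf_hasWindingNumber hP _

lemma isOpen_upper (hP : 0 < P) : IsOpen Γ.upper := Γ.isOpen_setOf_hasWindingNumber hP _

lemma hasWindingNumber_add {p : ℂ} {w : ℝ} (h : HasWindingNumber Γ.param p w) :
    HasWindingNumber Γ.param (p + (P : ℂ)) w := by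
  obtain ⟨θ, hθc, hθ, a, b, ha, hb, hab⟩ := h
  have hsub : ∀ t, Γ.param t - (p + (P : ℂ)) = Γ.param (t - 1) - p := fun t => by
    have := Γ.param_add_one (t - 1)
    rw [sub_add_cancel] at this
    rw [this]; ring
  refine ⟨fun t => θ (t - 1), by fun_prop, fun t => ?_, a, b, ?_, ?_, hab⟩
  · rw [hsub]; exact hθ (t - 1)
  · exact ha.comp (tendsto_atBot_add_const_right _ (-1) tendsto_id)
  · exact hb.comp (tendsto_atTop_add_const_right _ (-1) tendsto_id)

lemma add_mem_lower_and_upper {p : ℂ} : (p + (P : ℂ) ∈ Γ.lower ↔ p ∈ Γ.lower) ∧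
    (p + (P : ℂ) ∈ Γ.upper ↔ p ∈ Γ.upper) := by
  have hl : p ∈ Γ.lower → p + (P : ℂ) ∈ Γ.lower := fun h =>
    ⟨fun ht => h.1 (Γ.add_mem_trace.1 ht), Γ.hasWindingNumber_add h.2⟩
  have hu : p ∈ Γ.upper → p + (P : ℂ) ∈ Γ.upper := fun h =>
    ⟨fun ht => h.1 (Γ.add_mem_trace.1 ht), Γ.hasWindingNumber_add h.2⟩
  have hd := Γ.disjoint_lower_upper
  refine ⟨⟨fun h => ?_, hl⟩, ⟨fun h => ?_, hu⟩⟩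
  · refine (Γ.winding p fun ht => h.1 (Γ.add_mem_trace.2 ht)).elim
      (fun hw => ⟨fun ht => h.1 (Γ.add_mem_trace.2 ht), hw⟩) fun hw => ?_
    exact (hd.le_bot ⟨h, hu ⟨fun ht => h.1 (Γ.add_mem_trace.2 ht), hw⟩⟩).elim
  · refine (Γ.winding p fun ht => h.1 (Γ.add_mem_trace.2 ht)).elim
      (fun hw => ?_) fun hw => ⟨fun ht => h.1 (Γ.add_mem_trace.2 ht), hw⟩
    exact (hd.le_bot ⟨hl ⟨fun ht => h.1 (Γ.add_mem_trace.2 ht), hw⟩, h⟩).elim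

variable {Γ}

lemma IsC1.isTwoSided (h : Γ.IsC1) (hP : 0 < P) : IsTwoSided Γ.trace := by
  obtain ⟨Γ', htr, hc, hd⟩ := h
  rw [← htr]
  exact isTwoSided_range (Γ'.isClosedEmbedding_param hP) hc hd

lemma IsC1.isPreconnected_lower (h : Γ.IsC1) (hP : 0 < P) : IsPreconnected Γ.lower :=
  (h.isTwoSided hP).isPreconnected Γ.isPreconnected_trace (Γ.isOpen_lower hP) (Γ.isOpen_upper hP)
    Γ.disjoint_lower_upper Γ.lower_union_upper (Γ.lower_nonempty hP) (Γ.upper_nonempty hP)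

lemma IsC1.isPreconnected_upper (h : Γ.IsC1) (hP : 0 < P) : IsPreconnected Γ.upper :=
  (h.isTwoSided hP).isPreconnected Γ.isPreconnected_trace (Γ.isOpen_upper hP) (Γ.isOpen_lower hP)
    Γ.disjoint_lower_upper.symm (by rw [union_comm, Γ.lower_union_upper])
    (Γ.upper_nonempty hP) (Γ.lower_nonempty hP)

lemma IsC1.trace_subset_closure_lower (h : Γ.IsC1) (hP : 0 < P) : Γ.trace ⊆ closure Γ.lower :=
  (h.isTwoSided hP).subset_closure Γ.isPreconnected_trace (Γ.isOpen_lower hP) (Γ.isOpen_upper hP)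
    Γ.disjoint_lower_upper Γ.lower_union_upper (Γ.lower_nonempty hP) (Γ.upper_nonempty hP)

lemma IsC1.trace_subset_closure_upper (h : Γ.IsC1) (hP : 0 < P) : Γ.trace ⊆ closure Γ.upper :=
  (h.isTwoSided hP).subset_closure Γ.isPreconnected_trace (Γ.isOpen_upper hP) (Γ.isOpen_lower hP)
    Γ.disjoint_lower_upper.symm (by rw [union_comm, Γ.lower_union_upper])
    (Γ.upper_nonempty hP) (Γ.lower_nonempty hP)

lemma IsC1.hasCollar_lower (h : Γ.IsC1) (hP : 0 < P) : HasCollar Γ.lower Γ.trace :=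
  (h.isTwoSided hP).hasCollar Γ.isPreconnected_trace (Γ.isOpen_lower hP) (Γ.isOpen_upper hP)
    Γ.disjoint_lower_upper Γ.lower_union_upper (Γ.lower_nonempty hP) (Γ.upper_nonempty hP)

lemma IsC1.hasCollar_upper (h : Γ.IsC1) (hP : 0 < P) : HasCollar Γ.upper Γ.trace :=
  (h.isTwoSided hP).hasCollar Γ.isPreconnected_trace (Γ.isOpen_upper hP) (Γ.isOpen_lower hP)
    Γ.disjoint_lower_upper.symm (by rw [union_comm, Γ.lower_union_upper])
    (Γ.upper_nonempty hP) (Γ.lower_nonempty hP)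

variable (Γ)

/-- An arc has no interior: a disc stays connected when a point is removed, an interval does not. -/
lemma interior_trace_eq_empty (hP : 0 < P) : interior Γ.trace = ∅ := by
  by_contra hne
  obtain ⟨z, hz⟩ := nonempty_iff_ne_empty.2 hne
  obtain ⟨r, hr, hball⟩ := Metric.isOpen_iff.1 isOpen_interior z hz
  have hemb := Γ.isClosedEmbedding_param hP
  have hsub : Metric.ball z r ⊆ range Γ.param := hball.trans interior_subset
  obtain ⟨t₀, ht₀⟩ := hsub (Metric.mem_ball_self hr)
  -- the disc without its centre is connected, being the image of a punctured disc in polar form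
  have hconn : IsPreconnected (Metric.ball z r \ {z}) := by
    have himg : Metric.ball z r \ {z} = (fun q : ℝ × ℝ => z + q.1 * exp (q.2 * I)) ''
        (Ioo 0 r ×ˢ univ) := by
      ext w
      constructor
      · rintro ⟨hw, hwz⟩
        have hwz' : w - z ≠ 0 := sub_ne_zero.2 hwz
        refine ⟨(‖w - z‖, arg (w - z)), ⟨⟨norm_pos_iff.2 hwz', ?_⟩, mem_univ _⟩, ?_⟩
        · rwa [← dist_eq_norm]
        · simp only [norm_mul_exp_arg_mul_I]; ring
      · rintro ⟨⟨s, θ⟩, ⟨hs, -⟩, rfl⟩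
        have hn : ‖(s : ℂ) * exp (θ * I)‖ = s := by
          rw [norm_mul, norm_exp_ofReal_mul_I, mul_one, norm_real, Real.norm_of_nonneg hs.1.le]
        refine ⟨?_, ?_⟩
        · rw [Metric.mem_ball, dist_eq_norm, add_sub_cancel_left, hn]; exact hs.2
        · intro h
          simp only [mem_singleton_iff, add_eq_left] at h
          rw [h, norm_zero] at hn
          exact hs.1.ne hn
    rw [himg]
    exact (isPreconnected_Ioo.prod isPreconnected_univ).image _ (by fun_prop)
  have hpre : IsPreconnected (Γ.param ⁻¹' (Metric.ball z r \ {z})) :=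
    (hemb.isInducing.isPreconnected_image).1 (by
      rw [image_preimage_eq_of_subset (sdiff_subset.trans hsub)]; exact hconn)
  have hopen : Γ.param ⁻¹' Metric.ball z r ∈ 𝓝 t₀ :=
    (Metric.isOpen_ball.preimage Γ.continuous_param).mem_nhds (by
      rw [mem_preimage, ht₀]; exact Metric.mem_ball_self hr)
  obtain ⟨ε, hε, hε'⟩ := Metric.mem_nhds_iff.1 hopen
  have hmem : ∀ t, t ≠ t₀ → |t - t₀| < ε → t ∈ Γ.param ⁻¹' (Metric.ball z r \ {z}) := by
    intro t ht htε
    refine ⟨hε' (by rwa [Metric.mem_ball, Real.dist_eq]), fun h => ht (Γ.injective_param ?_)⟩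
    rw [ht₀]; exact h
  have h1 := hmem (t₀ - ε / 2) (by linarith) (by
    rw [abs_lt]; constructor <;> linarith)
  have h2 := hmem (t₀ + ε / 2) (by linarith) (by
    rw [abs_lt]; constructor <;> linarith)
  have h3 : t₀ ∈ Γ.param ⁻¹' (Metric.ball z r \ {z}) :=
    hpre.Icc_subset h1 h2 ⟨by linarith, by linarith⟩
  exact h3.2 ht₀

end PeriodicArc

/-! ### Periodic strips -/

lemma add_mem_closure_iff {P : ℝ} {S : Set ℂ} (h : ∀ z, z + (P : ℂ) ∈ S ↔ z ∈ S) (z : ℂ) :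
    z + (P : ℂ) ∈ closure S ↔ z ∈ closure S := by
  have h1 : (fun z : ℂ => z + (P : ℂ)) ⁻¹' S = S := by ext z; exact h z
  have h2 := (Homeomorph.addRight (P : ℂ)).preimage_closure S
  rw [Homeomorph.coe_addRight, h1] at h2
  constructor
  · intro hz; rw [← h2]; exact hz
  · intro hz; rw [← h2] at hz; exact hz

/-- `Ω` is a periodic strip bounded below by `b` and above by `t`; `low` and `up` are the parts of
the plane beyond `b` and `t`. The notion is symmetric under exchanging the two sides, which is how
the reflection of the plane is avoided in the arguments below. -/
structure IsStrip (P : ℝ) (Ω b t low up : Set ℂ) : Prop where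
  isOpen_low : IsOpen low
  isOpen_up : IsOpen up
  isClosed_low : IsClosed (low ∪ b)
  isClosed_up : IsClosed (up ∪ t)
  isClosed_bot : IsClosed b
  isClosed_top : IsClosed t
  disjoint : Disjoint (low ∪ b) (up ∪ t)
  eq_compl : Ω = (low ∪ b ∪ (up ∪ t))ᶜ
  isPreconnected_bot : IsPreconnected b
  isPreconnected_top : IsPreconnected t
  bot_nonempty : b.Nonempty
  top_nonempty : t.Nonempty
  bot_subset : b ⊆ closure Ω
  top_subset : t ⊆ closure Ω
  collar_bot : HasCollar Ω b
  collar_top : HasCollar Ω t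
  isPreconnected : IsPreconnected Ω
  add_mem : ∀ z, z + (P : ℂ) ∈ Ω ↔ z ∈ Ω
  add_mem_bot : ∀ z, z + (P : ℂ) ∈ b ↔ z ∈ b
  add_mem_top : ∀ z, z + (P : ℂ) ∈ t ↔ z ∈ t
  exists_bound : ∃ C : ℝ, ∀ z ∈ Ω, |z.im| ≤ C

namespace IsStrip

variable {P : ℝ} {Ω b t low up : Set ℂ}

lemma flip (h : IsStrip P Ω b t low up) : IsStrip P Ω t b up low where
  isOpen_low := h.isOpen_up
  isOpen_up := h.isOpen_low
  isClosed_low := h.isClosed_up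
  isClosed_up := h.isClosed_low
  isClosed_bot := h.isClosed_top
  isClosed_top := h.isClosed_bot
  disjoint := h.disjoint.symm
  eq_compl := by rw [h.eq_compl, union_comm]
  isPreconnected_bot := h.isPreconnected_top
  isPreconnected_top := h.isPreconnected_bot
  bot_nonempty := h.top_nonempty
  top_nonempty := h.bot_nonempty
  bot_subset := h.top_subset
  top_subset := h.bot_subset
  collar_bot := h.collar_top
  collar_top := h.collar_bot
  isPreconnected := h.isPreconnected
  add_mem := h.add_mem
  add_mem_bot := h.add_mem_top
  add_mem_top := h.add_mem_bot
  exists_bound := h.exists_bound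

lemma isOpen (h : IsStrip P Ω b t low up) : IsOpen Ω := by
  rw [h.eq_compl]
  exact (h.isClosed_low.union h.isClosed_up).isOpen_compl

lemma notMem_bot (h : IsStrip P Ω b t low up) {z : ℂ} (hz : z ∈ Ω) : z ∉ b := fun hb => by
  rw [h.eq_compl] at hz
  exact hz (Or.inl (Or.inr hb))

lemma notMem_low (h : IsStrip P Ω b t low up) {z : ℂ} (hz : z ∈ Ω) : z ∉ low := fun hb => by
  rw [h.eq_compl] at hz
  exact hz (Or.inl (Or.inl hb))

lemma notMem_top (h : IsStrip P Ω b t low up) {z : ℂ} (hz : z ∈ Ω) : z ∉ t :=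
  h.flip.notMem_bot hz

lemma mem_closure_cases (h : IsStrip P Ω b t low up) {z : ℂ} (hz : z ∈ closure Ω) :
    z ∈ Ω ∨ z ∈ b ∨ z ∈ t := by
  by_contra! hcon
  obtain ⟨h1, h2, h3⟩ := hcon
  have h4 : z ∈ low ∪ b ∪ (up ∪ t) := by
    by_contra h4; exact h1 (by rw [h.eq_compl]; exact h4)
  rcases h4 with (h4 | h4) | (h4 | h4)
  · obtain ⟨w, hw, hwΩ⟩ := mem_closure_iff.1 hz low h.isOpen_low h4
    exact h.notMem_low hwΩ hw
  · exact h2 h4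
  · obtain ⟨w, hw, hwΩ⟩ := mem_closure_iff.1 hz up h.isOpen_up h4
    exact h.flip.notMem_low hwΩ hw
  · exact h3 h4

lemma add_mem_closure (h : IsStrip P Ω b t low up) (z : ℂ) :
    z + (P : ℂ) ∈ closure Ω ↔ z ∈ closure Ω :=
  add_mem_closure_iff h.add_mem z

end IsStrip

lemma mul_add_mem {P : ℝ} {S : Set ℂ} (h : ∀ z, z + (P : ℂ) ∈ S ↔ z ∈ S) (n : ℤ) (z : ℂ) :
    z + n * (P : ℂ) ∈ S ↔ z ∈ S := by
  induction n using Int.induction_on with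
  | zero => simp
  | succ n ih =>
    rw [← ih, ← h (z + ((n : ℤ) : ℂ) * P)]
    push_cast
    rw [show z + (n + 1) * (P : ℂ) = z + n * P + P by ring]
  | pred n ih =>
    rw [← ih, ← h (z + ((-(n : ℤ) - 1 : ℤ) : ℂ) * P)]
    push_cast
    rw [show z + (-n - 1) * (P : ℂ) + P = z + -n * P by ring]

/-- A continuous periodic function on a closed periodic set of bounded height attains its
minimum. -/
lemma exists_min_of_periodic {P : ℝ} (hP : 0 < P) {S : Set ℂ} (hS : IsClosed S)
    (hne : S.Nonempty) (hadd : ∀ z, z + (P : ℂ) ∈ S ↔ z ∈ S) {C : ℝ} (hC : ∀ z ∈ S, |z.im| ≤ C)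
    {f : ℂ → ℝ} (hf : ContinuousOn f S) (hper : ∀ z ∈ S, f (z + (P : ℂ)) = f z) :
    ∃ z ∈ S, ∀ w ∈ S, f z ≤ f w := by
  have hper' : ∀ (n : ℕ), ∀ z ∈ S, f (z + (n : ℤ) * (P : ℂ)) = f z := by
    intro n z hz
    induction n with
    | zero => simp
    | succ n ih =>
      rw [← ih, ← hper _ ((mul_add_mem hadd n z).2 hz)]
      push_cast; ring_nf
  have hper'' : ∀ (n : ℤ), ∀ z ∈ S, f (z + n * (P : ℂ)) = f z := by
    intro n z hz
    obtain ⟨m, rfl | rfl⟩ := n.eq_nat_or_neg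
    · exact hper' m z hz
    · have h1 := hper' m (z + ((-m : ℤ) : ℂ) * P) ((mul_add_mem hadd _ z).2 hz)
      rw [← h1]
      push_cast; ring_nf
  have hred : ∀ z ∈ S, ∃ w ∈ S, w.re ∈ Icc 0 P ∧ f w = f z := by
    intro z hz
    refine ⟨z + ((-⌊z.re / P⌋ : ℤ) : ℂ) * P, (mul_add_mem hadd _ z).2 hz, ?_, hper'' _ z hz⟩
    have h1 := Int.floor_le (z.re / P)
    have h2 := Int.lt_floor_add_one (z.re / P)
    rw [le_div_iff₀ hP] at h1
    rw [div_lt_iff₀ hP] at h2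
    have h3 : (z + ((-⌊z.re / P⌋ : ℤ) : ℂ) * P).re = z.re - ⌊z.re / P⌋ * P := by
      simp; ring
    rw [h3]
    constructor <;> linarith
  have hK : IsCompact (S ∩ {z | z.re ∈ Icc 0 P}) := by
    refine (isCompact_closedBall (0 : ℂ) (P + C)).of_isClosed_subset
      (hS.inter (isClosed_Icc.preimage continuous_re)) ?_
    rintro z ⟨hz, hz0, hz1⟩
    rw [mem_closedBall_zero_iff]
    refine (norm_le_abs_re_add_abs_im z).trans (add_le_add ?_ (hC z hz))
    rwa [abs_of_nonneg hz0]
  obtain ⟨z0, hz0⟩ := hne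
  obtain ⟨w0, hw0, hw0', -⟩ := hred z0 hz0
  obtain ⟨z, ⟨hzS, -⟩, hmin⟩ := hK.exists_isMinOn ⟨w0, hw0, hw0'⟩ (hf.mono inter_subset_left)
  refine ⟨z, hzS, fun w hw => ?_⟩
  obtain ⟨w', hw', hw'', heq⟩ := hred w hw
  rw [← heq]
  exact hmin ⟨hw', hw''⟩

/-- The region between two `C¹` arcs is a strip. -/
lemma ArcPair.isStrip_region {P : ℝ} (hP : 0 < P) (Γ : ArcPair P) (hb : Γ.bot.IsC1)
    (ht : Γ.top.IsC1) :
    IsStrip P Γ.region Γ.bot.trace Γ.top.trace Γ.bot.lower Γ.top.upper := by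
  have hmem : ∀ (A : PeriodicArc P) (z : ℂ), z ∈ A.trace ∨ z ∈ A.lower ∨ z ∈ A.upper := by
    intro A z
    by_cases hz : z ∈ A.trace
    · exact Or.inl hz
    · have : z ∈ A.lower ∪ A.upper := by rw [A.lower_union_upper]; exact hz
      exact Or.inr this
  have hlt : ∀ (A : PeriodicArc P) (z : ℂ), z ∈ A.lower → z ∉ A.trace := fun A z hz => hz.1
  have hut : ∀ (A : PeriodicArc P) (z : ℂ), z ∈ A.upper → z ∉ A.trace := fun A z hz => hz.1
  have hlu : ∀ (A : PeriodicArc P) (z : ℂ), z ∈ A.lower → z ∉ A.upper := fun A z hz hz' =>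
    A.disjoint_lower_upper.le_bot ⟨hz, hz'⟩
  have hbc : Γ.bot.lower ∪ Γ.bot.trace = Γ.bot.upperᶜ := by
    ext z
    have h1 := hmem Γ.bot z
    have h2 := hut Γ.bot z
    have h3 := hlu Γ.bot z
    simp only [mem_union, mem_compl_iff]
    tauto
  have htc : Γ.top.upper ∪ Γ.top.trace = Γ.top.lowerᶜ := by
    ext z
    have h1 := hmem Γ.top z
    have h2 := hlt Γ.top z
    have h3 := hlu Γ.top z
    simp only [mem_union, mem_compl_iff]
    tauto
  have hdisj : Disjoint (Γ.bot.lower ∪ Γ.bot.trace) (Γ.top.upper ∪ Γ.top.trace) := by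
    rcases Γ.bot_below_top with h | h
    · rw [htc, disjoint_compl_right_iff_subset]
      exact (union_subset subset_closure (hb.trace_subset_closure_lower hP)).trans h
    · rw [hbc, disjoint_compl_left_iff_subset]
      exact (union_subset subset_closure (ht.trace_subset_closure_upper hP)).trans h
  have heq : Γ.region = (Γ.bot.lower ∪ Γ.bot.trace ∪ (Γ.top.upper ∪ Γ.top.trace))ᶜ := by
    rw [compl_union, hbc, htc, compl_compl, compl_compl, inter_comm]; rfl
  have hclb : IsClosed (Γ.bot.lower ∪ Γ.bot.trace) := by
    rw [hbc]; exact (Γ.bot.isOpen_upper hP).isClosed_compl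
  have hclt : IsClosed (Γ.top.upper ∪ Γ.top.trace) := by
    rw [htc]; exact (Γ.top.isOpen_lower hP).isClosed_compl
  have hbtop : ∀ z ∈ Γ.bot.trace, z ∈ Γ.top.lower := fun z hz => by
    by_contra hcon
    exact hdisj.le_bot ⟨Or.inr hz, by rw [htc]; exact hcon⟩
  have htbot : ∀ z ∈ Γ.top.trace, z ∈ Γ.bot.upper := fun z hz => by
    by_contra hcon
    exact hdisj.le_bot ⟨by rw [hbc]; exact hcon, Or.inr hz⟩
  have hbsub : Γ.bot.trace ⊆ closure Γ.region := by
    intro z hz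
    rw [mem_closure_iff]
    intro O hO hzO
    obtain ⟨w, ⟨hw1, hw2⟩, hw3⟩ := mem_closure_iff.1 (hb.trace_subset_closure_upper hP hz)
      (O ∩ Γ.top.lower) (hO.inter (Γ.top.isOpen_lower hP)) ⟨hzO, hbtop z hz⟩
    exact ⟨w, hw1, hw2, hw3⟩
  have htsub : Γ.top.trace ⊆ closure Γ.region := by
    intro z hz
    rw [mem_closure_iff]
    intro O hO hzO
    obtain ⟨w, ⟨hw1, hw2⟩, hw3⟩ := mem_closure_iff.1 (ht.trace_subset_closure_lower hP hz)
      (O ∩ Γ.bot.upper) (hO.inter (Γ.bot.isOpen_upper hP)) ⟨hzO, htbot z hz⟩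
    exact ⟨w, hw1, hw3, hw2⟩
  have hcb : HasCollar Γ.region Γ.bot.trace := by
    intro p hp W hW
    obtain ⟨N, hN, hpN, hNW, hc⟩ := hb.hasCollar_upper hP p hp (W ∩ Γ.top.lower)
      (inter_mem hW ((Γ.top.isOpen_lower hP).mem_nhds (hbtop p hp)))
    refine ⟨N, hN, hpN, hNW.trans inter_subset_left, ?_⟩
    have : N ∩ Γ.region = N ∩ Γ.bot.upper := by
      ext z
      exact ⟨fun h => ⟨h.1, h.2.2⟩, fun h => ⟨h.1, (hNW h.1).2, h.2⟩⟩
    rw [this]; exact hc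
  have hct : HasCollar Γ.region Γ.top.trace := by
    intro p hp W hW
    obtain ⟨N, hN, hpN, hNW, hc⟩ := ht.hasCollar_lower hP p hp (W ∩ Γ.bot.upper)
      (inter_mem hW ((Γ.bot.isOpen_upper hP).mem_nhds (htbot p hp)))
    refine ⟨N, hN, hpN, hNW.trans inter_subset_left, ?_⟩
    have : N ∩ Γ.region = N ∩ Γ.top.lower := by
      ext z
      exact ⟨fun h => ⟨h.1, h.2.1⟩, fun h => ⟨h.1, h.2, (hNW h.1).2⟩⟩
    rw [this]; exact hc
  have hopen : IsOpen Γ.region := (Γ.top.isOpen_lower hP).inter (Γ.bot.isOpen_upper hP)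
  refine ⟨Γ.bot.isOpen_lower hP, Γ.top.isOpen_upper hP, hclb, hclt, Γ.bot.isClosed_trace hP,
    Γ.top.isClosed_trace hP, hdisj, heq, Γ.bot.isPreconnected_trace, Γ.top.isPreconnected_trace,
    Γ.bot.trace_nonempty, Γ.top.trace_nonempty, hbsub, htsub, hcb, hct, ?_, ?_,
    fun z => Γ.bot.add_mem_trace, fun z => Γ.top.add_mem_trace, ?_⟩
  · -- a component of the region that stays away from the top arc would be all of the upper
    -- complement of the bottom arc
    refine hct.isPreconnected Γ.top.isPreconnected_trace htsub fun x hx => ?_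
    by_contra hcon
    have h1 : Γ.bot.upper ⊆ connectedComponentIn Γ.region x := by
      refine (hb.isPreconnected_upper hP).subset_of_closure_inter_subset
        hopen.connectedComponentIn ⟨x, hx.2, mem_connectedComponentIn hx⟩ ?_
      rintro y ⟨hy, hyu⟩
      refine closure_connectedComponentIn_inter ⟨hy, ?_, hyu⟩
      by_contra hyl
      have hyt : y ∈ Γ.top.upper ∪ Γ.top.trace := by rw [htc]; exact hyl
      rcases hyt with hyt | hyt
      · obtain ⟨w, hw, hwC⟩ := mem_closure_iff.1 hy _ (Γ.top.isOpen_upper hP) hyt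
        exact hlu _ _ (connectedComponentIn_subset _ _ hwC).1 hw
      · exact hcon ⟨y, hy, hyt⟩
    obtain ⟨w, hw⟩ := Γ.top.upper_nonempty hP
    have hwb : w ∈ Γ.bot.upper := by
      by_contra hcon
      exact hdisj.le_bot ⟨by rw [hbc]; exact hcon, Or.inl hw⟩
    exact hlu _ _ (connectedComponentIn_subset _ _ (h1 hwb)).1 hw
  · intro z
    exact and_congr Γ.top.add_mem_lower_and_upper.1 Γ.bot.add_mem_lower_and_upper.2
  · obtain ⟨C, hC, -⟩ := Γ.bot.exists_im_bound hP
    obtain ⟨C', -, hC'⟩ := Γ.top.exists_im_bound hP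
    refine ⟨max C C', fun z hz => abs_le.2 ⟨?_, ?_⟩⟩
    · by_contra! hlt
      exact hlu _ _ (hC z (by linarith [le_max_left C C'])) hz.2
    · by_contra! hlt
      exact hlu _ _ hz.1 (hC' z (by linarith [le_max_right C C']))

/-! ### Stream functions in a strip -/

/-- Components of the gradient in the complex plane. -/
lemma gradient_eq_fderiv_add (U : ℂ → ℝ) (z : ℂ) :
    gradient U z = (fderiv ℝ U z 1 : ℂ) + fderiv ℝ U z I * I := by
  have h : ∀ v : ℂ, inner ℝ (gradient U z) v = fderiv ℝ U z v := fun v => by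
    rw [gradient, InnerProductSpace.toDual_symm_apply]
  have h1 := h 1
  have h2 := h I
  rw [Complex.inner] at h1 h2
  apply Complex.ext
  · simp at h1 ⊢; exact h1
  · simp at h2 ⊢; exact h2

lemma norm_gradient_eq (U : ℂ → ℝ) (z : ℂ) :
    ‖gradient U z‖ = ‖(fderiv ℝ U z 1 : ℂ) - I * fderiv ℝ U z I‖ := by
  rw [gradient_eq_fderiv_add, ← Complex.norm_conj ((fderiv ℝ U z 1 : ℂ) + fderiv ℝ U z I * I)]
  congr 1
  simp
  ring

lemma gradient_const_sub (U : ℂ → ℝ) (c : ℝ) (z : ℂ) :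
    gradient (fun w => c - U w) z = -gradient U z := by
  rw [gradient_eq_fderiv_add, gradient_eq_fderiv_add, fderiv_const_sub]
  simp
  ring

lemma fderiv_apply_eq_inner (U : ℂ → ℝ) (z v : ℂ) : fderiv ℝ U z v = inner ℝ (gradient U z) v := by
  rw [gradient, InnerProductSpace.toDual_symm_apply]

/-- If a function at most `M` on a connected open set is locally constant wherever it has a local
maximum, then it is constant as soon as it attains the value `M`. -/
lemma eqOn_of_strong_max {D : Set ℂ} (hD : IsOpen D) (hc : IsPreconnected D) {v : ℂ → ℝ} {M : ℝ}
    (hv : ContinuousOn v D) (hs : ∀ p ∈ D, IsLocalMax v p → ∀ᶠ z in 𝓝 p, v z = v p)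
    (hle : ∀ z ∈ D, v z ≤ M) {p : ℂ} (hp : p ∈ D) (hpM : v p = M) : ∀ z ∈ D, v z = M := by
  have hA : IsOpen {z | z ∈ D ∧ v z = M} := by
    rw [isOpen_iff_mem_nhds]
    rintro z ⟨hz, hzM⟩
    have hmax : IsLocalMax v z := by
      filter_upwards [hD.mem_nhds hz] with w hw
      rw [hzM]; exact hle w hw
    filter_upwards [hs z hz hmax, hD.mem_nhds hz] with w hw hwD
    exact ⟨hwD, hw.trans hzM⟩
  have hB : IsOpen (D ∩ v ⁻¹' {M}ᶜ) := hv.isOpen_inter_preimage hD isOpen_compl_singleton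
  have h1 := hc.subset_left_of_subset_union hA hB (by
    rw [Set.disjoint_left]
    rintro z ⟨-, h1⟩ ⟨-, h2⟩
    exact h2 h1) (fun z hz => by
      by_cases h : v z = M
      · exact Or.inl ⟨hz, h⟩
      · exact Or.inr ⟨hz, h⟩) ⟨p, hp, hp, hpM⟩
  exact fun z hz => (h1 hz).2

open InnerProductSpace in
lemma eventually_eq_of_isLocalMax_of_harmonicAt {v : ℂ → ℝ} {p : ℂ} (h : HarmonicAt v p)
    (hm : IsLocalMax v p) : ∀ᶠ z in 𝓝 p, v z = v p :=
  eventually_eq_of_isLocalMax (h.1.eventually (by simp))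
    (h.2.mono fun z hz => by rw [hz]; simp) hm

/-- `U` is the stream function of the strip `Ω`, and `V` the continuous extension of its gradient,
with `‖V‖ = a` on both sides; the logarithm of the speed `a` is subharmonic in `Ω`, in the sense of
the Laplacian. -/
structure IsFlow (P : ℝ) (a : ℂ → ℝ) (Ω b t low up : Set ℂ) (U : ℂ → ℝ) (V : ℂ → ℂ) : Prop where
  strip : IsStrip P Ω b t low up
  period_pos : 0 < P
  speed_pos : ∀ z, 0 < a z
  speed_periodic : ∀ z, a (z + (P : ℂ)) = a z
  speed_smooth : ContDiff ℝ 2 a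
  laplacian_nonneg : ∀ z ∈ Ω, 0 ≤ Laplacian.laplacian (fun w => Real.log (a w)) z
  continuousOn : ContinuousOn U (closure Ω)
  periodic : ∀ z ∈ closure Ω, U (z + (P : ℂ)) = U z
  harmonic : InnerProductSpace.HarmonicOnNhd U Ω
  eq_zero : ∀ z ∈ b, U z = 0
  eq_one : ∀ z ∈ t, U z = 1
  continuousOn_grad : ContinuousOn V (closure Ω)
  grad_eq : ∀ z ∈ Ω, V z = gradient U z
  norm_grad : ∀ z ∈ b ∪ t, ‖V z‖ = a z

namespace IsFlow

variable {P : ℝ} {a : ℂ → ℝ} {Ω b t low up : Set ℂ} {U : ℂ → ℝ} {V : ℂ → ℂ}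

lemma flip (h : IsFlow P a Ω b t low up U V) :
    IsFlow P a Ω t b up low (fun z => 1 - U z) (fun z => -V z) where
  strip := h.strip.flip
  period_pos := h.period_pos
  speed_pos := h.speed_pos
  speed_periodic := h.speed_periodic
  speed_smooth := h.speed_smooth
  laplacian_nonneg := h.laplacian_nonneg
  continuousOn := continuousOn_const.sub h.continuousOn
  periodic := fun z hz => by rw [h.periodic z hz]
  harmonic := (InnerProductSpace.harmonicOnNhd_const 1).sub h.harmonic
  eq_zero := fun z hz => by rw [h.eq_one z hz, sub_self]
  eq_one := fun z hz => by rw [h.eq_zero z hz, sub_zero]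
  continuousOn_grad := h.continuousOn_grad.neg
  grad_eq := fun z hz => by rw [gradient_const_sub, h.grad_eq z hz]
  norm_grad := fun z hz => by rw [norm_neg]; exact h.norm_grad z hz.symm

lemma false_of_eventually_const (h : IsFlow P a Ω b t low up U V) {z : ℂ} (hz : z ∈ Ω) {c : ℝ}
    (hc : ∀ᶠ w in 𝓝 z, U w = c) : False := by
  have h1 : AnalyticOnNhd ℝ U Ω := fun w hw => HarmonicAt.analyticAt (h.harmonic w hw)
  have h2 : EqOn U (fun _ => c) Ω := h1.eqOn_of_preconnected_of_eventuallyEq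
    (fun _ _ => analyticAt_const) h.strip.isPreconnected hz hc
  have h3 : EqOn U (fun _ => c) (closure Ω) :=
    h2.of_subset_closure h.continuousOn continuousOn_const subset_closure subset_rfl
  obtain ⟨p, hp⟩ := h.strip.bot_nonempty
  obtain ⟨q, hq⟩ := h.strip.top_nonempty
  have h4 := h3 (h.strip.bot_subset hp)
  have h5 := h3 (h.strip.top_subset hq)
  simp only [h.eq_zero p hp, h.eq_one q hq] at h4 h5
  linarith

lemma not_isLocalMax (h : IsFlow P a Ω b t low up U V) {z : ℂ} (hz : z ∈ Ω) :
    ¬ IsLocalMax U z := fun hm =>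
  h.false_of_eventually_const hz (eventually_eq_of_isLocalMax_of_harmonicAt (h.harmonic z hz) hm)

lemma not_isLocalMin (h : IsFlow P a Ω b t low up U V) {z : ℂ} (hz : z ∈ Ω) :
    ¬ IsLocalMin U z := fun hm => h.flip.not_isLocalMax hz (by
  filter_upwards [hm] with w hw
  linarith)

lemma exists_bound_closure (h : IsFlow P a Ω b t low up U V) :
    ∃ C : ℝ, ∀ z ∈ closure Ω, |z.im| ≤ C := by
  obtain ⟨C, hC⟩ := h.strip.exists_bound
  refine ⟨C, fun z hz => ?_⟩
  have h1 : IsClosed {z : ℂ | |z.im| ≤ C} := isClosed_le (by fun_prop) continuous_const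
  exact closure_minimal (fun z hz => hC z hz) h1 hz

lemma nonneg (h : IsFlow P a Ω b t low up U V) {z : ℂ} (hz : z ∈ closure Ω) : 0 ≤ U z := by
  obtain ⟨C, hC⟩ := h.exists_bound_closure
  obtain ⟨w, hw, hmin⟩ := exists_min_of_periodic h.period_pos isClosed_closure ⟨z, hz⟩
    h.strip.add_mem_closure hC h.continuousOn h.periodic
  rcases h.strip.mem_closure_cases hw with h1 | h1 | h1
  · refine (h.not_isLocalMin h1 ?_).elim
    filter_upwards [h.strip.isOpen.mem_nhds h1] with y hy using hmin y (subset_closure hy)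
  · rw [← h.eq_zero w h1]; exact hmin z hz
  · refine le_trans ?_ (hmin z hz)
    rw [h.eq_one w h1]; exact zero_le_one

lemma pos (h : IsFlow P a Ω b t low up U V) {z : ℂ} (hz : z ∈ Ω) : 0 < U z := by
  refine (h.nonneg (subset_closure hz)).lt_of_ne fun h0 => h.not_isLocalMin hz ?_
  filter_upwards [h.strip.isOpen.mem_nhds hz] with y hy
  rw [← h0]; exact h.nonneg (subset_closure hy)

lemma le_one (h : IsFlow P a Ω b t low up U V) {z : ℂ} (hz : z ∈ closure Ω) : U z ≤ 1 :=
  sub_nonneg.1 (h.flip.nonneg hz)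

lemma lt_one (h : IsFlow P a Ω b t low up U V) {z : ℂ} (hz : z ∈ Ω) : U z < 1 :=
  sub_pos.1 (h.flip.pos hz)

lemma isOpen_superlevel (h : IsFlow P a Ω b t low up U V) (c : ℝ) :
    IsOpen {z | z ∈ Ω ∧ c < U z} :=
  (h.continuousOn.mono subset_closure).isOpen_inter_preimage h.strip.isOpen isOpen_Ioi

lemma exists_isOpen_superlevel (h : IsFlow P a Ω b t low up U V) {c : ℝ} (hc : c < 1) {p : ℂ}
    (hp : p ∈ t) : ∃ O, IsOpen O ∧ p ∈ O ∧ ∀ z ∈ O ∩ Ω, c < U z := by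
  have h1 : ∀ᶠ z in 𝓝[closure Ω] p, c < U z :=
    (h.continuousOn p (h.strip.top_subset hp)).eventually_const_lt (by rwa [h.eq_one p hp])
  obtain ⟨O, hO, hpO, hsub⟩ := mem_nhdsWithin.1 h1
  exact ⟨O, hO, hpO, fun z hz => hsub ⟨hz.1, subset_closure hz.2⟩⟩

lemma top_subset_closure_superlevel (h : IsFlow P a Ω b t low up U V) {c : ℝ} (hc : c < 1) :
    t ⊆ closure {z | z ∈ Ω ∧ c < U z} := by
  intro p hp
  obtain ⟨O, hO, hpO, hsub⟩ := h.exists_isOpen_superlevel hc hp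
  rw [mem_closure_iff]
  intro O' hO' hpO'
  obtain ⟨w, ⟨hw1, hw2⟩, hw⟩ := mem_closure_iff.1 (h.strip.top_subset hp) (O' ∩ O)
    (hO'.inter hO) ⟨hpO', hpO⟩
  exact ⟨w, hw1, hw, hsub w ⟨hw2, hw⟩⟩

lemma hasCollar_superlevel (h : IsFlow P a Ω b t low up U V) {c : ℝ} (hc : c < 1) :
    HasCollar {z | z ∈ Ω ∧ c < U z} t := by
  intro p hp W hW
  obtain ⟨O, hO, hpO, hsub⟩ := h.exists_isOpen_superlevel hc hp
  obtain ⟨N, hN, hpN, hNW, hcN⟩ := h.strip.collar_top p hp (W ∩ O)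
    (inter_mem hW (hO.mem_nhds hpO))
  refine ⟨N, hN, hpN, hNW.trans inter_subset_left, ?_⟩
  have : N ∩ {z | z ∈ Ω ∧ c < U z} = N ∩ Ω := by
    ext z
    exact ⟨fun hz => ⟨hz.1, hz.2.1⟩, fun hz => ⟨hz.1, hz.2, hsub z ⟨(hNW hz.1).2, hz.2⟩⟩⟩
  rw [this]; exact hcN

/-- Superlevel sets of the stream function are connected: by the maximum principle, applied to all
horizontal translates of a component at once, each component reaches the top. -/
lemma isPreconnected_superlevel (h : IsFlow P a Ω b t low up U V) {c : ℝ} (hc0 : 0 ≤ c)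
    (hc : c < 1) : IsPreconnected {z | z ∈ Ω ∧ c < U z} := by
  set S := {z | z ∈ Ω ∧ c < U z} with hS
  have hSo : IsOpen S := h.isOpen_superlevel c
  have hcol := h.hasCollar_superlevel hc
  have htS := h.top_subset_closure_superlevel hc
  have hSadd : ∀ z, z + (P : ℂ) ∈ S ↔ z ∈ S := by
    intro z
    simp only [hS, mem_ofPred_eq, h.strip.add_mem]
    exact and_congr_right fun hw => by rw [h.periodic z (subset_closure hw)]
  refine hcol.isPreconnected h.strip.isPreconnected_top htS fun x hx => ?_
  by_contra hcon
  set C := connectedComponentIn S x with hC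
  -- the translates of the component `C`, and their union `T`
  set A : ℤ → Set ℂ := fun n => (fun z : ℂ => z + n * (P : ℂ)) ⁻¹' C with hA
  have hAS : ∀ n, A n ⊆ S := fun n z hz =>
    (mul_add_mem hSadd n z).1 (connectedComponentIn_subset _ _ hz)
  have hsat : ∀ n, ∀ D ⊆ S, IsPreconnected D → (D ∩ A n).Nonempty → D ⊆ A n := by
    rintro n D hD hDc ⟨w, hwD, hw⟩
    have h1 : (fun z : ℂ => z + n * (P : ℂ)) '' D ⊆ C := by
      refine connectedComponentIn_saturated ?_ (hDc.image _ (by fun_prop)) ⟨_, ⟨w, hwD, rfl⟩, hw⟩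
      rintro _ ⟨z, hz, rfl⟩
      exact (mul_add_mem hSadd n z).2 (hD hz)
    exact fun z hz => h1 ⟨z, hz, rfl⟩
  have hAo : ∀ n, IsOpen (A n) := fun n =>
    hSo.connectedComponentIn.preimage (by fun_prop)
  have hAcl : ∀ n z, z ∈ closure (A n) → z + n * (P : ℂ) ∈ closure C := by
    intro n z hz
    have := (Homeomorph.addRight (n * (P : ℂ))).preimage_closure C
    rw [Homeomorph.coe_addRight] at this
    have hz' : z ∈ (fun x => x + n * (P : ℂ)) ⁻¹' closure C := by rw [this]; exact hz
    exact hz'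
  set T := ⋃ n, A n with hT
  have hTadd : ∀ z, z + (P : ℂ) ∈ T ↔ z ∈ T := by
    intro z
    simp only [hT, mem_iUnion, hA, mem_preimage]
    constructor
    · rintro ⟨n, hn⟩
      refine ⟨n + 1, ?_⟩
      push_cast
      rwa [show z + (n + 1) * (P : ℂ) = z + P + n * P by ring]
    · rintro ⟨n, hn⟩
      refine ⟨n - 1, ?_⟩
      push_cast
      rwa [show z + (P : ℂ) + (n - 1) * P = z + n * P by ring]
  have hTS : T ⊆ S := iUnion_subset hAS
  have hTΩ : closure T ⊆ closure Ω := closure_mono (hTS.trans fun z hz => hz.1)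
  have hxT : x ∈ T := mem_iUnion.2 ⟨0, by simpa [hA] using mem_connectedComponentIn hx⟩
  obtain ⟨B, hB⟩ := h.exists_bound_closure
  obtain ⟨p, hp, hmax⟩ := exists_min_of_periodic (f := fun z => -U z) h.period_pos
    isClosed_closure ⟨x, subset_closure hxT⟩ (add_mem_closure_iff hTadd) (fun z hz => hB z (hTΩ hz))
    (h.continuousOn.mono hTΩ).neg (fun z hz => by rw [h.periodic z (hTΩ hz)])
  have hpc : c < U p := by
    have := hmax x (subset_closure hxT)
    have := hx.2
    linarith
  rcases h.strip.mem_closure_cases (hTΩ hp) with h1 | h1 | h1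
  · have hpS : p ∈ S := ⟨h1, hpc⟩
    obtain ⟨r, hr, hball⟩ := Metric.isOpen_iff.1 hSo p hpS
    obtain ⟨w, hw, hwT⟩ := mem_closure_iff.1 hp _ Metric.isOpen_ball (Metric.mem_ball_self hr)
    obtain ⟨n, hn⟩ := mem_iUnion.1 hwT
    have h2 := hsat n _ hball (convex_ball p r).isPreconnected ⟨w, hw, hn⟩
    refine h.not_isLocalMax h1 ?_
    filter_upwards [(hAo n).mem_nhds (h2 (Metric.mem_ball_self hr))] with z hz
    have := hmax z (subset_closure (mem_iUnion.2 ⟨n, hz⟩))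
    linarith
  · rw [h.eq_zero p h1] at hpc
    linarith
  · obtain ⟨N, hN, hpN, -, hNc⟩ := hcol p h1 univ univ_mem
    obtain ⟨w, hw, hwT⟩ := mem_closure_iff.1 hp N hN hpN
    obtain ⟨n, hn⟩ := mem_iUnion.1 hwT
    have h2 := hsat n _ inter_subset_right hNc ⟨w, ⟨hw, hAS n hn⟩, hn⟩
    have h3 : p ∈ closure (A n) := by
      rw [mem_closure_iff]
      intro O hO hpO
      obtain ⟨y, ⟨hy1, hy2⟩, hyS⟩ := mem_closure_iff.1 (htS h1) (O ∩ N) (hO.inter hN) ⟨hpO, hpN⟩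
      exact ⟨y, hy1, h2 ⟨hy2, hyS⟩⟩
    exact hcon ⟨_, hAcl n p h3, (mul_add_mem h.strip.add_mem_top n p).2 h1⟩

lemma isPathConnected_superlevel (h : IsFlow P a Ω b t low up U V) {c : ℝ} (hc0 : 0 ≤ c)
    (hc : c < 1) : IsPathConnected {z | z ∈ Ω ∧ c < U z} := by
  rw [← (h.isOpen_superlevel c).isConnected_iff_isPathConnected]
  refine ⟨closure_nonempty_iff.1 (h.strip.top_nonempty.mono
    (h.top_subset_closure_superlevel hc)), h.isPreconnected_superlevel hc0 hc⟩

lemma isPathConnected_sublevel (h : IsFlow P a Ω b t low up U V) {c : ℝ} (hc0 : 0 < c)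
    (hc : c ≤ 1) : IsPathConnected {z | z ∈ Ω ∧ U z < c} := by
  have h1 := h.flip.isPathConnected_superlevel (c := 1 - c) (by linarith) (by linarith)
  have h2 : {z | z ∈ Ω ∧ 1 - c < 1 - U z} = {z | z ∈ Ω ∧ U z < c} := by
    ext z
    simp only [mem_ofPred_eq, sub_lt_sub_iff_left]
  rwa [h2] at h1

/-- The stream function has no critical points: at one, four or more sectors would alternately
belong to a superlevel set and to a sublevel set, both of which are connected. -/
lemma gradient_ne_zero (h : IsFlow P a Ω b t low up U V) {p : ℂ} (hp : p ∈ Ω) :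
    gradient U p ≠ 0 := by
  intro hgrad
  have hfd : fderiv ℝ U p = 0 := by
    ext1 v
    rw [fderiv_apply_eq_inner, hgrad]
    simp
  obtain ⟨R, hR, hball⟩ := Metric.isOpen_iff.1 h.strip.isOpen p hp
  obtain ⟨F, hF, hFU⟩ := InnerProductSpace.HarmonicOnNhd.exists_analyticOnNhd_ball_re_eq
    (h.harmonic.mono hball)
  have hFp := hF p (Metric.mem_ball_self hR)
  have hGan : AnalyticAt ℂ (fun z => F z - F p) p := hFp.sub analyticAt_const
  have hne : ¬ ∀ᶠ z in 𝓝 p, F z - F p = 0 := by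
    intro hev
    refine h.false_of_eventually_const hp (c := (F p).re) ?_
    filter_upwards [hev, Metric.ball_mem_nhds p hR] with z hz hzb
    have := hFU hzb
    simp only at this
    rw [← this, sub_eq_zero.1 hz]
  -- near `p`, `U` is the real part of `F p + (z - p) ^ n * g z`
  obtain ⟨n, g, hg, hg0, hGg⟩ := hGan.exists_eventuallyEq_pow_smul_nonzero_iff.2 hne
  have hn0 : n ≠ 0 := by
    rintro rfl
    have := hGg.self_of_nhds
    simp only [sub_self, pow_zero, one_smul] at this
    exact hg0 this.symm
  -- a zero of order one would contradict the vanishing of the gradient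
  have hn1 : n ≠ 1 := by
    rintro rfl
    have h1 : HasDerivAt (fun z => F z - F p) (g p) p := by
      have h2 : HasDerivAt (fun z => (z - p) ^ 1 • g z) (g p) p := by
        have := ((hasDerivAt_id p).sub_const p).fun_mul hg.differentiableAt.hasDerivAt
        simpa using this
      exact h2.congr_of_eventuallyEq hGg
    have h3 : HasFDerivAt U (reCLM.comp ((ContinuousLinearMap.toSpanSingleton ℂ
        (g p)).restrictScalars ℝ)) p := by
      have h4 := (reCLM.hasFDerivAt.comp p (h1.hasFDerivAt.restrictScalars ℝ)).add_const (F p).re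
      refine h4.congr_of_eventuallyEq ?_
      filter_upwards [Metric.ball_mem_nhds p hR] with z hz
      have := hFU hz
      simp only at this
      simp [this]
    have h5 := h3.fderiv
    rw [hfd] at h5
    have h6 := DFunLike.congr_fun h5 ((starRingEnd ℂ) (g p))
    simp [mul_comm, Complex.mul_conj] at h6
    exact (Complex.normSq_pos.2 hg0).ne h6
  have hn2 : 2 ≤ n := by omega
  have hnpos : (0 : ℝ) < n := by exact_mod_cast (by omega : 0 < n)
  -- along the ray in direction `w * ω ^ j`, the leading term has the sign `(-1) ^ j`
  obtain ⟨w, hw⟩ := IsAlgClosed.exists_pow_nat_eq (g p)⁻¹ (n := n) (by omega)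
  have hw0 : w ≠ 0 := by
    rintro rfl
    rw [zero_pow hn0] at hw
    exact inv_ne_zero hg0 hw.symm
  have hre : ∀ᶠ z in 𝓝 p, 0 < (g z / g p).re := by
    have hcont : ContinuousAt (fun z => (g z / g p).re) p :=
      continuous_re.continuousAt.comp (f := fun z => g z / g p)
        (hg.continuousAt.div_const (g p))
    refine hcont.eventually_const_lt ?_
    change 0 < (g p / g p).re
    rw [div_self hg0]; simp
  obtain ⟨ρ, hρ, hρball⟩ := Metric.eventually_nhds_iff_ball.1
    ((hGg.and hre).and (Metric.ball_mem_nhds p hR))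
  set δ := ρ / (2 * ‖w‖) with hδ
  have hwn : 0 < ‖w‖ := norm_pos_iff.2 hw0
  have hδpos : 0 < δ := by positivity
  set α := Real.pi / n with hα
  have hα0 : 0 < α := div_pos Real.pi_pos hnpos
  have hα2 : α ≤ Real.pi / 2 := by
    have : (2 : ℝ) ≤ n := by exact_mod_cast hn2
    exact div_le_div_of_nonneg_left Real.pi_pos.le two_pos this
  set ω := exp (α * I) with hω
  have hωn : ω ^ n = -1 := by
    rw [hω, ← Complex.exp_nat_mul, ← mul_assoc]
    have : (n : ℂ) * (α : ℂ) = Real.pi := by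
      rw [hα]; push_cast
      have : (n : ℂ) ≠ 0 := by exact_mod_cast hn0
      field_simp
    rw [this, Complex.exp_pi_mul_I]
  have hωnorm : ‖ω‖ = 1 := norm_exp_ofReal_mul_I α
  set c := U p with hc
  have hkey : ∀ j : ℕ, ∀ s ∈ Ioc (0 : ℝ) 1, p + s * (δ * w * ω ^ j) ∈ Ω ∧
      0 < (-1) ^ j * (U (p + s * (δ * w * ω ^ j)) - c) := by
    intro j s hs
    set z := p + s * (δ * w * ω ^ j) with hz
    have hzb : z ∈ Metric.ball p ρ := by
      rw [Metric.mem_ball, dist_eq_norm, hz, add_sub_cancel_left, norm_mul, norm_mul, norm_mul,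
        norm_pow, hωnorm, one_pow, mul_one, norm_real, norm_real, Real.norm_of_nonneg hs.1.le,
        Real.norm_of_nonneg hδpos.le]
      have h1 : δ * ‖w‖ = ρ / 2 := by rw [hδ]; field_simp
      rw [h1]
      nlinarith [hs.2]
    obtain ⟨⟨hz1, hz2⟩, hz3⟩ := hρball z hzb
    refine ⟨hball hz3, ?_⟩
    have h1 : F z - F p = ((-1) ^ j * (s * δ) ^ n : ℝ) * (g z / g p) := by
      rw [hz1, hz, add_sub_cancel_left, smul_eq_mul]
      have : (s * (δ * w * ω ^ j) : ℂ) ^ n = (s * δ) ^ n * w ^ n * (ω ^ n) ^ j := by ring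
      rw [this, hw, hωn]
      push_cast
      ring
    have h2 : U z - c = (-1) ^ j * (s * δ) ^ n * (g z / g p).re := by
      have h3 := hFU hz3
      have h4 := hFU (Metric.mem_ball_self hR)
      simp only at h3 h4
      rw [hc, ← h3, ← h4, ← sub_re, h1, re_ofReal_mul]
    rw [h2, show (-1 : ℝ) ^ j * ((-1) ^ j * (s * δ) ^ n * (g z / g p).re) =
      ((-1) ^ j) ^ 2 * ((s * δ) ^ n * (g z / g p).re) by ring, ← pow_mul, mul_comm j 2, pow_mul]
    have := hs.1
    simp only [even_two, Even.neg_pow, one_pow, one_mul]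
    positivity
  have hXp := h.isPathConnected_superlevel (h.pos hp).le (h.lt_one hp)
  have hYp := h.isPathConnected_sublevel (h.pos hp) (h.lt_one hp).le
  refine false_of_alternating_segments hXp hYp ?_ (p := p) (u := δ * w)
    (fun hpX => lt_irrefl _ hpX.2) (fun hpY => lt_irrefl _ hpY.2)
    (by simp [hδpos.ne', hw0]) hα0 hα2 ?_ ?_ ?_ ?_
  · rw [Set.disjoint_left]
    rintro z ⟨-, h1⟩ ⟨-, h2⟩
    exact lt_asymm h1 h2
  · intro s hs
    obtain ⟨h1, h2⟩ := hkey 0 s hs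
    simp only [pow_zero, mul_one, one_mul, sub_pos] at h1 h2
    exact ⟨h1, h2⟩
  · intro s hs
    obtain ⟨h1, h2⟩ := hkey 1 s hs
    simp only [pow_one] at h1 h2
    exact ⟨h1, by linarith⟩
  · intro s hs
    obtain ⟨h1, h2⟩ := hkey 2 s hs
    exact ⟨h1, by linarith⟩
  · intro s hs
    obtain ⟨h1, h2⟩ := hkey 3 s hs
    exact ⟨h1, by linarith⟩

lemma ne_zero (h : IsFlow P a Ω b t low up U V) {z : ℂ} (hz : z ∈ closure Ω) : V z ≠ 0 := by
  rcases h.strip.mem_closure_cases hz with h1 | h1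
  · rw [h.grad_eq z h1]; exact h.gradient_ne_zero h1
  · have h2 := h.norm_grad z h1
    have h3 := h.speed_pos z
    rw [← h2] at h3
    exact norm_pos_iff.1 h3

open InnerProductSpace in
lemma harmonicAt_log_norm_gradient (h : IsFlow P a Ω b t low up U V) {z : ℂ} (hz : z ∈ Ω) :
    HarmonicAt (fun w => Real.log ‖gradient U w‖) z := by
  simp only [norm_gradient_eq]
  refine AnalyticAt.harmonicAt_log_norm (HarmonicAt.analyticAt_complex_partial (h.harmonic z hz)) ?_
  rw [← norm_ne_zero_iff, ← norm_gradient_eq, norm_ne_zero_iff]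
  exact h.gradient_ne_zero hz

lemma contDiff_log_speed (h : IsFlow P a Ω b t low up U V) :
    ContDiff ℝ 2 (fun w => Real.log (a w)) :=
  h.speed_smooth.log fun w => (h.speed_pos w).ne'

open InnerProductSpace in
/-- The strong maximum principle for `log a - log ‖∇ U‖`. -/
lemma eventually_eq_of_isLocalMax_log (h : IsFlow P a Ω b t low up U V) {p : ℂ} (hp : p ∈ Ω)
    (hm : IsLocalMax (fun w => Real.log (a w) - Real.log ‖gradient U w‖) p) :
    ∀ᶠ z in 𝓝 p, Real.log (a z) - Real.log ‖gradient U z‖ =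
      Real.log (a p) - Real.log ‖gradient U p‖ := by
  refine eventually_eq_of_isLocalMax ?_ ?_ hm
  · filter_upwards [h.strip.isOpen.mem_nhds hp] with z hz
    exact h.contDiff_log_speed.contDiffAt.sub (h.harmonicAt_log_norm_gradient hz).1
  · filter_upwards [h.strip.isOpen.mem_nhds hp] with z hz
    have h1 : ContDiffAt ℝ 2 (fun w => Real.log (a w)) z := h.contDiff_log_speed.contDiffAt
    have h2 := h.harmonicAt_log_norm_gradient hz
    have h3 := h1.laplacian_sub h2.1
    rw [h2.2.eq_of_nhds] at h3
    have h4 : Laplacian.laplacian (fun w => Real.log (a w) - Real.log ‖gradient U w‖) z =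
        Laplacian.laplacian (fun w => Real.log (a w)) z - 0 := h3
    rw [h4, sub_zero]
    exact h.laplacian_nonneg z hz

lemma continuousOn_log (h : IsFlow P a Ω b t low up U V) :
    ContinuousOn (fun w => Real.log (a w) - Real.log ‖V w‖) (closure Ω) := by
  refine h.contDiff_log_speed.continuous.continuousOn.sub ?_
  exact h.continuousOn_grad.norm.log fun z hz => norm_ne_zero_iff.2 (h.ne_zero hz)

lemma continuousOn_log_gradient (h : IsFlow P a Ω b t low up U V) :
    ContinuousOn (fun w => Real.log (a w) - Real.log ‖gradient U w‖) Ω :=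
  (h.continuousOn_log.mono subset_closure).congr fun z hz => by simp only [h.grad_eq z hz]

/-- The speed inside the stream is at least `a`: the superharmonic function `log ‖∇ U‖ - log a`
vanishes on the boundary. -/
lemma le_norm_gradient (h : IsFlow P a Ω b t low up U V) {z : ℂ} (hz : z ∈ Ω) :
    a z ≤ ‖gradient U z‖ := by
  obtain ⟨C, hC⟩ := h.exists_bound_closure
  have hper : ∀ w ∈ closure Ω, -(Real.log (a (w + (P : ℂ))) - Real.log ‖V (w + (P : ℂ))‖) =
      -(Real.log (a w) - Real.log ‖V w‖) := by
    intro w hw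
    have hbt : ∀ w ∈ b ∪ t, w + (P : ℂ) ∈ b ∪ t := fun w hw =>
      hw.imp (h.strip.add_mem_bot w).2 (h.strip.add_mem_top w).2
    rcases h.strip.mem_closure_cases hw with h1 | h1
    · have h2 := (h.strip.add_mem w).2 h1
      have h3 : gradient U (w + (P : ℂ)) = gradient U w := by
        have h4 : (fun y => U (y + (P : ℂ))) =ᶠ[𝓝 w] U := by
          filter_upwards [h.strip.isOpen.mem_nhds h1] with y hy using
            h.periodic y (subset_closure hy)
        have h5 : fderiv ℝ (fun y => U (y + (P : ℂ))) w = fderiv ℝ U (w + (P : ℂ)) :=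
          fderiv_comp_add_right _
        rw [gradient, ← h5, h4.fderiv_eq]; rfl
      rw [h.speed_periodic, h.grad_eq _ h2, h.grad_eq _ h1, h3]
    · rw [h.speed_periodic, h.norm_grad w h1, h.norm_grad _ (hbt w h1), h.speed_periodic]
  obtain ⟨p, hp, hmin⟩ := exists_min_of_periodic
    (f := fun w => -(Real.log (a w) - Real.log ‖V w‖)) h.period_pos isClosed_closure
    ⟨z, subset_closure hz⟩ h.strip.add_mem_closure hC h.continuousOn_log.neg hper
  have hbd : ∀ w ∈ b ∪ t, Real.log (a w) - Real.log ‖V w‖ = 0 := fun w hw => by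
    rw [h.norm_grad w hw, sub_self]
  have hp0 : Real.log (a p) - Real.log ‖V p‖ = 0 := by
    rcases h.strip.mem_closure_cases hp with h1 | h1
    · have h2 := eqOn_of_strong_max (M := Real.log (a p) - Real.log ‖V p‖) h.strip.isOpen
        h.strip.isPreconnected h.continuousOn_log_gradient
        (fun q hq => h.eventually_eq_of_isLocalMax_log hq) (fun w hw => by
          have := hmin w (subset_closure hw)
          rw [← h.grad_eq w hw]; linarith) h1 (by rw [h.grad_eq p h1])
      have h3 : EqOn (fun w => Real.log (a w) - Real.log ‖V w‖)
          (fun _ => Real.log (a p) - Real.log ‖V p‖) (closure Ω) := by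
        refine EqOn.of_subset_closure (s := Ω) (fun w hw => ?_) h.continuousOn_log
          continuousOn_const subset_closure subset_rfl
        rw [h.grad_eq w hw]; exact h2 w hw
      obtain ⟨q, hq⟩ := h.strip.bot_nonempty
      have h4 := h3 (h.strip.bot_subset hq)
      simp only [hbd q (Or.inl hq)] at h4
      exact h4.symm
    · exact hbd p h1
  have h1 := hmin z (subset_closure hz)
  rw [h.grad_eq z hz, hp0] at h1
  have h2 : Real.log (a z) ≤ Real.log ‖gradient U z‖ := by linarith
  exact (Real.log_le_log_iff (h.speed_pos z) (norm_pos_iff.2 (h.gradient_ne_zero hz))).1 h2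

/-- Equality of the speeds at one interior point propagates to the whole stream. -/
lemma norm_gradient_eq_of_eq (h : IsFlow P a Ω b t low up U V) {p : ℂ} (hp : p ∈ Ω)
    (hpa : ‖gradient U p‖ = a p) {z : ℂ} (hz : z ∈ Ω) : ‖gradient U z‖ = a z := by
  have h1 := eqOn_of_strong_max (M := 0) h.strip.isOpen
    h.strip.isPreconnected h.continuousOn_log_gradient
    (fun q hq => h.eventually_eq_of_isLocalMax_log hq) (fun w hw => by
      have := Real.log_le_log (h.speed_pos w) (h.le_norm_gradient hw)
      linarith) hp (by rw [hpa, sub_self]) z hz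
  exact (Real.log_injOn_pos (norm_pos_iff.2 (h.gradient_ne_zero hz)) (h.speed_pos z)
    (by linarith))

end IsFlow

/-! ### Boundary behaviour along a normal -/

/-- At a noncritical point, the small discs tangent to the level set from above lie in the
superlevel set, up to the point of tangency. -/
lemma exists_interior_disc {f : ℂ → ℝ} {p : ℂ} (hf : ContDiffAt ℝ 2 f p)
    (hg : gradient f p ≠ 0) :
    ∃ r₀ > 0, ∀ r : ℝ, 0 < r → r < r₀ →
      ∀ z ∈ Metric.closedBall (p + (r / ‖gradient f p‖) • gradient f p) r, z ≠ p → f p < f z := by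
  set g := gradient f p with hgdef
  have hgn : 0 < ‖g‖ := norm_pos_iff.2 hg
  obtain ⟨K, T, hT, hK⟩ := (hf.fderiv_right (m := 1) (by norm_num)).exists_lipschitzOnWith
  have hdiff : ∀ᶠ z in 𝓝 p, DifferentiableAt ℝ f z :=
    (hf.eventually (by simp)).mono fun z hz => hz.differentiableAt (by norm_num)
  obtain ⟨ε, hε, hball⟩ := Metric.eventually_nhds_iff_ball.1 (hdiff.and hT)
  refine ⟨min (ε / 2) (‖g‖ / (2 * (K + 1))), by positivity, fun r hr hr0 z hz hzp => ?_⟩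
  have hr1 : r < ε / 2 := hr0.trans_le (min_le_left _ _)
  have hr2 : r < ‖g‖ / (2 * (K + 1)) := hr0.trans_le (min_le_right _ _)
  have hK0 : (0 : ℝ) ≤ K := K.2
  rw [lt_div_iff₀ (by positivity)] at hr2
  set v := z - p with hv
  have hvn : 0 < ‖v‖ := norm_pos_iff.2 (sub_ne_zero.2 hzp)
  have h1 : ‖v - (r / ‖g‖) • g‖ ≤ r := by
    rw [Metric.mem_closedBall, dist_eq_norm] at hz
    rwa [hv, sub_sub]
  have h2 : ‖v‖ ^ 2 - 2 * (r / ‖g‖) * inner ℝ g v ≤ 0 := by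
    have h3 := pow_le_pow_left₀ (norm_nonneg _) h1 2
    rw [norm_sub_sq_real, inner_smul_right, norm_smul, Real.norm_of_nonneg (by positivity),
      div_mul_cancel₀ _ hgn.ne', real_inner_comm] at h3
    linarith
  have h3 : ‖v‖ ≤ 2 * r := by
    have h4 : ‖(r / ‖g‖) • g‖ = r := by
      rw [norm_smul, Real.norm_of_nonneg (by positivity), div_mul_cancel₀ _ hgn.ne']
    have := norm_sub_norm_le v ((r / ‖g‖) • g)
    linarith
  have hsub : Metric.closedBall p ‖v‖ ⊆ Metric.ball p ε :=
    Metric.closedBall_subset_ball (by linarith)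
  have h4 := Convex.norm_image_sub_le_of_norm_hasFDerivWithin_le' (f := f) (C := K * ‖v‖)
    (s := Metric.closedBall p ‖v‖) (x := p) (y := z) (f' := fderiv ℝ f) (φ := fderiv ℝ f p)
    (fun x hx => ((hball x (hsub hx)).1.hasFDerivAt).hasFDerivWithinAt)
    (fun x hx => by
      refine (hK.norm_sub_le (hball x (hsub hx)).2 (mem_of_mem_nhds hT)).trans ?_
      rw [Metric.mem_closedBall, dist_eq_norm] at hx
      gcongr)
    (convex_closedBall _ _) (Metric.mem_closedBall_self hvn.le)
    (by rw [Metric.mem_closedBall, dist_eq_norm])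
  rw [← hv, fderiv_apply_eq_inner, ← hgdef, Real.norm_eq_abs] at h4
  have h5 := (abs_le.1 h4).1
  have h6 : ‖g‖ * ‖v‖ ^ 2 ≤ 2 * r * inner ℝ g v := by
    have : ‖g‖ * (‖v‖ ^ 2 - 2 * (r / ‖g‖) * inner ℝ g v) ≤ 0 :=
      mul_nonpos_of_nonneg_of_nonpos hgn.le h2
    have h7 : ‖g‖ * (‖v‖ ^ 2 - 2 * (r / ‖g‖) * inner ℝ g v) =
        ‖g‖ * ‖v‖ ^ 2 - 2 * r * inner ℝ g v := by field_simp
    linarith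
  have h8 : 2 * r * (K * ‖v‖ ^ 2) < ‖g‖ * ‖v‖ ^ 2 := by
    rw [← mul_assoc]
    refine mul_lt_mul_of_pos_right ?_ (by positivity)
    nlinarith
  have h9 : K * ‖v‖ ^ 2 < inner ℝ g v := by
    have := h8.trans_le h6
    exact lt_of_mul_lt_mul_left this (by positivity)
  nlinarith

/-- One-sided derivative of the stream function along a segment that enters the stream. -/
lemma IsFlow.hasDerivWithinAt_ray {P : ℝ} {a : ℂ → ℝ} {Ω b t low up : Set ℂ} {U : ℂ → ℝ}
    {V : ℂ → ℂ} (h : IsFlow P a Ω b t low up U V) {p e : ℂ} {r : ℝ} (hr : 0 < r)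
    (hp : p ∈ closure Ω) (hseg : ∀ s ∈ Ioo 0 r, p + s • e ∈ Ω) :
    HasDerivWithinAt (fun s : ℝ => U (p + s • e)) (inner ℝ (V p) e) (Ici 0) 0 := by
  have hcont : Continuous fun s : ℝ => p + s • e := by fun_prop
  have hzero : p + (0 : ℝ) • e = p := by simp
  have hmaps : MapsTo (fun s : ℝ => p + s • e) (Ioo 0 r) (closure Ω) := fun s hs =>
    subset_closure (hseg s hs)
  have hder : ∀ s ∈ Ioo 0 r, HasDerivAt (fun s : ℝ => U (p + s • e))
      (inner ℝ (V (p + s • e)) e) s := fun s hs => by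
    have h1 := hasDerivAt_along_line (p := p) (e := e) (t := s)
      ((h.harmonic _ (hseg s hs)).1.differentiableAt (by norm_num))
    rwa [fderiv_apply_eq_inner, ← h.grad_eq _ (hseg s hs)] at h1
  refine hasDerivWithinAt_Ici_of_tendsto_deriv (s := Ioo 0 r)
    (fun s hs => (hder s hs).differentiableAt.differentiableWithinAt) ?_ (Ioo_mem_nhdsGT hr) ?_
  · refine ContinuousWithinAt.comp (t := closure Ω) (g := U) ?_ hcont.continuousWithinAt hmaps
    rw [hzero]; exact h.continuousOn p hp
  · have h1 : ContinuousWithinAt (fun s : ℝ => inner ℝ (V (p + s • e)) e) (Ioo 0 r) 0 := by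
      refine ContinuousWithinAt.inner (𝕜 := ℝ) ?_ continuousWithinAt_const
      refine ContinuousWithinAt.comp (t := closure Ω) (g := V) ?_ hcont.continuousWithinAt hmaps
      rw [hzero]; exact h.continuousOn_grad p hp
    have h2 := h1.tendsto
    rw [hzero, nhdsWithin_Ioo_eq_nhdsGT hr] at h2
    refine h2.congr' ?_
    filter_upwards [Ioo_mem_nhdsGT hr] with s hs using (hder s hs).deriv.symm

/-- A periodic open part of the stream with no boundary points inside the stream or on the bottom is
empty, since the stream function would have an interior minimum on it. -/
lemma IsFlow.eq_empty_of_closure_subset_top {P : ℝ} {a : ℂ → ℝ} {Ω b t low up : Set ℂ} {U : ℂ → ℝ}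
    {V : ℂ → ℂ} (h : IsFlow P a Ω b t low up U V) {A : Set ℂ} (hA : IsOpen A) (hAΩ : A ⊆ Ω)
    (hadd : ∀ z, z + (P : ℂ) ∈ A ↔ z ∈ A) (hcl : closure A ⊆ A ∪ t) : A = ∅ := by
  by_contra hne
  obtain ⟨x, hx⟩ := nonempty_iff_ne_empty.2 hne
  obtain ⟨B, hB⟩ := h.exists_bound_closure
  have hsub : closure A ⊆ closure Ω := closure_mono hAΩ
  obtain ⟨p, hp, hmin⟩ := exists_min_of_periodic h.period_pos isClosed_closure
    ⟨x, subset_closure hx⟩ (add_mem_closure_iff hadd) (fun z hz => hB z (hsub hz))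
    (h.continuousOn.mono hsub) (fun z hz => h.periodic z (hsub hz))
  rcases hcl hp with h1 | h1
  · refine h.not_isLocalMin (hAΩ h1) ?_
    filter_upwards [hA.mem_nhds h1] with y hy using hmin y (subset_closure hy)
  · have h2 := hmin x (subset_closure hx)
    rw [h.eq_one p h1] at h2
    exact absurd (h.lt_one (hAΩ hx)) (not_lt.2 h2)

/-! ### Two streams with a common dividing arc -/

/-- Two flows with the same speed, separated by a common connected set `(L ∪ H)ᶜ` lying in both:
the bottoms are in `L` and the tops in `H`. -/
structure IsFlowPair (P : ℝ) (a : ℂ → ℝ) (Ω b t low up : Set ℂ) (U : ℂ → ℝ) (V : ℂ → ℂ)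
    (Ω' b' t' low' up' : Set ℂ) (U' : ℂ → ℝ) (V' : ℂ → ℂ) (L H : Set ℂ) : Prop where
  left : IsFlow P a Ω b t low up U V
  right : IsFlow P a Ω' b' t' low' up' U' V'
  isOpen_lower : IsOpen L
  isOpen_upper : IsOpen H
  disjoint : Disjoint L H
  isPreconnected : IsPreconnected (L ∪ H)ᶜ
  nonempty : (L ∪ H)ᶜ.Nonempty
  subset_left : (L ∪ H)ᶜ ⊆ Ω
  subset_right : (L ∪ H)ᶜ ⊆ Ω'
  add_mem_lower : ∀ z, z + (P : ℂ) ∈ L ↔ z ∈ L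
  add_mem_upper : ∀ z, z + (P : ℂ) ∈ H ↔ z ∈ H
  bot_left : low ∪ b ⊆ L
  bot_right : low' ∪ b' ⊆ L
  top_left : up ∪ t ⊆ H
  top_right : up' ∪ t' ⊆ H

namespace IsFlowPair

variable {P : ℝ} {a : ℂ → ℝ} {Ω b t low up : Set ℂ} {U : ℂ → ℝ} {V : ℂ → ℂ}
  {Ω' b' t' low' up' : Set ℂ} {U' : ℂ → ℝ} {V' : ℂ → ℂ} {L H : Set ℂ}

lemma swap (h : IsFlowPair P a Ω b t low up U V Ω' b' t' low' up' U' V' L H) :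
    IsFlowPair P a Ω' b' t' low' up' U' V' Ω b t low up U V L H where
  left := h.right
  right := h.left
  isOpen_lower := h.isOpen_lower
  isOpen_upper := h.isOpen_upper
  disjoint := h.disjoint
  isPreconnected := h.isPreconnected
  nonempty := h.nonempty
  subset_left := h.subset_right
  subset_right := h.subset_left
  add_mem_lower := h.add_mem_lower
  add_mem_upper := h.add_mem_upper
  bot_left := h.bot_right
  bot_right := h.bot_left
  top_left := h.top_right
  top_right := h.top_left

/-- Turning the plane upside down and exchanging the two flows preserves `U - U'`. -/
lemma rotate (h : IsFlowPair P a Ω b t low up U V Ω' b' t' low' up' U' V' L H) :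
    IsFlowPair P a Ω' t' b' up' low' (fun z => 1 - U' z) (fun z => -V' z)
      Ω t b up low (fun z => 1 - U z) (fun z => -V z) H L where
  left := h.right.flip
  right := h.left.flip
  isOpen_lower := h.isOpen_upper
  isOpen_upper := h.isOpen_lower
  disjoint := h.disjoint.symm
  isPreconnected := by rw [union_comm]; exact h.isPreconnected
  nonempty := by rw [union_comm]; exact h.nonempty
  subset_left := by rw [union_comm]; exact h.subset_right
  subset_right := by rw [union_comm]; exact h.subset_left
  add_mem_lower := h.add_mem_upper
  add_mem_upper := h.add_mem_lower
  bot_left := h.top_right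
  bot_right := h.top_left
  top_left := h.bot_right
  top_right := h.bot_left

lemma isOpen_inter (h : IsFlowPair P a Ω b t low up U V Ω' b' t' low' up' U' V' L H) :
    IsOpen (Ω ∩ Ω') :=
  h.left.strip.isOpen.inter h.right.strip.isOpen

lemma add_mem_inter (h : IsFlowPair P a Ω b t low up U V Ω' b' t' low' up' U' V' L H) (z : ℂ) :
    z + (P : ℂ) ∈ Ω ∩ Ω' ↔ z ∈ Ω ∩ Ω' :=
  and_congr (h.left.strip.add_mem z) (h.right.strip.add_mem z)

lemma closure_subset_left : closure (Ω ∩ Ω') ⊆ closure Ω := closure_mono inter_subset_left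

lemma closure_subset_right : closure (Ω ∩ Ω') ⊆ closure Ω' := closure_mono inter_subset_right

lemma continuousOn (h : IsFlowPair P a Ω b t low up U V Ω' b' t' low' up' U' V' L H) :
    ContinuousOn (fun z => U z - U' z) (closure (Ω ∩ Ω')) :=
  (h.left.continuousOn.mono closure_subset_left).sub
    (h.right.continuousOn.mono closure_subset_right)

lemma periodic (h : IsFlowPair P a Ω b t low up U V Ω' b' t' low' up' U' V' L H) {z : ℂ}
    (hz : z ∈ closure (Ω ∩ Ω')) : U (z + (P : ℂ)) - U' (z + (P : ℂ)) = U z - U' z := by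
  rw [h.left.periodic z (closure_subset_left hz), h.right.periodic z (closure_subset_right hz)]

lemma harmonicOnNhd (h : IsFlowPair P a Ω b t low up U V Ω' b' t' low' up' U' V' L H) :
    InnerProductSpace.HarmonicOnNhd (fun z => U z - U' z) (Ω ∩ Ω') := fun z hz =>
  (h.left.harmonic z hz.1).sub (h.right.harmonic z hz.2)

lemma analyticOnNhd (h : IsFlowPair P a Ω b t low up U V Ω' b' t' low' up' U' V' L H) :
    AnalyticOnNhd ℝ (fun z => U z - U' z) (Ω ∩ Ω') := fun z hz =>
  HarmonicAt.analyticAt (h.harmonicOnNhd z hz)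

lemma bot_mem_closure (h : IsFlowPair P a Ω b t low up U V Ω' b' t' low' up' U' V' L H) {z : ℂ}
    (hz : z ∈ b) (hz' : z ∈ Ω') : z ∈ closure (Ω ∩ Ω') := by
  rw [mem_closure_iff]
  intro O hO hzO
  obtain ⟨w, ⟨hw1, hw2⟩, hw3⟩ := mem_closure_iff.1 (h.left.strip.bot_subset hz) (O ∩ Ω')
    (hO.inter h.right.strip.isOpen) ⟨hzO, hz'⟩
  exact ⟨w, hw1, hw3, hw2⟩

/-- A negative value of `U - U'` is attained on the boundary of the common stream only where the
bottom of the first stream or the top of the second one is inside the other stream. -/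
lemma mem_cases_of_neg (h : IsFlowPair P a Ω b t low up U V Ω' b' t' low' up' U' V' L H) {z : ℂ}
    (hz : z ∈ closure (Ω ∩ Ω')) (hneg : U z - U' z < 0) :
    z ∈ Ω ∩ Ω' ∨ z ∈ b ∩ Ω' ∨ z ∈ t' ∩ Ω := by
  have hLH : ∀ {y}, y ∈ b → y ∉ t' := fun hy hy' =>
    h.disjoint.le_bot ⟨h.bot_left (Or.inr hy), h.top_right (Or.inr hy')⟩
  have h0 := h.left.nonneg (closure_subset_left hz)
  have h1 := h.right.le_one (closure_subset_right hz)
  rcases h.left.strip.mem_closure_cases (closure_subset_left hz) with h2 | h2 | h2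
  · rcases h.right.strip.mem_closure_cases (closure_subset_right hz) with h3 | h3 | h3
    · exact Or.inl ⟨h2, h3⟩
    · rw [h.right.eq_zero z h3] at hneg
      linarith
    · exact Or.inr (Or.inr ⟨h3, h2⟩)
  · rcases h.right.strip.mem_closure_cases (closure_subset_right hz) with h3 | h3 | h3
    · exact Or.inr (Or.inl ⟨h2, h3⟩)
    · rw [h.right.eq_zero z h3] at hneg
      linarith
    · exact absurd h3 (hLH h2)
  · rw [h.left.eq_one z h2] at hneg
    linarith

lemma exists_min (h : IsFlowPair P a Ω b t low up U V Ω' b' t' low' up' U' V' L H) :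
    ∃ p ∈ closure (Ω ∩ Ω'), ∀ z ∈ closure (Ω ∩ Ω'), U p - U' p ≤ U z - U' z := by
  obtain ⟨C, hC⟩ := h.left.exists_bound_closure
  obtain ⟨q, hq⟩ := h.nonempty
  exact exists_min_of_periodic (S := closure (Ω ∩ Ω')) (f := fun z => U z - U' z)
    h.left.period_pos isClosed_closure
    ⟨q, subset_closure ⟨h.subset_left hq, h.subset_right hq⟩⟩ (add_mem_closure_iff h.add_mem_inter)
    (fun z hz => hC z (closure_subset_left hz)) h.continuousOn fun z hz => h.periodic hz

lemma exists_min_mem_boundary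
    (h : IsFlowPair P a Ω b t low up U V Ω' b' t' low' up' U' V' L H) {m : ℝ} (hm : m < 0)
    (hle : ∀ z ∈ closure (Ω ∩ Ω'), m ≤ U z - U' z)
    (hp : ∃ p ∈ closure (Ω ∩ Ω'), U p - U' p = m) :
    ∃ p, (p ∈ b ∩ Ω' ∨ p ∈ t' ∩ Ω) ∧ U p - U' p = m := by
  by_contra! hcon
  set A := {z | z ∈ closure (Ω ∩ Ω') ∧ U z - U' z = m} with hA
  have hAD : ∀ z ∈ A, z ∈ Ω ∩ Ω' := fun z hz =>
    (h.mem_cases_of_neg hz.1 (by rw [hz.2]; exact hm)).resolve_right fun h1 => hcon z h1 hz.2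
  have hcl : IsClosed A := h.continuousOn.preimage_isClosed_of_isClosed isClosed_closure
    (isClosed_singleton (x := m))
  have hop : IsOpen A := by
    rw [isOpen_iff_mem_nhds]
    intro z hz
    have hzD := hAD z hz
    have h1 : ∀ᶠ w in 𝓝 z, w ∈ Ω ∩ Ω' := h.isOpen_inter.mem_nhds hzD
    have h2 : IsLocalMax (fun w => U' w - U w) z := by
      filter_upwards [h1] with w hw
      have h3 := hle w (subset_closure hw)
      have h4 := hz.2
      linarith
    filter_upwards [h1, eventually_eq_of_isLocalMax_of_harmonicAt
      (h.swap.harmonicOnNhd z hzD.symm) h2] with w hw hw'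
    have h4 := hz.2
    exact ⟨subset_closure hw, by linarith⟩
  obtain ⟨p, hp, hpm⟩ := hp
  have huniv : A = univ := (IsClopen.eq_univ ⟨hcl, hop⟩ ⟨p, hp, hpm⟩)
  obtain ⟨q, hq⟩ := h.left.strip.bot_nonempty
  have hqA : q ∈ A := huniv ▸ mem_univ q
  exact h.left.strip.notMem_bot (hAD q hqA).1 hq

/-- The part of the second stream above the level that `U'` has at a minimum of `U - U'` on the
bottom of the first stream does not cross that bottom. -/
lemma superlevel_subset_compl
    (h : IsFlowPair P a Ω b t low up U V Ω' b' t' low' up' U' V' L H) {m : ℝ} (hm : m < 0)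
    (hle : ∀ z ∈ closure (Ω ∩ Ω'), m ≤ U z - U' z) {p : ℂ} (hp : p ∈ b) (hp' : p ∈ Ω')
    (hpm : U p - U' p = m) : {z | z ∈ Ω' ∧ -m < U' z} ⊆ (low ∪ b)ᶜ := by
  have hs : U' p = -m := by rw [h.left.eq_zero p hp] at hpm; linarith
  have hs1 : -m < 1 := hs ▸ h.right.lt_one hp'
  have hSb : ∀ z ∈ {z | z ∈ Ω' ∧ -m < U' z}, z ∉ b := fun z hz hzb => by
    have h1 := hle z (h.bot_mem_closure hzb hz.1)
    rw [h.left.eq_zero z hzb] at h1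
    linarith [hz.2]
  refine (h.right.isPreconnected_superlevel (by linarith) hs1).subset_left_of_subset_union
    h.left.strip.isClosed_low.isOpen_compl h.left.strip.isOpen_low
    (disjoint_compl_left.mono_right subset_union_left) (fun z hz => ?_) ?_
  · by_cases hzl : z ∈ low
    · exact Or.inr hzl
    · exact Or.inl fun h1 => h1.elim hzl (hSb z hz)
  · obtain ⟨τ, hτ⟩ := h.right.strip.top_nonempty
    obtain ⟨w, hwH, hwS⟩ := mem_closure_iff.1 (h.right.top_subset_closure_superlevel hs1 hτ) H
      h.isOpen_upper (h.top_right (Or.inr hτ))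
    exact ⟨w, hwS, fun hw => h.disjoint.le_bot ⟨h.bot_left hw, hwH⟩⟩

/-- The Hopf boundary point argument: where the bottom of the first stream touches the level line
of the second one, `U - U'` has a nonpositive normal derivative, as `a` bounds `‖∇ U'‖` below.
Hence it is locally constant and all speeds agree with `a`. -/
lemma eventually_eq_and_norm_eq_of_mem_bot
    (h : IsFlowPair P a Ω b t low up U V Ω' b' t' low' up' U' V' L H) {m : ℝ} (hm : m < 0)
    (hle : ∀ z ∈ closure (Ω ∩ Ω'), m ≤ U z - U' z) {p : ℂ} (hp : p ∈ b) (hp' : p ∈ Ω')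
    (hpm : U p - U' p = m) :
    (∃ q ∈ Ω ∩ Ω', ∀ᶠ z in 𝓝 q, U z - U' z = m) ∧ (∀ z ∈ Ω, ‖gradient U z‖ = a z) ∧
      ∀ z ∈ Ω', ‖gradient U' z‖ = a z := by
  have hs : U' p = -m := by rw [h.left.eq_zero p hp] at hpm; linarith
  have hsuper := h.superlevel_subset_compl hm hle hp hp' hpm
  have hpD : p ∈ closure (Ω ∩ Ω') := h.bot_mem_closure hp hp'
  set g := gradient U' p with hg
  have hg0 : g ≠ 0 := h.right.gradient_ne_zero hp'
  have hgn : 0 < ‖g‖ := norm_pos_iff.2 hg0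
  obtain ⟨r₀, hr₀, hdisc⟩ := exists_interior_disc (h.right.harmonic p hp').1 hg0
  have hnear : (up ∪ t)ᶜ ∩ Ω' ∈ 𝓝 p :=
    (h.left.strip.isClosed_up.isOpen_compl.inter h.right.strip.isOpen).mem_nhds
      ⟨fun h1 => h.left.strip.disjoint.le_bot ⟨Or.inr hp, h1⟩, hp'⟩
  obtain ⟨ε, hε, hball⟩ := Metric.mem_nhds_iff.1 hnear
  -- the radius of a disc in the common stream, touching the boundary at `p`
  obtain ⟨r, hr, hrlt⟩ : ∃ r, 0 < r ∧ r < min r₀ (ε / 2) := exists_between (by positivity)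
  have hr1 := hrlt.trans_le (min_le_left _ _)
  have hr2 := hrlt.trans_le (min_le_right _ _)
  set n := (‖g‖⁻¹ : ℝ) • g with hn
  have hnn : ‖n‖ = 1 := by
    rw [hn, norm_smul, Real.norm_of_nonneg (by positivity), inv_mul_cancel₀ hgn.ne']
  set c := p + r • n with hc
  have hc' : c = p + (r / ‖g‖) • g := by rw [hc, hn, smul_smul, div_eq_mul_inv]
  have hpc : dist p c = r := by
    rw [hc, dist_eq_norm, sub_add_cancel_left, norm_neg, norm_smul, hnn, mul_one,
      Real.norm_of_nonneg hr.le]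
  have hcD : ∀ z ∈ Metric.closedBall c r, z ≠ p → z ∈ Ω ∩ Ω' := by
    intro z hz hzp
    have h1 : z ∈ Metric.ball p ε := by
      rw [Metric.mem_ball]
      rw [Metric.mem_closedBall] at hz
      have := dist_triangle z c p
      rw [dist_comm] at hpc
      linarith
    have h2 := hball h1
    have h3 : -m < U' z := hs ▸ hdisc r hr hr1 z (hc' ▸ hz) hzp
    refine ⟨?_, h2.2⟩
    rw [h.left.strip.eq_compl]
    exact fun h4 => h4.elim (hsuper ⟨h2.2, h3⟩) h2.1
  have hbD : Metric.ball c r ⊆ Ω ∩ Ω' := fun z hz => hcD z (Metric.ball_subset_closedBall hz)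
    (fun hzp => by rw [hzp, Metric.mem_ball, hpc] at hz; exact lt_irrefl _ hz)
  have hcc : Metric.closedBall c r ⊆ closure (Ω ∩ Ω') := fun z hz => by
    by_cases hzp : z = p
    · rw [hzp]; exact hpD
    · exact subset_closure (hcD z hz hzp)
  have hray : ∀ s ∈ Ioo 0 r, dist (p + s • n) c = r - s := by
    intro s hs
    rw [dist_eq_norm, hc, add_sub_add_left_eq_sub, ← sub_smul, norm_smul, hnn, mul_one,
      Real.norm_eq_abs, abs_of_neg (by linarith [hs.2])]
    ring
  have hrayD : ∀ s ∈ Ioo 0 r, p + s • n ∈ Ω ∩ Ω' := fun s hs =>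
    hbD (by rw [Metric.mem_ball, hray s hs]; linarith [hs.1])
  have hVa : ‖V p‖ = a p := h.left.norm_grad p (Or.inl hp)
  obtain ⟨q, hq, hqm⟩ : ∃ q ∈ Metric.ball c r, U q - U' q = m := by
    by_contra! hne
    -- otherwise the boundary point lemma gives `U - U'` a positive normal derivative at `p`
    have hcont : ContinuousOn (fun z => U' z - U z) (Metric.closedBall c r) := by
      refine ((h.continuousOn.mono hcc).neg).congr fun z _ => ?_
      simp
    obtain ⟨κ, hκ, hhopf⟩ := hopf_boundary_point (v := fun z => U' z - U z) (M := -m) hr hcont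
      (fun z hz => (h.swap.harmonicOnNhd z (hbD hz).symm).1)
      (fun z hz => ((h.swap.harmonicOnNhd z (hbD hz).symm).2.eq_of_nhds).ge)
      (fun z hz => by linarith [hle z (hcc hz)])
      (fun z hz => by
        have h1 := hle z (subset_closure (hbD hz))
        have h2 := h1.lt_of_ne (hne z hz).symm
        linarith)
    have hd1 := h.left.hasDerivWithinAt_ray hr (closure_subset_left hpD) fun s hs => (hrayD s hs).1
    have hd2 := h.right.hasDerivWithinAt_ray hr (closure_subset_right hpD)
      fun s hs => (hrayD s hs).2
    have hd := (hd2.fun_sub hd1).mono Ioi_subset_Ici_self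
    have h1 := le_neg_of_le_linear_of_hasDerivWithinAt (κ := κ) (half_pos hr) (fun s hs => by
      have hs' : s ∈ Ioo 0 r := ⟨hs.1, by linarith [hs.2]⟩
      have h2 := hhopf (p + s • n) (by rw [Metric.mem_closedBall, hray s hs']; linarith [hs.1])
        (by rw [hray s hs']; linarith [hs.2])
      rw [hray s hs'] at h2
      simp only [zero_smul, add_zero]
      linarith) hd
    have h2 : inner ℝ (V' p) n = ‖g‖ := by
      rw [h.right.grad_eq p hp', ← hg, hn, inner_smul_right, real_inner_self_eq_norm_sq]
      field_simp
    have h3 : inner ℝ (V p) n ≤ a p := by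
      have := real_inner_le_norm (V p) n
      rwa [hVa, hnn, mul_one] at this
    have h4 := h.right.le_norm_gradient hp'
    rw [← hg] at h4
    linarith
  have hconst : ∀ z ∈ Metric.ball c r, U z - U' z = m := by
    have h1 := eqOn_of_strong_max (v := fun z => U' z - U z) (M := -m) Metric.isOpen_ball
      (convex_ball c r).isPreconnected
      ((h.swap.continuousOn.mono subset_closure).mono fun z hz => (hbD hz).symm)
      (fun z hz => eventually_eq_of_isLocalMax_of_harmonicAt (h.swap.harmonicOnNhd z (hbD hz).symm))
      (fun z hz => by linarith [hle z (subset_closure (hbD hz))]) hq (by linarith)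
    intro z hz
    linarith [h1 z hz]
  have hev : ∀ z ∈ Metric.ball c r, ∀ᶠ y in 𝓝 z, U y - U' y = m := fun z hz => by
    filter_upwards [Metric.isOpen_ball.mem_nhds hz] with y hy using hconst y hy
  have hVV : ∀ z ∈ Metric.ball c r, V z = V' z := fun z hz => by
    rw [h.left.grad_eq z (hbD hz).1, h.right.grad_eq z (hbD hz).2]
    have h1 : U =ᶠ[𝓝 z] fun y => m + U' y := by
      filter_upwards [hev z hz] with y hy
      linarith
    rw [h1.gradient_eq, gradient, gradient, fderiv_const_add]
  have hpV : V p = V' p := by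
    have hcl : p ∈ closure (Metric.ball c r) := by
      rw [closure_ball c hr.ne', Metric.mem_closedBall, hpc]
    have hsub : closure (Metric.ball c r) ⊆ closure (Ω ∩ Ω') := closure_mono hbD
    have h1 : EqOn V V' (closure (Metric.ball c r)) := EqOn.of_subset_closure hVV
      (h.left.continuousOn_grad.mono (hsub.trans closure_subset_left))
      (h.right.continuousOn_grad.mono (hsub.trans closure_subset_right)) subset_closure subset_rfl
    exact h1 hcl
  have hright : ∀ z ∈ Ω', ‖gradient U' z‖ = a z := fun z hz =>
    h.right.norm_gradient_eq_of_eq hp' (by rw [← h.right.grad_eq p hp', ← hpV, hVa]) hz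
  refine ⟨⟨q, hbD hq, hev q hq⟩, fun z hz => h.left.norm_gradient_eq_of_eq (hbD hq).1 ?_ hz, hright⟩
  rw [← h.left.grad_eq q (hbD hq).1, hVV q hq, h.right.grad_eq q (hbD hq).2, hright q (hbD hq).2]

lemma eventually_eq_and_norm_eq
    (h : IsFlowPair P a Ω b t low up U V Ω' b' t' low' up' U' V' L H) {m : ℝ} (hm : m < 0)
    (hle : ∀ z ∈ closure (Ω ∩ Ω'), m ≤ U z - U' z)
    (hp : ∃ p ∈ closure (Ω ∩ Ω'), U p - U' p = m) :
    (∃ q ∈ Ω ∩ Ω', ∀ᶠ z in 𝓝 q, U z - U' z = m) ∧ (∀ z ∈ Ω, ‖gradient U z‖ = a z) ∧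
      ∀ z ∈ Ω', ‖gradient U' z‖ = a z := by
  obtain ⟨p, hp | hp, hpm⟩ := h.exists_min_mem_boundary hm hle hp
  · exact h.eventually_eq_and_norm_eq_of_mem_bot hm hle hp.1 hp.2 hpm
  · obtain ⟨⟨q, hq, hev⟩, h1, h2⟩ := h.rotate.eventually_eq_and_norm_eq_of_mem_bot hm
      (fun z hz => by rw [inter_comm] at hz; linarith [hle z hz]) hp.1 hp.2 (by linarith)
    refine ⟨⟨q, hq.symm, hev.mono fun z hz => by linarith⟩, fun z hz => ?_, fun z hz => ?_⟩
    · rw [← h2 z hz, gradient_const_sub, norm_neg]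
    · rw [← h1 z hz, gradient_const_sub, norm_neg]

end IsFlowPair

/-! ### Propagation of coincidence up to a constant -/

/-- `A` is a nonempty periodic union of components of the common stream `Ω ∩ Ω'`, on which
`U - U'` is the negative constant `m`. -/
structure IsCoincidenceSet (P : ℝ) (Ω Ω' : Set ℂ) (U U' : ℂ → ℝ) (m : ℝ) (A : Set ℂ) : Prop where
  isOpen : IsOpen A
  nonempty : A.Nonempty
  subset : A ⊆ Ω ∩ Ω'
  closure_inter : closure A ∩ (Ω ∩ Ω') ⊆ A
  add_mem : ∀ z, z + (P : ℂ) ∈ A ↔ z ∈ A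
  eq_const : ∀ z ∈ closure A, U z - U' z = m
  neg : m < 0

lemma IsCoincidenceSet.rotate {P : ℝ} {Ω Ω' : Set ℂ} {U U' : ℂ → ℝ} {m : ℝ} {A : Set ℂ}
    (hA : IsCoincidenceSet P Ω Ω' U U' m A) :
    IsCoincidenceSet P Ω' Ω (fun z => 1 - U' z) (fun z => 1 - U z) m A where
  isOpen := hA.isOpen
  nonempty := hA.nonempty
  subset := inter_comm Ω Ω' ▸ hA.subset
  closure_inter := inter_comm Ω Ω' ▸ hA.closure_inter
  add_mem := hA.add_mem
  eq_const := fun z hz => by linarith [hA.eq_const z hz]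
  neg := hA.neg

namespace IsFlowPair

variable {P : ℝ} {a : ℂ → ℝ} {Ω b t low up : Set ℂ} {U : ℂ → ℝ} {V : ℂ → ℂ}
  {Ω' b' t' low' up' : Set ℂ} {U' : ℂ → ℝ} {V' : ℂ → ℂ} {L H : Set ℂ} {m : ℝ} {A : Set ℂ}

lemma isCoincidenceSet (h : IsFlowPair P a Ω b t low up U V Ω' b' t' low' up' U' V' L H)
    (hm : m < 0) (hne : ∃ q ∈ Ω ∩ Ω', ∀ᶠ z in 𝓝 q, U z - U' z = m) :
    IsCoincidenceSet P Ω Ω' U U' m {q | q ∈ Ω ∩ Ω' ∧ ∀ᶠ z in 𝓝 q, U z - U' z = m} where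
  isOpen := h.isOpen_inter.inter isOpen_setOfPred_eventually_nhds
  nonempty := hne
  subset := fun z hz => hz.1
  closure_inter := by
    rintro z ⟨hz, hzD⟩
    refine ⟨hzD, ?_⟩
    obtain ⟨r, hr, hball⟩ := Metric.isOpen_iff.1 h.isOpen_inter z hzD
    obtain ⟨w, hw, -, hwm⟩ := mem_closure_iff.1 hz _ Metric.isOpen_ball (Metric.mem_ball_self hr)
    have h1 := (h.analyticOnNhd.mono hball).eqOn_of_preconnected_of_eventuallyEq
      (g := fun _ => m) (fun _ _ => analyticAt_const) (convex_ball z r).isPreconnected hw hwm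
    filter_upwards [Metric.ball_mem_nhds z hr] with y hy using h1 hy
  add_mem := fun z => by
    simp only [mem_ofPred_eq, h.add_mem_inter]
    refine and_congr_right fun hz => ?_
    have h1 : 𝓝 (z + (P : ℂ)) = map (fun y => y + (P : ℂ)) (𝓝 z) :=
      ((Homeomorph.addRight (P : ℂ)).map_nhds_eq z).symm
    rw [h1, eventually_map]
    refine eventually_congr ?_
    filter_upwards [h.isOpen_inter.mem_nhds hz] with y hy
    rw [h.periodic (subset_closure hy)]
  eq_const := by
    intro z hz
    have h1 : closure {q | q ∈ Ω ∩ Ω' ∧ ∀ᶠ z in 𝓝 q, U z - U' z = m} ⊆ closure (Ω ∩ Ω') :=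
      closure_mono fun z hz => hz.1
    exact EqOn.of_subset_closure (g := fun _ => m) (fun y hy => hy.2.self_of_nhds)
      (h.continuousOn.mono h1) continuousOn_const subset_closure subset_rfl hz
  neg := hm

lemma mem_closure_cases (h : IsFlowPair P a Ω b t low up U V Ω' b' t' low' up' U' V' L H)
    (hA : IsCoincidenceSet P Ω Ω' U U' m A) {z : ℂ} (hz : z ∈ closure A) :
    z ∈ A ∨ z ∈ b ∩ Ω' ∨ z ∈ t' ∩ Ω :=
  (h.mem_cases_of_neg (closure_mono hA.subset hz) (by rw [hA.eq_const z hz]; exact hA.neg)).imp_left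
    fun h1 => hA.closure_inter ⟨hz, h1⟩

/-- A coincidence set that avoids the dividing arc has no points above it: above, its boundary
would consist of points of the top of the second stream only. -/
lemma inter_upper_eq_empty (h : IsFlowPair P a Ω b t low up U V Ω' b' t' low' up' U' V' L H)
    (hA : IsCoincidenceSet P Ω Ω' U U' m A) (hd : Disjoint (L ∪ H)ᶜ A) : A ∩ H = ∅ := by
  refine h.right.eq_empty_of_closure_subset_top (hA.isOpen.inter h.isOpen_upper)
    (fun z hz => (hA.subset hz.1).2)
    (fun z => and_congr (hA.add_mem z) (h.add_mem_upper z)) fun z hz => ?_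
  have hzL : z ∉ L := fun hzL => by
    obtain ⟨w, hw, hwA⟩ := mem_closure_iff.1 hz L h.isOpen_lower hzL
    exact h.disjoint.le_bot ⟨hw, hwA.2⟩
  rcases h.mem_closure_cases hA (closure_mono inter_subset_left hz) with h1 | h1 | h1
  · refine Or.inl ⟨h1, ?_⟩
    by_contra hzH
    exact hd.le_bot ⟨fun h2 => h2.elim hzL hzH, h1⟩
  · exact absurd (h.bot_left (Or.inr h1.1)) hzL
  · exact Or.inr h1.1

lemma dividing_subset (h : IsFlowPair P a Ω b t low up U V Ω' b' t' low' up' U' V' L H)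
    (hA : IsCoincidenceSet P Ω Ω' U U' m A) : (L ∪ H)ᶜ ⊆ A := by
  by_cases hne : ((L ∪ H)ᶜ ∩ A).Nonempty
  · exact h.isPreconnected.subset_of_closure_inter_subset hA.isOpen hne
      fun z hz => hA.closure_inter ⟨hz.1, h.subset_left hz.2, h.subset_right hz.2⟩
  · have hd : Disjoint (L ∪ H)ᶜ A := disjoint_iff_inter_eq_empty.2 (not_nonempty_iff_eq_empty.1 hne)
    have h1 := h.inter_upper_eq_empty hA hd
    have h2 := h.rotate.inter_upper_eq_empty hA.rotate (by rwa [union_comm])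
    obtain ⟨z, hz⟩ := hA.nonempty
    refine (hd.le_bot ⟨fun hz' => ?_, hz⟩).elim
    rcases hz' with hz' | hz'
    · exact notMem_empty z (h2 ▸ ⟨hz, hz'⟩)
    · exact notMem_empty z (h1 ▸ ⟨hz, hz'⟩)

/-- A coincidence set fills the common stream along the top of the second stream. -/
lemma disjoint_closure_sdiff_top (h : IsFlowPair P a Ω b t low up U V Ω' b' t' low' up' U' V' L H)
    (hA : IsCoincidenceSet P Ω Ω' U U' m A) : Disjoint (closure ((Ω ∩ Ω') \ A)) t' := by
  have key : ∀ p ∈ t', p ∈ closure A → ∃ N, IsOpen N ∧ p ∈ N ∧ N ∩ Ω' ⊆ A := by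
    intro p hp hpA
    have hpΩ : p ∈ Ω := by
      rcases h.mem_closure_cases hA hpA with h1 | h1 | h1
      · exact (hA.subset h1).1
      · exact absurd hp (h.right.strip.notMem_top h1.2)
      · exact h1.2
    obtain ⟨N, hN, hpN, hNΩ, hc⟩ := h.right.strip.collar_top p hp Ω
      (h.left.strip.isOpen.mem_nhds hpΩ)
    refine ⟨N, hN, hpN, hc.subset_of_closure_inter_subset hA.isOpen ?_
      fun z hz => hA.closure_inter ⟨hz.1, hNΩ hz.2.1, hz.2.2⟩⟩
    obtain ⟨z, hz, hzA⟩ := mem_closure_iff.1 hpA N hN hpN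
    exact ⟨z, ⟨hz, (hA.subset hzA).2⟩, hzA⟩
  have hne : (closure A ∩ t').Nonempty := by
    by_contra hcon
    refine hA.nonempty.ne_empty (h.left.flip.eq_empty_of_closure_subset_top hA.isOpen
      (fun z hz => (hA.subset hz).1) hA.add_mem fun z hz => ?_)
    rcases h.mem_closure_cases hA hz with h1 | h1 | h1
    · exact Or.inl h1
    · exact Or.inr h1.1
    · exact (hcon ⟨z, hz, h1.1⟩).elim
  have hsub := subset_closure_of_local h.right.strip.isPreconnected_top h.right.strip.top_subset
    key hne
  rw [Set.disjoint_left]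
  intro p hpQ hp
  obtain ⟨N, hN, hpN, hNA⟩ := key p hp (hsub hp)
  obtain ⟨z, hz, hzD, hzA⟩ := mem_closure_iff.1 hpQ N hN hpN
  exact hzA (hNA ⟨hz, hzD.2⟩)

lemma sdiff_inter_upper_eq_empty
    (h : IsFlowPair P a Ω b t low up U V Ω' b' t' low' up' U' V' L H)
    (hA : IsCoincidenceSet P Ω Ω' U U' m A) : (Ω ∩ Ω') \ A ∩ H = ∅ := by
  have hopen : IsOpen ((Ω ∩ Ω') \ A) := by
    have : (Ω ∩ Ω') \ A = (Ω ∩ Ω') ∩ (closure A)ᶜ := by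
      ext z
      exact ⟨fun hz => ⟨hz.1, fun hz' => hz.2 (hA.closure_inter ⟨hz', hz.1⟩)⟩,
        fun hz => ⟨hz.1, fun hz' => hz.2 (subset_closure hz')⟩⟩
    rw [this]
    exact h.isOpen_inter.inter isClosed_closure.isOpen_compl
  refine h.left.eq_empty_of_closure_subset_top (hopen.inter h.isOpen_upper)
    (fun z hz => hz.1.1.1) (fun z => and_congr (and_congr (h.add_mem_inter z)
      (not_congr (hA.add_mem z))) (h.add_mem_upper z)) fun z hz => ?_
  have hzL : z ∉ L := fun hzL => by
    obtain ⟨w, hw, hwA⟩ := mem_closure_iff.1 hz L h.isOpen_lower hzL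
    exact h.disjoint.le_bot ⟨hw, hwA.2⟩
  have hzQ : z ∈ closure ((Ω ∩ Ω') \ A) := closure_mono inter_subset_left hz
  have hzA : z ∉ A := fun hzA => by
    obtain ⟨w, hw, hwQ⟩ := mem_closure_iff.1 hzQ A hA.isOpen hzA
    exact hwQ.2 hw
  have hzD : z ∈ closure (Ω ∩ Ω') := closure_mono sdiff_subset hzQ
  rcases h.left.strip.mem_closure_cases (closure_subset_left hzD) with h1 | h1 | h1
  · rcases h.right.strip.mem_closure_cases (closure_subset_right hzD) with h2 | h2 | h2
    · refine Or.inl ⟨⟨⟨h1, h2⟩, hzA⟩, ?_⟩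
      by_contra hzH
      exact hzA (h.dividing_subset hA fun h3 => h3.elim hzL hzH)
    · exact absurd (h.bot_right (Or.inr h2)) hzL
    · exact ((h.disjoint_closure_sdiff_top hA).le_bot ⟨hzQ, h2⟩).elim
  · exact absurd (h.bot_left (Or.inr h1)) hzL
  · exact Or.inr h1

lemma inter_subset (h : IsFlowPair P a Ω b t low up U V Ω' b' t' low' up' U' V' L H)
    (hA : IsCoincidenceSet P Ω Ω' U U' m A) : Ω ∩ Ω' ⊆ A := by
  intro z hz
  by_contra hzA
  have h1 := h.sdiff_inter_upper_eq_empty hA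
  have h2 := h.rotate.sdiff_inter_upper_eq_empty hA.rotate
  by_cases hzH : z ∈ H
  · exact notMem_empty z (h1 ▸ ⟨⟨hz, hzA⟩, hzH⟩)
  by_cases hzL : z ∈ L
  · exact notMem_empty z (h2 ▸ ⟨⟨hz.symm, hzA⟩, hzL⟩)
  exact hzA (h.dividing_subset hA fun h3 => h3.elim hzL hzH)

/-- If `U - U'` has a negative value, both speeds are `a` throughout and `U - U'` is constant. -/
lemma norm_eq_and_exists_const_of_neg
    (h : IsFlowPair P a Ω b t low up U V Ω' b' t' low' up' U' V' L H)
    (hneg : ∃ z ∈ closure (Ω ∩ Ω'), U z - U' z < 0) :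
    (∀ z ∈ Ω, ‖gradient U z‖ = a z) ∧ (∀ z ∈ Ω', ‖gradient U' z‖ = a z) ∧
      ∃ c, ∀ z ∈ Ω ∩ Ω', U z = U' z + c := by
  obtain ⟨p, hp, hmin⟩ := h.exists_min
  obtain ⟨z, hz, hzneg⟩ := hneg
  have hm : U p - U' p < 0 := (hmin z hz).trans_lt hzneg
  obtain ⟨hev, h1, h2⟩ := h.eventually_eq_and_norm_eq hm hmin ⟨p, hp, rfl⟩
  have hA := h.isCoincidenceSet hm hev
  refine ⟨h1, h2, U p - U' p, fun w hw => ?_⟩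
  linarith [hA.eq_const w (subset_closure (h.inter_subset hA hw))]

/-- If `U = U'` on the common stream, then each stream is contained in the other. -/
lemma subset_of_eqOn (h : IsFlowPair P a Ω b t low up U V Ω' b' t' low' up' U' V' L H)
    (heq : ∀ z ∈ closure (Ω ∩ Ω'), U z = U' z) : Ω ⊆ Ω' := by
  obtain ⟨q, hq⟩ := h.nonempty
  refine (h.left.strip.isPreconnected.subset_of_closure_inter_subset h.isOpen_inter
    ⟨q, h.subset_left hq, h.subset_left hq, h.subset_right hq⟩ ?_).trans inter_subset_right
  rintro z ⟨hz, hzΩ⟩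
  refine ⟨hzΩ, ?_⟩
  rcases h.right.strip.mem_closure_cases (closure_subset_right hz) with h1 | h1 | h1
  · exact h1
  · have := h.left.pos hzΩ
    rw [heq z hz, h.right.eq_zero z h1] at this
    exact (lt_irrefl _ this).elim
  · have := h.left.lt_one hzΩ
    rw [heq z hz, h.right.eq_one z h1] at this
    exact (lt_irrefl _ this).elim

lemma bot_subset_of_eqOn (h : IsFlowPair P a Ω b t low up U V Ω' b' t' low' up' U' V' L H)
    (heq : ∀ z ∈ closure (Ω ∩ Ω'), U z = U' z) (hΩ : Ω = Ω') : b ⊆ b' := by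
  subst hΩ
  rw [inter_self] at heq
  intro z hz
  have hzc := h.left.strip.bot_subset hz
  rcases h.right.strip.mem_closure_cases hzc with h1 | h1 | h1
  · exact absurd hz (h.left.strip.notMem_bot h1)
  · exact h1
  · have := heq z hzc
    rw [h.left.eq_zero z hz, h.right.eq_one z h1] at this
    exact absurd this zero_ne_one

/-- The dichotomy: the two flows coincide, or both have speed `a` throughout and their stream
functions differ by a constant. -/
theorem eq_or_norm_eq (h : IsFlowPair P a Ω b t low up U V Ω' b' t' low' up' U' V' L H) :
    (Ω = Ω' ∧ b = b' ∧ t = t' ∧ EqOn U U' (closure Ω)) ∨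
    ((∀ z ∈ Ω, ‖gradient U z‖ = a z) ∧ (∀ z ∈ Ω', ‖gradient U' z‖ = a z) ∧
      ∃ c, ∀ z ∈ Ω ∩ Ω', U z = U' z + c) := by
  by_cases h1 : ∃ z ∈ closure (Ω ∩ Ω'), U z - U' z < 0
  · exact Or.inr (h.norm_eq_and_exists_const_of_neg h1)
  by_cases h2 : ∃ z ∈ closure (Ω' ∩ Ω), U' z - U z < 0
  · obtain ⟨h3, h4, c, hc⟩ := h.swap.norm_eq_and_exists_const_of_neg h2
    exact Or.inr ⟨h4, h3, -c, fun z hz => by linarith [hc z hz.symm]⟩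
  push Not at h1 h2
  have heq : ∀ z ∈ closure (Ω ∩ Ω'), U z = U' z := fun z hz => by
    have h3 := h1 z hz
    have h4 := h2 z (inter_comm Ω Ω' ▸ hz)
    linarith
  have heq' : ∀ z ∈ closure (Ω' ∩ Ω), U' z = U z := fun z hz =>
    (heq z (inter_comm Ω Ω' ▸ hz)).symm
  have hΩ : Ω = Ω' := (h.subset_of_eqOn heq).antisymm (h.swap.subset_of_eqOn heq')
  refine Or.inl ⟨hΩ, (h.bot_subset_of_eqOn heq hΩ).antisymm
    (h.swap.bot_subset_of_eqOn heq' hΩ.symm), ?_, ?_⟩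
  · exact (h.swap.rotate.bot_subset_of_eqOn (fun z hz => by rw [heq z hz]) hΩ).antisymm
      (h.rotate.bot_subset_of_eqOn (fun z hz => by rw [heq' z hz]) hΩ.symm)
  · intro z hz
    refine heq z ?_
    rwa [← hΩ, inter_self]

end IsFlowPair

/-! ### Classical solutions -/

lemma continuous_laplacian {u : ℂ → ℝ} (hu : ContDiff ℝ 2 u) :
    Continuous (Laplacian.laplacian u) := by
  have h1 : Continuous (fderiv ℝ (fderiv ℝ u)) :=
    ((hu.fderiv_right (m := 1) (by norm_num)).fderiv_right (m := 0) (by norm_num)).continuous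
  have h2 : Laplacian.laplacian u = fun z => secondDeriv u z 1 + secondDeriv u z I :=
    funext fun z => laplacian_eq_secondDeriv u z
  rw [h2]
  simp only [secondDeriv]
  fun_prop

/-- An arc above `Γ` has `Γ` and everything below it in its lower complement. -/
lemma PeriodicArc.IsC1.lower_union_trace_subset {P : ℝ} (hP : 0 < P) {Γ γ : PeriodicArc P}
    (h : Γ.IsC1) (hγ : γ.trace ⊆ Γ.upper) : Γ.lower ∪ Γ.trace ⊆ γ.lower := by
  have hγl : ∀ z ∈ Γ.lower, z ∈ γ.lower ∪ γ.upper := fun z hz => by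
    rw [γ.lower_union_upper]
    exact fun hz' => Γ.disjoint_lower_upper.le_bot ⟨hz, hγ hz'⟩
  have hlow : Γ.lower ⊆ γ.lower := by
    obtain ⟨C, hC, -⟩ := Γ.exists_im_bound hP
    obtain ⟨C', hC', -⟩ := γ.exists_im_bound hP
    refine (h.isPreconnected_lower hP).subset_left_of_subset_union (γ.isOpen_lower hP)
      (γ.isOpen_upper hP) γ.disjoint_lower_upper hγl ⟨(-max C C' - 1 : ℝ) * I, hC _ ?_, hC' _ ?_⟩
    · simp only [im_ofReal_mul, I_im]; linarith [le_max_left C C']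
    · simp only [im_ofReal_mul, I_im]; linarith [le_max_right C C']
  refine union_subset hlow fun z hz => ?_
  have hz1 : z ∈ γ.lower ∪ γ.upper := by
    rw [γ.lower_union_upper]
    exact fun hz' => (hγ hz').1 hz
  refine hz1.resolve_right fun hzu => ?_
  obtain ⟨w, hw, hwl⟩ := mem_closure_iff.1 (h.trace_subset_closure_lower hP hz) _
    (γ.isOpen_upper hP) hzu
  exact γ.disjoint_lower_upper.le_bot ⟨hlow hwl, hw⟩

lemma PeriodicArc.IsC1.upper_union_trace_subset {P : ℝ} (hP : 0 < P) {Γ γ : PeriodicArc P}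
    (h : Γ.IsC1) (hγ : γ.trace ⊆ Γ.lower) : Γ.upper ∪ Γ.trace ⊆ γ.upper := by
  have hγu : ∀ z ∈ Γ.upper, z ∈ γ.upper ∪ γ.lower := fun z hz => by
    rw [union_comm, γ.lower_union_upper]
    exact fun hz' => Γ.disjoint_lower_upper.le_bot ⟨hγ hz', hz⟩
  have hupp : Γ.upper ⊆ γ.upper := by
    obtain ⟨C, -, hC⟩ := Γ.exists_im_bound hP
    obtain ⟨C', -, hC'⟩ := γ.exists_im_bound hP
    refine (h.isPreconnected_upper hP).subset_left_of_subset_union (γ.isOpen_upper hP)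
      (γ.isOpen_lower hP) γ.disjoint_lower_upper.symm hγu
      ⟨(max C C' + 1 : ℝ) * I, hC _ ?_, hC' _ ?_⟩
    · simp only [im_ofReal_mul, I_im]; linarith [le_max_left C C']
    · simp only [im_ofReal_mul, I_im]; linarith [le_max_right C C']
  refine union_subset hupp fun z hz => ?_
  have hz1 : z ∈ γ.upper ∪ γ.lower := by
    rw [union_comm, γ.lower_union_upper]
    exact fun hz' => (hγ hz').1 hz
  refine hz1.resolve_right fun hzu => ?_
  obtain ⟨w, hw, hwl⟩ := mem_closure_iff.1 (h.trace_subset_closure_upper hP hz) _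
    (γ.isOpen_lower hP) hzu
  exact γ.disjoint_lower_upper.le_bot ⟨hw, hupp hwl⟩

namespace ArcPair

variable {P : ℝ}

lemma isOpen_region (hP : 0 < P) (Γ : ArcPair P) : IsOpen Γ.region :=
  (Γ.top.isOpen_lower hP).inter (Γ.bot.isOpen_upper hP)

lemma Inside.mem_region {Γ B : ArcPair P} (h : Γ.Inside B) {z : ℂ} (hz : z ∈ Γ.region)
    (hb : z ∉ B.bot.trace) (ht : z ∉ B.top.trace) : z ∈ B.region := by
  constructor
  · have h1 : z ∈ B.top.lower ∪ B.top.upper := by rw [B.top.lower_union_upper]; exact ht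
    rcases h.2 with h2 | h2
    · exact h2 (subset_closure hz.1)
    · exact h1.resolve_right fun h3 =>
        Γ.top.disjoint_lower_upper.le_bot ⟨hz.1, h2 (subset_closure h3)⟩
  · have h1 : z ∈ B.bot.lower ∪ B.bot.upper := by rw [B.bot.lower_union_upper]; exact hb
    rcases h.1 with h2 | h2
    · exact h1.resolve_left fun h3 =>
        Γ.bot.disjoint_lower_upper.le_bot ⟨h2 (subset_closure h3), hz.2⟩
    · exact h2 (subset_closure hz.2)

/-- The region of a pair inside `B` is contained in the region of `B`, up to a nowhere dense set
(which is in fact empty, by the Jordan curve theorem for the arcs of `B`). -/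
lemma Inside.region_subset_closure (hP : 0 < P) {Γ B : ArcPair P} (h : Γ.Inside B) :
    Γ.region ⊆ closure (Γ.region ∩ B.region) := by
  intro z hz
  have h1 : interior (B.bot.trace ∪ B.top.trace) = ∅ := by
    rw [interior_union_isClosed_of_interior_empty (B.bot.isClosed_trace hP)
      (B.top.interior_trace_eq_empty hP), B.bot.interior_trace_eq_empty hP]
  have h2 : Dense (B.bot.trace ∪ B.top.trace)ᶜ := interior_eq_empty_iff_dense_compl.1 h1
  refine closure_mono ?_ (h2.open_subset_closure_inter (Γ.isOpen_region hP) hz)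
  rintro w ⟨hw, hw'⟩
  exact ⟨hw, h.mem_region hw (fun h3 => hw' (Or.inl h3)) fun h3 => hw' (Or.inr h3)⟩

end ArcPair

/-- A subharmonic `C²` function in an open set has nonnegative Laplacian there. -/
lemma SubharmonicOn.laplacian_nonneg {u : ℂ → ℝ} {G : Set ℂ} (h : SubharmonicOn u G)
    (hG : IsOpen G) (hu : ContDiff ℝ 2 u) {z : ℂ} (hz : z ∈ G) :
    0 ≤ Laplacian.laplacian u z := by
  obtain ⟨r, hr, hball⟩ := Metric.isOpen_iff.1 hG z hz
  exact laplacian_nonneg_of_le_circleAverage hr hu.contDiffAt fun s hs hsr =>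
    h.2 z s hs ((Metric.closedBall_subset_ball hsr).trans hball)

/-- The mean value property rules out strict subharmonicity. -/
lemma StrictSubharmonicOn.eq_empty_of_harmonicOnNhd {u : ℂ → ℝ} {G D : Set ℂ}
    (h : StrictSubharmonicOn u G) (hD : IsOpen D) (hDG : D ⊆ G)
    (hu : InnerProductSpace.HarmonicOnNhd u D) : D = ∅ := by
  by_contra hne
  obtain ⟨z, hz⟩ := nonempty_iff_ne_empty.2 hne
  obtain ⟨r, hr, hball⟩ := Metric.isOpen_iff.1 hD z hz
  have hsub : Metric.closedBall z (r / 2) ⊆ D :=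
    (Metric.closedBall_subset_ball (by linarith)).trans hball
  have h1 := h.2 z (r / 2) (by linarith) (hsub.trans hDG)
  rw [InnerProductSpace.HarmonicOnNhd.circleAverage_eq (f := u) (c := z) (R := r / 2) (by
    rw [abs_of_pos (by linarith)]; exact hu.mono hsub)] at h1
  exact lt_irrefl _ h1

/-- A classical solution is a flow in the strip between its arcs. -/
lemma IsClassicalSolution.exists_isFlow {P : ℝ} (hP : 0 < P) {B Γ : ArcPair P} {a : ℂ → ℝ}
    (ha_pos : ∀ p, 0 < a p) (ha_smooth : ContDiff ℝ 2 a) (ha_per : ∀ p, a (p + (P : ℂ)) = a p)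
    (ha_sub : SubharmonicOn (fun p => Real.log (a p)) B.region) (hΓ : Γ.Inside B) {U : ℂ → ℝ}
    (h : IsClassicalSolution a Γ U) :
    ∃ V, IsFlow P a Γ.region Γ.bot.trace Γ.top.trace Γ.bot.lower Γ.top.upper U V := by
  obtain ⟨V, hV, hVU, hVa⟩ := h.bernoulli
  have hlog : ContDiff ℝ 2 fun p => Real.log (a p) := ha_smooth.log fun p => (ha_pos p).ne'
  refine ⟨V, Γ.isStrip_region hP h.bot_c1 h.top_c1, hP, ha_pos, ha_per, ha_smooth, fun z hz => ?_,
    h.potential.continuousOn, h.potential.periodic, h.potential.harmonic, h.potential.eq_zero,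
    h.potential.eq_one, hV, hVU, hVa⟩
  have hcl : IsClosed {z | 0 ≤ Laplacian.laplacian (fun p => Real.log (a p)) z} :=
    isClosed_le continuous_const (continuous_laplacian hlog)
  exact closure_minimal (fun w hw => ha_sub.laplacian_nonneg (B.isOpen_region hP) hlog hw.2) hcl
    (hΓ.region_subset_closure hP hz)

open InnerProductSpace in
lemma IsFlow.harmonicAt_log_speed {P : ℝ} {a : ℂ → ℝ} {Ω b t low up : Set ℂ} {U : ℂ → ℝ}
    {V : ℂ → ℂ} (h : IsFlow P a Ω b t low up U V) (ha : ∀ z ∈ Ω, ‖gradient U z‖ = a z) {z : ℂ}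
    (hz : z ∈ Ω) : HarmonicAt (fun p => Real.log (a p)) z := by
  refine (harmonicAt_congr_nhds ?_).1 (h.harmonicAt_log_norm_gradient hz)
  filter_upwards [h.strip.isOpen.mem_nhds hz] with w hw
  rw [ha w hw]

open InnerProductSpace in
/-- Harmonic functions that differ by a constant on the overlap of two open sets define a harmonic
function on the union. -/
lemma exists_harmonicOnNhd_union {Ω Ω' : Set ℂ} (hΩ : IsOpen Ω) (hΩ' : IsOpen Ω') {U U' a : ℂ → ℝ}
    (hU : HarmonicOnNhd U Ω) (hU' : HarmonicOnNhd U' Ω') (hUa : ∀ z ∈ Ω, ‖gradient U z‖ = a z)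
    (hUa' : ∀ z ∈ Ω', ‖gradient U' z‖ = a z) {c : ℝ} (hc : ∀ z ∈ Ω ∩ Ω', U z = U' z + c) :
    ∃ W : ℂ → ℝ, HarmonicOnNhd W (Ω ∪ Ω') ∧ ∀ z ∈ Ω ∪ Ω', ‖gradient W z‖ = a z := by
  classical
  set W : ℂ → ℝ := fun z => if z ∈ Ω then U z else U' z + c with hW
  have h1 : ∀ z ∈ Ω, W =ᶠ[𝓝 z] U := fun z hz => by
    filter_upwards [hΩ.mem_nhds hz] with w hw
    exact if_pos hw
  have h2 : ∀ z ∈ Ω', W =ᶠ[𝓝 z] fun w => U' w + c := fun z hz => by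
    filter_upwards [hΩ'.mem_nhds hz] with w hw
    by_cases hwΩ : w ∈ Ω
    · rw [hW]; simp only [if_pos hwΩ]; exact hc w ⟨hwΩ, hw⟩
    · exact if_neg hwΩ
  refine ⟨W, fun z hz => ?_, fun z hz => ?_⟩
  · rcases hz with hz | hz
    · exact (harmonicAt_congr_nhds (h1 z hz)).2 (hU z hz)
    · exact (harmonicAt_congr_nhds (h2 z hz)).2 ((hU' z hz).add (harmonicAt_const c))
  · rcases hz with hz | hz
    · rw [(h1 z hz).gradient_eq, hUa z hz]
    · rw [(h2 z hz).gradient_eq, ← hUa' z hz, gradient, gradient, fderiv_add_const]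

/-- Two classical solutions with a common dividing arc form a pair of flows. -/
lemma exists_isFlowPair {P : ℝ} (hP : 0 < P) {B : ArcPair P} {a : ℂ → ℝ}
    (ha_pos : ∀ p, 0 < a p) (ha_smooth : ContDiff ℝ 2 a) (ha_per : ∀ p, a (p + (P : ℂ)) = a p)
    (ha_sub : SubharmonicOn (fun p => Real.log (a p)) B.region)
    {Γ₁ Γ₂ : ArcPair P} {U₁ U₂ : ℂ → ℝ} (hΓ₁ : Γ₁.Inside B) (hΓ₂ : Γ₂.Inside B)
    (hU₁ : IsClassicalSolution a Γ₁ U₁) (hU₂ : IsClassicalSolution a Γ₂ U₂)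
    {γ : PeriodicArc P} (hγ₁ : γ.trace ⊆ Γ₁.region) (hγ₂ : γ.trace ⊆ Γ₂.region) :
    ∃ V₁ V₂, IsFlowPair P a Γ₁.region Γ₁.bot.trace Γ₁.top.trace Γ₁.bot.lower Γ₁.top.upper U₁ V₁
      Γ₂.region Γ₂.bot.trace Γ₂.top.trace Γ₂.bot.lower Γ₂.top.upper U₂ V₂ γ.lower γ.upper := by
  obtain ⟨V₁, h₁⟩ := hU₁.exists_isFlow hP ha_pos ha_smooth ha_per ha_sub hΓ₁
  obtain ⟨V₂, h₂⟩ := hU₂.exists_isFlow hP ha_pos ha_smooth ha_per ha_sub hΓ₂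
  have hγ : (γ.lower ∪ γ.upper)ᶜ = γ.trace := by rw [γ.lower_union_upper, compl_compl]
  exact ⟨V₁, V₂, h₁, h₂, γ.isOpen_lower hP, γ.isOpen_upper hP, γ.disjoint_lower_upper,
    hγ ▸ γ.isPreconnected_trace, hγ ▸ γ.trace_nonempty, hγ ▸ hγ₁, hγ ▸ hγ₂,
    fun z => γ.add_mem_lower_and_upper.1, fun z => γ.add_mem_lower_and_upper.2,
    hU₁.bot_c1.lower_union_trace_subset hP fun z hz => (hγ₁ hz).2,
    hU₂.bot_c1.lower_union_trace_subset hP fun z hz => (hγ₂ hz).2,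
    hU₁.top_c1.upper_union_trace_subset hP fun z hz => (hγ₁ hz).1,
    hU₂.top_c1.upper_union_trace_subset hP fun z hz => (hγ₂ hz).1⟩

theorem mainTheorem2 (P : ℝ) (hP : 0 < P)
    -- the strip-like domain `G`, given by its lower and upper boundary arcs
    (B : ArcPair P)
    -- the flow-speed
    (a : ℂ → ℝ) (ha_pos : ∀ p, 0 < a p) (ha_smooth : ContDiff ℝ 2 a)
    (ha_per : ∀ p, a (p + (P : ℂ)) = a p)
    (ha_sub : SubharmonicOn (fun p => Real.log (a p)) B.region)
    -- two classical solutions in `X(G)`, with their stream functions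
    (Γ₁ Γ₂ : ArcPair P) (U₁ U₂ : ℂ → ℝ)
    (hΓ₁ : Γ₁.Inside B) (hΓ₂ : Γ₂.Inside B)
    (hU₁ : IsClassicalSolution a Γ₁ U₁) (hU₂ : IsClassicalSolution a Γ₂ U₂)
    -- a periodic arc contained in both stream-beds
    (γ : PeriodicArc P) (hγ₁ : γ.trace ⊆ Γ₁.region) (hγ₂ : γ.trace ⊆ Γ₂.region) :
    (¬ Γ₁.Same Γ₂ →
      (∀ p ∈ Γ₁.region, ‖gradient U₁ p‖ = a p) ∧
      (∀ p ∈ Γ₂.region, ‖gradient U₂ p‖ = a p) ∧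
      IsConnected (Γ₁.region ∪ Γ₂.region) ∧
      InnerProductSpace.HarmonicOnNhd (fun p => Real.log (a p)) (Γ₁.region ∪ Γ₂.region) ∧
      ∃ U : ℂ → ℝ, InnerProductSpace.HarmonicOnNhd U (Γ₁.region ∪ Γ₂.region) ∧
        ∀ p ∈ Γ₁.region ∪ Γ₂.region, ‖gradient U p‖ = a p) ∧
    (StrictSubharmonicOn (fun p => Real.log (a p)) B.region →
      Γ₁.Same Γ₂ ∧ Γ₁.region = Γ₂.region ∧ EqOn U₁ U₂ (closure Γ₁.region)) := by
  obtain ⟨V₁, V₂, h⟩ := exists_isFlowPair hP ha_pos ha_smooth ha_per ha_sub hΓ₁ hΓ₂ hU₁ hU₂ hγ₁ hγ₂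
  obtain ⟨q, hq⟩ := γ.trace_nonempty
  constructor
  · intro hne
    obtain ⟨-, hb, ht, -⟩ | ⟨hn₁, hn₂, c, hc⟩ := h.eq_or_norm_eq
    · exact absurd ⟨hb, ht⟩ hne
    refine ⟨hn₁, hn₂, IsConnected.union ⟨q, hγ₁ hq, hγ₂ hq⟩ ⟨⟨q, hγ₁ hq⟩,
      h.left.strip.isPreconnected⟩ ⟨⟨q, hγ₂ hq⟩, h.right.strip.isPreconnected⟩, fun z hz => ?_,
      exists_harmonicOnNhd_union h.left.strip.isOpen h.right.strip.isOpen h.left.harmonic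
        h.right.harmonic hn₁ hn₂ hc⟩
    exact hz.elim (h.left.harmonicAt_log_speed hn₁) (h.right.harmonicAt_log_speed hn₂)
  · intro hstrict
    obtain ⟨hΩ, hb, ht, hU⟩ | ⟨hn₁, -, -⟩ := h.eq_or_norm_eq
    · exact ⟨⟨hb, ht⟩, hΩ, hU⟩
    -- `log a` would be harmonic in the first stream, which overlaps the region of `B`
    have hempty := hstrict.eq_empty_of_harmonicOnNhd
      ((Γ₁.isOpen_region hP).inter (B.isOpen_region hP)) inter_subset_right
      fun z hz => h.left.harmonicAt_log_speed hn₁ hz.1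
    have hq' := hΓ₁.region_subset_closure hP (hγ₁ hq)
    rw [hempty, closure_empty] at hq'
    exact hq'.elim
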